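/- **Setting.** Let $\mathbb R^4_1$ be Minkowski space with $\langle x,x\rangle=-2x^1x^4+(x^2)^2+(x^3)^2$, time orientation $x^1+x^4>0$ and positive light cone $\mathcal L^+$, and let $L=\mathbb R^4\rtimes SO_0(3,1)$. The space $\Lambda=\mathbb R^3\times S^2$ of contact elements is identified with the set of null lines of $\mathbb R^4_1=\mathbb R^3\times\mathbb R$ by $(x,n)\mapsto\{(x-tn,t):t\in\mathbb R\}$; $[b_0,b_1]$ denotes the line through $b_0$ with direction $b_1$. Let $M$ be a smooth surface and $F=(f,n):M\to\Lambda$ an immersion with $df\cdot n=0$ and $\mathrm{III}=dn\cdot dn$ positive definite. $F$ is *L-isothermic* if for a complex structure compatible with $\mathrm{III}$ there are a holomorphic quadratic differential $q$ and a smooth real function $\mu$ such that $\mathrm{II}=-df\cdot dn$ satisfies $\mathrm{II}^{(2,0)}=\mu q$. A *principal frame* along $F$ on an open set $U\subset M$ is a smooth map $A=(a_0;a_1,\dots,a_4):U\to L$ with $F=[a_0,a_1]$ whose connection form $\alpha=A^{-1}dA=((\alpha^i_0),(\alpha^i_j))$ satisfies $\alpha^2_0\wedge\alpha^2_1=\alpha^3_0\wedge\alpha^3_1=0$.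 For such a frame let $*$ be the Hodge operator with $*\alpha^2_1=\alpha^3_1$, $*\alpha^3_1=-\alpha^2_1$, and for a smooth positive function $\rho$ with $$2(\alpha^1_1-*\alpha^3_2)=-d\log\rho \qquad (\ast)$$ let $\alpha'_\rho$ be the matrix obtained from $\alpha'=(\alpha^i_j)_{1\le i,j\le4}$ by replacing $\alpha^1_2,\alpha^2_4$ by $\alpha^1_2+\rho\alpha^2_1$ and $\alpha^1_3,\alpha^3_4$ by $\alpha^1_3-\rho\alpha^3_1$. A *sphere congruence with envelopes* $F,\hat F$ (Legendre immersions) is a space-like immersion $S$ into $\mathbb R^4_1$ such that, at each $p$, $F(p)$ and $\hat F(p)$ are two distinct null lines through $S(p)$. It is *Darboux* if the correspondence between the envelopes preserves curvature lines (at each point there are two independent directions, orthogonal for $\mathrm{III}$, that are principal for both envelopes) and is conformal for the third fundamental forms; it is *nondegenerate* if the envelopes have opposite orientations, i.e. the second fundamental forms of $S$ in its two null normal directions have determinants of opposite sign. L-isothermic immersions $F,\hat F$ that envelope a nondegenerate Darboux congruence are *Bianchi–Darboux transforms* of each other. **Theorem 3.** Let $F:M\to\Lambda$ be an L-isothermic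 immersion, with polarization $q$ and function $\mu$ as above, and let $A$ be any principal frame along $F$ on an open set $U\subset M$. 1. If $q$ has no zeros on $U$ and, at every point near which $\mu$ vanishes identically, $q$ is real on the direction $\alpha^3_1=0$, then there is a smooth positive function $\rho$ on $U$ satisfying $(\ast)$. Now let $\rho$ be any smooth positive function on $U$ satisfying $(\ast)$. 2. The linear system $dv=-\alpha'_\rho v$ is completely integrable: for $p\in U$ and $v_0\in\mathbb R^4_1$ there is a smooth solution $v$ near $p$ with $v(p)=v_0$, and it can be taken with values in $\mathcal L^+$ if $v_0\in\mathcal L^+$. 3. For any solution $v:W\to\mathcal L^+$ on an open set $W\subset U$, the 1-form $\gamma=v^2\alpha^2_0+v^3\alpha^3_0-v^4\alpha^1_0$ is closed. If $r$ is a smooth function on $W$ with $dr=\gamma$ and $v^4\ne0$ on $W$, put $s=r/v^4$; then $$\hat F=\Bigl[a_0+s\,a_1,\ \sum_{i=1}^4 v^i a_i\Bigr]:W\to\Lambda$$ is an L-isothermic immersion. If moreover $a_0+s\,a_1$ is an immersion on $W$, then it is a nondegenerate Darboux congruence enveloped by $F$ and $\hat F$, so that $\hat F$ is a Bianchi–Darboux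 transform of $F$ on $W$. 4. Every $p\in U$ has an open neighbourhood $W\subset U$ on which there are a solution $v:W\to\mathcal L^+$ with $v^4\neq0$ and a function $r$ with $dr=\gamma$ for which $a_0+s\,a_1$ is an immersion. Finally, every point $p$ with $q_p\ne0$ has an open neighbourhood on which there are a principal frame along $F$ and a function $\rho$ satisfying $(\ast)$, and on which $F$ has a Bianchi–Darboux transform. -/

import Mathlib

open Set Filter Topology
open scoped Manifold ContDiff

noncomputable section

namespace Laguerre

/-! ### Minkowski space, the light cone, the Laguerre group -/

/-- Minkowski 4-space `ℝ⁴₁`, in the null coordinates `x¹, …, x⁴` (indexed here by `0, 1, 2, 3`). -/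
abbrev R41 := Fin 4 → ℝ

/-- Euclidean 3-space. -/
abbrev E3 := EuclideanSpace ℝ (Fin 3)

/-- The Lorentz scalar product, the polarization of `-2 x¹ x⁴ + (x²)² + (x³)²`. -/
def lor (u w : R41) : ℝ := -(u 0 * w 3) - u 3 * w 0 + u 1 * w 1 + u 2 * w 2

/-- The positive light cone `𝓛⁺`; the time orientation is `x¹ + x⁴ > 0`. -/
def lightCone : Set R41 := {v | lor v v = 0 ∧ 0 < v 0 + v 3}

/-- The matrix with columns `a 0, …, a 3`. -/
def frameMatrix (a : Fin 4 → R41) : Matrix (Fin 4) (Fin 4) ℝ := (Matrix.of a).transpose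

/-- `SO₀(3,1)`: the linear maps which preserve the Lorentz product, the orientation and the
time orientation. -/
def properLorentz : Set (Matrix (Fin 4) (Fin 4) ℝ) :=
  {a | (∀ u w : R41, lor (a.mulVec u) (a.mulVec w) = lor u w) ∧ a.det = 1 ∧
    ∀ v ∈ lightCone, a.mulVec v ∈ lightCone}

/-- The point of `ℝ⁴₁ = ℝ³ × ℝ` with space part `x` and time `t` (the oriented sphere with centre
`x` and signed radius `t`), in null coordinates. -/
def sphereVec (x : E3) (t : ℝ) : R41 :=
  ![(t + x 0) / Real.sqrt 2, x 1, x 2, (t - x 0) / Real.sqrt 2]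

/-- The affine line through `b₀` with direction `b₁`, written `[b₀, b₁]`. -/
def affLine (b₀ b₁ : R41) : Set R41 := {y | ∃ t : ℝ, y = b₀ + t • b₁}

/-- The space `Λ = ℝ³ × S²` of contact elements. -/
structure ContactElement where
  pt : E3
  normal : E3
  norm_normal : ‖normal‖ = 1

/-- The null line `{(x - t n, t)}` of a contact element `(x, n)`. -/
def ContactElement.line (e : ContactElement) : Set R41 :=
  {y | ∃ t : ℝ, y = sphereVec (e.pt - t • e.normal) t}

/-- The future pointing null direction `(-n, 1)` of the line of `(x, n)`. -/
def ContactElement.dir (e : ContactElement) : R41 := sphereVec (-e.normal) 1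

/-! ### Surfaces -/

/-- The model space of surfaces. -/
abbrev E2 := EuclideanSpace ℝ (Fin 2)

variable {M : Type*} [TopologicalSpace M] [ChartedSpace E2 M]

/-- The tangent space of the surface `M` at `p`. -/
abbrev T (p : M) : Type := TangentSpace (𝓡 2) p

/-- The differential of a map from a surface to a vector space. -/
def dd {V : Type*} [NormedAddCommGroup V] [NormedSpace ℝ V] (f : M → V) (p : M) :
    T p →L[ℝ] V :=
  mfderiv (𝓡 2) 𝓘(ℝ, V) f p

/-- `f` is smooth on `U`. -/
def SmoothOn {V : Type*} [NormedAddCommGroup V] [NormedSpace ℝ V] (U : Set M) (f : M → V) : Prop :=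
  ContMDiffOn (𝓡 2) 𝓘(ℝ, V) ∞ f U

/-- The coefficients of a 1-form in the preferred chart at `p`. -/
def chartForm (γ : (x : M) → T x →L[ℝ] ℝ) (p : M) (y : E2) : E2 →L[ℝ] ℝ :=
  (γ ((extChartAt (𝓡 2) p).symm y)).comp
    (mfderiv 𝓘(ℝ, E2) (𝓡 2) (extChartAt (𝓡 2) p).symm y)

/-- The 1-form `γ` is closed on `U`: `dγ = 0`, where `dγ` is computed in charts. -/
def IsClosedForm (U : Set M) (γ : (x : M) → T x →L[ℝ] ℝ) : Prop :=
  ∀ p ∈ U, DifferentiableAt ℝ (chartForm γ p) (extChartAt (𝓡 2) p p) ∧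
    ∀ u w : E2, fderiv ℝ (chartForm γ p) (extChartAt (𝓡 2) p p) u w =
      fderiv ℝ (chartForm γ p) (extChartAt (𝓡 2) p p) w u

/-! ### Legendre immersions and L-isothermic immersions -/

/-- The third fundamental form `dn · dn` of `F = (f, n)`. -/
def thirdForm (F : M → ContactElement) (p : M) (X Y : T p) : ℝ :=
  inner ℝ (dd (fun x => (F x).normal) p X) (dd (fun x => (F x).normal) p Y)

/-- The second fundamental form `- df · dn` of `F = (f, n)`. -/
def secondForm (F : M → ContactElement) (p : M) (X Y : T p) : ℝ :=
  -inner ℝ (dd (fun x => (F x).pt) p X) (dd (fun x => (F x).normal) p Y)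

/-- `F = (f, n)` is, on `U`, a smooth immersion into `Λ` with `df · n = 0`. -/
structure IsLegendreImmersion (U : Set M) (F : M → ContactElement) : Prop where
  smooth_pt : SmoothOn U (fun x => (F x).pt)
  smooth_normal : SmoothOn U (fun x => (F x).normal)
  contact : ∀ p ∈ U, ∀ X : T p, inner ℝ (dd (fun x => (F x).pt) p X) (F p).normal = 0
  immersion : ∀ p ∈ U, ∀ X : T p, dd (fun x => (F x).pt) p X = 0 →
    dd (fun x => (F x).normal) p X = 0 → X = 0

/-- The part of type `(2,0)`, with respect to the complex structure `J`, of a real symmetric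
bilinear form `B` on a tangent plane, evaluated on `(X, X)`. -/
def part20 {p : M} (J : T p →L[ℝ] T p) (B : T p → T p → ℝ) (X : T p) : ℂ :=
  (((B X X - B (J X) (J X)) / 4 : ℝ) : ℂ) - ((B X (J X) / 2 : ℝ) : ℂ) * Complex.I

/-- `J` is a complex structure on the open set `U` and `q` is a holomorphic quadratic differential
for `J`: around every point there are a complex coordinate `z`, holomorphic for `J`, and a
holomorphic function `h` with `q = h dz²`. -/
structure IsPolarization (U : Set M) (J : (x : M) → T x →L[ℝ] T x) (q : (x : M) → T x → ℂ) :
    Prop where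
  sq : ∀ p ∈ U, ∀ X : T p, J p (J p X) = -X
  holomorphic : ∀ p ∈ U, ∃ V : Set M, IsOpen V ∧ p ∈ V ∧ V ⊆ U ∧ ∃ z h : M → ℂ,
    SmoothOn V z ∧ SmoothOn V h ∧ ∀ x ∈ V,
      (∀ X : T x, dd z x X = 0 → X = 0) ∧
      (∀ X : T x, dd z x (J x X) = Complex.I * dd z x X) ∧
      (∀ X : T x, dd h x (J x X) = Complex.I * dd h x X) ∧
      (∀ X : T x, q x X = h x * (dd z x X) ^ 2)

/-- `F : (U, q) → Λ` is an L-isothermic immersion: `III` is positive definite, `J` is a complex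
structure compatible with the conformal structure of `III`, `q` is a holomorphic quadratic
differential, `μ` is a smooth real function, and the Hopf differential is `II^(2,0) = μ q`. -/
structure IsLIsothermicWith (U : Set M) (F : M → ContactElement)
    (J : (x : M) → T x →L[ℝ] T x) (q : (x : M) → T x → ℂ) (μ : M → ℝ) : Prop where
  legendre : IsLegendreImmersion U F
  third_pos : ∀ p ∈ U, ∀ X : T p, X ≠ 0 → 0 < thirdForm F p X X
  polarization : IsPolarization U J q
  conformal : ∀ p ∈ U, ∀ X : T p, thirdForm F p (J p X) (J p X) = thirdForm F p X X
  smooth_mu : SmoothOn U μ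
  hopf : ∀ p ∈ U, ∀ X : T p, part20 (J p) (secondForm F p) X = (μ p : ℂ) * q p X

/-- `F` is an L-isothermic immersion on `U`, for some polarization. -/
def IsLIsothermic (U : Set M) (F : M → ContactElement) : Prop :=
  ∃ J q μ, IsLIsothermicWith U F J q μ

/-! ### Frames -/

/-- A frame field: a position vector `a₀` and vectors `a₁, …, a₄` (here `vec 0, …, vec 3`). -/
structure FrameField (M : Type*) where
  pos : M → R41
  vec : M → Fin 4 → R41

/-- The components `α^i_0` of the translational part `a⁻¹ da₀` of the connection form
`α = A⁻¹ dA` (the indices `1, …, 4` are `0, …, 3` here). -/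
def FrameField.conn₀ (A : FrameField M) (p : M) (i : Fin 4) : T p →L[ℝ] ℝ :=
  ∑ k : Fin 4, (frameMatrix (A.vec p))⁻¹ i k •
    (ContinuousLinearMap.proj (R := ℝ) (φ := fun _ : Fin 4 => ℝ) k).comp (dd A.pos p)

/-- The components `α^i_j` of the linear part `a⁻¹ da` of the connection form `α = A⁻¹ dA`. -/
def FrameField.conn (A : FrameField M) (p : M) (i j : Fin 4) : T p →L[ℝ] ℝ :=
  ∑ k : Fin 4, (frameMatrix (A.vec p))⁻¹ i k •
    (ContinuousLinearMap.proj (R := ℝ) (φ := fun _ : Fin 4 => ℝ) k).comp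
      (dd (fun x => A.vec x j) p)

/-- `A` is a smooth principal framing along `F` on `U`: it takes values in the Laguerre group,
`[a₀, a₁] = F`, and `α²₀ ∧ α²₁ = 0 = α³₀ ∧ α³₁`. -/
structure IsPrincipalFraming (U : Set M) (F : M → ContactElement) (A : FrameField M) : Prop where
  smooth_pos : SmoothOn U A.pos
  smooth_vec : ∀ j, SmoothOn U (fun x => A.vec x j)
  lorentz : ∀ p ∈ U, frameMatrix (A.vec p) ∈ properLorentz
  along : ∀ p ∈ U, affLine (A.pos p) (A.vec p 0) = (F p).line
  principal₂ : ∀ p ∈ U, ∀ X Y : T p,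
    A.conn₀ p 1 X * A.conn p 1 0 Y - A.conn₀ p 1 Y * A.conn p 1 0 X = 0
  principal₃ : ∀ p ∈ U, ∀ X Y : T p,
    A.conn₀ p 2 X * A.conn p 2 0 Y - A.conn₀ p 2 Y * A.conn p 2 0 X = 0

/-- `σ = *β` for the Hodge operator of the oriented conformal structure for which `θ₁, θ₂` is an
oriented orthonormal coframe: `*θ₁ = θ₂`, `*θ₂ = -θ₁`. -/
def IsHodgeStar {p : M} (θ₁ θ₂ β σ : T p →L[ℝ] ℝ) : Prop :=
  ∃ b c : ℝ, β = b • θ₁ + c • θ₂ ∧ σ = b • θ₂ - c • θ₁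

/-- `ρ` is a smooth positive function on `U` with `2 (α¹₁ - * α³₂) = - d log ρ`. -/
structure IsPotential (U : Set M) (A : FrameField M) (ρ : M → ℝ) : Prop where
  smooth : SmoothOn U ρ
  pos : ∀ p ∈ U, 0 < ρ p
  eq : ∀ p ∈ U, ∃ σ : T p →L[ℝ] ℝ,
    IsHodgeStar (A.conn p 1 0) (A.conn p 2 0) (A.conn p 2 1) σ ∧
    (2 : ℝ) • (A.conn p 0 0 - σ) = -dd (fun x => Real.log (ρ x)) p

/-- The linear part `α'_ρ` of the deformed connection form: `α¹₂` and `α²₄` are increased by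
`ρ α²₁`, and `α¹₃` and `α³₄` are decreased by `ρ α³₁`. -/
def FrameField.connRho (A : FrameField M) (ρ : M → ℝ) (p : M) (i j : Fin 4) : T p →L[ℝ] ℝ :=
  A.conn p i j + ρ p •
    (!![0, A.conn p 1 0, -A.conn p 2 0, 0;
        0, 0, 0, A.conn p 1 0;
        0, 0, 0, -A.conn p 2 0;
        0, 0, 0, 0] : Matrix (Fin 4) (Fin 4) (T p →L[ℝ] ℝ)) i j

/-- `v` is a smooth solution on `U` of the linear system `dv = -α'_ρ v`. -/
def IsSolution (U : Set M) (A : FrameField M) (ρ : M → ℝ) (v : M → R41) : Prop :=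
  SmoothOn U v ∧ ∀ p ∈ U, ∀ X : T p, ∀ i,
    dd v p X i = -∑ j, A.connRho ρ p i j X * v p j

/-- The 1-form `γ = v² α²₀ + v³ α³₀ - v⁴ α¹₀`. -/
def FrameField.gam (A : FrameField M) (v : M → R41) (p : M) : T p →L[ℝ] ℝ :=
  v p 1 • A.conn₀ p 1 + v p 2 • A.conn₀ p 2 - v p 3 • A.conn₀ p 0

/-- The sphere congruence `a₀ + s a₁` with `s = r / v⁴`. -/
def FrameField.congr (A : FrameField M) (v : M → R41) (r : M → ℝ) (p : M) : R41 :=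
  A.pos p + (r p / v p 3) • A.vec p 0

/-! ### Sphere congruences and the Bianchi–Darboux transformation -/

/-- `X` is a principal direction (a tangent of a curvature line) of `F = (f, n)` at `p`:
`X ≠ 0`, and `df(X)` and `dn(X)` are linearly dependent. -/
def IsPrincipalDirection (F : M → ContactElement) (p : M) (X : T p) : Prop :=
  X ≠ 0 ∧ ∃ a b : ℝ, (a ≠ 0 ∨ b ≠ 0) ∧
    a • dd (fun x => (F x).pt) p X + b • dd (fun x => (F x).normal) p X = 0

/-- The second fundamental form of `S` in the direction of the null normal `(-n, 1)` of the
envelope `F = (f, n)`, up to sign. -/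
def congruenceForm (S : M → R41) (F : M → ContactElement) (p : M) (X Y : T p) : ℝ :=
  lor (dd S p X) (dd (fun x => (F x).dir) p Y)

/-- The discriminant of a bilinear form on the pair `X, Y`. -/
def disc {p : M} (B : T p → T p → ℝ) (X Y : T p) : ℝ := B X X * B Y Y - B X Y * B Y X

/-- On `U`, `S` is a space-like sphere congruence with the two envelopes `F` and `G`. -/
structure IsSpacelikeCongruence (U : Set M) (S : M → R41) (F G : M → ContactElement) : Prop where
  smooth : SmoothOn U S
  spacelike : ∀ p ∈ U, ∀ X : T p, X ≠ 0 → 0 < lor (dd S p X) (dd S p X)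
  legendre_left : IsLegendreImmersion U F
  legendre_right : IsLegendreImmersion U G
  envelope_left : ∀ p ∈ U, S p ∈ (F p).line
  envelope_right : ∀ p ∈ U, S p ∈ (G p).line
  distinct : ∀ p ∈ U, (F p).line ≠ (G p).line

/-- The congruence is Darboux: it is Ribaucour, i.e. the correspondence between the two envelopes
preserves curvature lines (there are at every point two independent directions which are principal
for both envelopes, orthogonal for the third fundamental form), and the correspondence is conformal
with respect to the third fundamental forms. -/
structure IsDarbouxCongruence (U : Set M) (S : M → R41) (F G : M → ContactElement) : Prop
    extends IsSpacelikeCongruence U S F G where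
  ribaucour : ∀ p ∈ U, ∃ X Y : T p, LinearIndependent ℝ ![X, Y] ∧ thirdForm F p X Y = 0 ∧
    IsPrincipalDirection F p X ∧ IsPrincipalDirection F p Y ∧
    IsPrincipalDirection G p X ∧ IsPrincipalDirection G p Y
  conformal : ∀ p ∈ U, ∃ c : ℝ, 0 < c ∧ ∀ X Y : T p, thirdForm G p X Y = c * thirdForm F p X Y

/-- A Darboux congruence is nondegenerate if its two envelopes have opposite orientations: the
tangential parts `T_pM → dS(T_pM)` of the differentials of the two null normals have determinants
of opposite signs. -/
structure IsNondegenerateDarboux (U : Set M) (S : M → R41) (F G : M → ContactElement) : Prop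
    extends IsDarbouxCongruence U S F G where
  opposite : ∀ p ∈ U, ∀ X Y : T p, LinearIndependent ℝ ![X, Y] →
    disc (congruenceForm S F p) X Y * disc (congruenceForm S G p) X Y < 0

/-- `F` and `G` are Bianchi–Darboux transforms of each other on `U`. -/
def IsBianchiDarboux (U : Set M) (F G : M → ContactElement) : Prop :=
  IsLIsothermic U F ∧ IsLIsothermic U G ∧ ∃ S, IsNondegenerateDarboux U S F G

end Laguerre

end

open Laguerre

/-! Notation as in the theorem: `vec 0` is a₁, so `conn p 1 0` is θ₂ = α²₁, `conn p 2 0` is θ₃ =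
α³₁, `conn p 2 1` is α³₂. Further, w = ∑ vⁱaᵢ and S = a₀ + s a₁.

The contact condition is α⁴₀ = 0, and III is a positive multiple of θ₂² + θ₃². Hence θ₂, θ₃ is a
coframe, and a principal frame has α²₀ = aθ₂, α³₀ = bθ₃, so that II is diagonal in θ₂, θ₃.

Existence of ρ. Let e be dual to θ₂ and κ = q(e). Since II is diagonal, μκ is real, so κ is real
wherever μ ≠ 0 and, by continuity, at limits of such points; the remaining points are covered by the
hypothesis on q. Holomorphy of q is one complex first-order equation for κ. When κ is real it splits
into two real equations, which say d log|κ| = -2(α¹₁ - *α³₂), so ρ = |κ| works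
(`exists_local_coefficient`, `exists_isPotential`).

Integrability. Let N be the matrix added to α'. Condition (∗) makes dN cancel α'∧N + N∧α', while N∧N
= 0 because only θ₂∧θ₂ and θ₃∧θ₃ occur. So α'_ρ is flat (`hasExtDeriv_connRho`) and Frobenius'
theorem applies. Moreover N lies in the Lorentz algebra, so ⟨v,v⟩ is constant along solutions.

The transform. For a solution, dw = -∑ (Nv)ⁱaᵢ is a combination of a₁, a₂, a₃ (`dd_comb`). Since γ =
⟨w, da₀⟩, its differential -ρv⁴(θ₂∧α²₀ - θ₃∧α³₀) vanishes. Since ⟨a₁,w⟩ = -v⁴ and ⟨a₁,dw⟩ = 0, one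
finds ⟨dS,w⟩ = γ - d(sv⁴) = 0, so the lines [S,w] are Legendre. Modulo a₁, dS is (a+s)θ₂a₂ +
(b+s)θ₃a₃ and dw is -ρv⁴(θ₂a₂ - θ₃a₃). The forms of the transform are therefore again diagonal in
θ₂, θ₃ and its III is conformal to that of F. This gives the Darboux property, and the sign between
the two terms of dw gives nondegeneracy when a+s and b+s do not vanish. By (∗) also √ρθ₂ and √ρθ₃
are closed (`hasExtDeriv_sqrt_smul`), so ρ(θ₂+iθ₃)² is holomorphic, and the Hopf differential of the
transform is a real multiple of it.

Local existence. The initial value of r is free, so a+s and b+s can be made positive at p. Where q ≠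
0, write q as the square of a (1,0)-form; its real and imaginary parts give curvature directions and
hence a principal frame in which q is real. -/

noncomputable section

set_option linter.unusedSectionVars false
set_option linter.unusedVariables false
set_option linter.unusedSimpArgs false

namespace Laguerre

/-! ### Frobenius' theorem for linear systems on a normed space, by radial integration -/

section Frobenius

variable {E V : Type*} [NormedAddCommGroup E] [NormedSpace ℝ E]
  [NormedAddCommGroup V] [NormedSpace ℝ V]

/-- Uniform bounds for a `C²` map near a point: norm, Lipschitz constant, Taylor remainder. -/
theorem exists_quadratic_bounds {α : E → V} {x₀ : E} (hα : ContDiffAt ℝ 2 α x₀) :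
    ∃ C > 0, ∃ δ > 0, ∀ x ∈ Metric.ball x₀ δ, ∀ y ∈ Metric.ball x₀ δ,
      DifferentiableAt ℝ α x ∧ ‖α x‖ ≤ C ∧ ‖α y - α x‖ ≤ C * ‖y - x‖ ∧
      ‖α y - α x - fderiv ℝ α x (y - x)‖ ≤ C * ‖y - x‖ ^ 2 := by
  obtain ⟨K₁, s₁, hs₁, hl₁⟩ := (hα.of_le (m := 1) (by norm_num)).exists_lipschitzOnWith
  have h2 : ContDiffAt ℝ 1 (fderiv ℝ α) x₀ := hα.fderiv_right (by norm_num)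
  obtain ⟨K₂, s₂, hs₂, hl₂⟩ := h2.exists_lipschitzOnWith
  have hd : ∀ᶠ x in 𝓝 x₀, DifferentiableAt ℝ α x := by
    filter_upwards [(hα.of_le (m := 1) (by norm_num)).eventually (by simp)] with x hx
    exact hx.differentiableAt (by norm_num)
  have hb : ∀ᶠ x in 𝓝 x₀, ‖α x‖ < ‖α x₀‖ + 1 :=
    hα.continuousAt.norm.eventually_lt_const (by linarith)
  obtain ⟨δ, hδ, hsub⟩ := Metric.mem_nhds_iff.1
    (inter_mem (inter_mem hs₁ hs₂) (inter_mem hd hb))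
  refine ⟨max (K₁ : ℝ) (max K₂ (‖α x₀‖ + 1)), ?_, δ, hδ, fun x hx y hy => ?_⟩
  · exact lt_max_of_lt_right (lt_max_of_lt_right (by positivity))
  obtain ⟨⟨hx1, hx2⟩, hx3, hx4⟩ := hsub hx
  obtain ⟨⟨hy1, hy2⟩, -, -⟩ := hsub hy
  refine ⟨hx3, hx4.le.trans ((le_max_right _ _).trans (le_max_right _ _)), ?_, ?_⟩
  · exact (hl₁.norm_sub_le hy1 hx1).trans (by gcongr; exact le_max_left _ _)
  · have hseg : segment ℝ x y ⊆ Metric.ball x₀ δ := (convex_ball x₀ δ).segment_subset hx hy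
    have key := (convex_segment (𝕜 := ℝ) x y).norm_image_sub_le_of_norm_fderiv_le' (f := α) (φ := fderiv ℝ α x)
      (C := K₂ * ‖y - x‖) (fun z hz => (hsub (hseg hz)).2.1) (fun z hz => ?_)
      (left_mem_segment ℝ x y) (right_mem_segment ℝ x y)
    · refine key.trans ?_
      rw [mul_assoc, ← pow_two]
      gcongr
      exact (le_max_left _ _).trans (le_max_right _ _)
    · refine (hl₂.norm_sub_le (hsub (hseg hz)).1.2 hx2).trans ?_
      gcongr
      obtain ⟨t, ht, rfl⟩ := (segment_eq_image' ℝ x y ▸ hz : z ∈ _)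
      simp only [add_sub_cancel_left, norm_smul, Real.norm_eq_abs, abs_of_nonneg ht.1]
      exact mul_le_of_le_one_left (norm_nonneg _) ht.2

/-- Solutions of a linear differential equation with small coefficients on `[0, 1]`. -/
theorem exists_linear_ode_solution [CompleteSpace V] {f : ℝ → V →L[ℝ] V}
    (hf : ContinuousOn f (Icc 0 1)) (hb : ∀ t ∈ Icc (0 : ℝ) 1, ‖f t‖ ≤ 1 / 2) (v₀ : V) :
    ∃ u : ℝ → V, u 0 = v₀ ∧ ∀ t ∈ Icc (0 : ℝ) 1, HasDerivWithinAt u (f t (u t)) (Icc 0 1) t := by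
  -- On the ball of radius ‖v₀‖ about v₀ one has ‖x‖ ≤ 2‖v₀‖, so the speed is at most ‖v₀‖ and the
  -- solution cannot leave the ball during the whole unit of time.
  have h : IsPicardLindelof (fun t x => f t x) (tmin := 0) (tmax := 1) ⟨0, by simp⟩ v₀
      ‖v₀‖₊ 0 ‖v₀‖₊ (1 / 2) := by
    refine ⟨fun t ht => ?_, fun x _ => hf.clm_apply continuousOn_const, fun t ht x hx => ?_, ?_⟩
    · refine ((f t).lipschitz.weaken ?_).lipschitzOnWith
      exact_mod_cast hb t ht
    · have hx' : ‖x‖ ≤ 2 * ‖v₀‖ := by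
        have := mem_closedBall_iff_norm.1 hx
        have h3 := norm_le_norm_add_norm_sub v₀ x
        rw [norm_sub_rev] at h3
        rw [coe_nnnorm] at this
        linarith
      calc ‖f t x‖ ≤ ‖f t‖ * ‖x‖ := (f t).le_opNorm x
        _ ≤ 1 / 2 * (2 * ‖v₀‖) := mul_le_mul (hb t ht) hx' (norm_nonneg _) (by norm_num)
        _ = _ := by rw [coe_nnnorm]; ring
    · simp
  exact h.exists_eq_forall_mem_Icc_hasDerivWithinAt₀

/-- Radial solutions of a flat linear system differ, to first order, as prescribed by the
system. -/
theorem norm_radial_sub_le {α : E → E →L[ℝ] V →L[ℝ] V} {x₀ : E} {C δ B : ℝ} (hC : 0 < C)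
    (hδ1 : δ ≤ 1)
    (hα : ∀ x ∈ Metric.ball x₀ δ, ∀ y ∈ Metric.ball x₀ δ,
      DifferentiableAt ℝ α x ∧ ‖α x‖ ≤ C ∧ ‖α y - α x‖ ≤ C * ‖y - x‖ ∧
      ‖α y - α x - fderiv ℝ α x (y - x)‖ ≤ C * ‖y - x‖ ^ 2)
    (hflat : ∀ x ∈ Metric.ball x₀ δ, ∀ u w, fderiv ℝ α x u w - fderiv ℝ α x w u =
      (α x w).comp (α x u) - (α x u).comp (α x w))
    {ξ ξ' : E} (hξ : ‖ξ‖ < δ) (hξ' : ‖ξ'‖ < δ) {u u' : ℝ → V} (h0 : u 0 = u' 0)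
    (hu : ∀ t ∈ Icc (0 : ℝ) 1, HasDerivWithinAt u (-α (x₀ + t • ξ) ξ (u t)) (Icc 0 1) t)
    (hu' : ∀ t ∈ Icc (0 : ℝ) 1, HasDerivWithinAt u' (-α (x₀ + t • ξ') ξ' (u' t)) (Icc 0 1) t)
    (hB : ∀ t ∈ Icc (0 : ℝ) 1, ‖u t‖ ≤ B) :
    ‖u' 1 - u 1 + α (x₀ + ξ) (ξ' - ξ) (u 1)‖ ≤
      (2 * C + 2 * C ^ 2) * B / C * (Real.exp C - 1) * ‖ξ' - ξ‖ ^ 2 := by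
  set h := ξ' - ξ with hh
  have hmem : ∀ η : E, ‖η‖ < δ → ∀ t ∈ Icc (0 : ℝ) 1, x₀ + t • η ∈ Metric.ball x₀ δ := by
    intro η hη t ht
    rw [mem_ball_iff_norm, add_sub_cancel_left, norm_smul, Real.norm_eq_abs, abs_of_nonneg ht.1]
    exact (mul_le_of_le_one_left (norm_nonneg _) ht.2).trans_lt hη
  -- D is the error in the expected first-order variation -tα(h)u of the radial solution. It
  -- suffices to show that D satisfies a linear differential inequality with source of order ‖h‖²;
  -- this replaces differentiability of the flow in its parameters.
  set D : ℝ → V := fun t => u' t - u t + t • α (x₀ + t • ξ) h (u t) with hD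
  have hderiv : ∀ t ∈ Icc (0 : ℝ) 1, HasDerivWithinAt D
      (-α (x₀ + t • ξ') ξ' (u' t) - -α (x₀ + t • ξ) ξ (u t) +
        (t • (fderiv ℝ α (x₀ + t • ξ) ξ h (u t) + α (x₀ + t • ξ) h (-α (x₀ + t • ξ) ξ (u t))) +
          (1 : ℝ) • α (x₀ + t • ξ) h (u t))) (Icc 0 1) t := by
    intro t ht
    have hy := hmem ξ hξ t ht
    have hray : HasDerivWithinAt (fun t : ℝ => x₀ + t • ξ) ξ (Icc 0 1) t := by
      simpa using (((hasDerivAt_id t).smul_const ξ).const_add x₀).hasDerivWithinAt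
    have h1 : HasDerivWithinAt (fun t : ℝ => α (x₀ + t • ξ)) (fderiv ℝ α (x₀ + t • ξ) ξ)
        (Icc 0 1) t := 
      HasFDerivAt.comp_hasDerivWithinAt (f := fun t : ℝ => x₀ + t • ξ) (l := α) t
        (hα _ hy _ hy).1.hasFDerivAt hray
    have h2 := (h1.clm_apply (hasDerivWithinAt_const t (Icc (0 : ℝ) 1) h)).clm_apply (hu t ht)
    have h3 := ((hu' t ht).sub (hu t ht)).add ((hasDerivAt_id t).hasDerivWithinAt.smul h2)
    refine h3.congr_deriv ?_
    simp
  have hbound : ∀ t ∈ Icc (0 : ℝ) 1, ‖-α (x₀ + t • ξ') ξ' (u' t) - -α (x₀ + t • ξ) ξ (u t) +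
        (t • (fderiv ℝ α (x₀ + t • ξ) ξ h (u t) + α (x₀ + t • ξ) h (-α (x₀ + t • ξ) ξ (u t))) +
          (1 : ℝ) • α (x₀ + t • ξ) h (u t))‖ ≤
      C * ‖D t‖ + (2 * C + 2 * C ^ 2) * B * ‖h‖ ^ 2 := by
    intro t ht
    have hy := hmem ξ hξ t ht
    have hy' := hmem ξ' hξ' t ht
    obtain ⟨-, hay, hlip, hrem⟩ := hα _ hy _ hy'
    have hay' := (hα _ hy' _ hy').2.1
    have hfl := hflat _ hy ξ h
    have hyy : x₀ + t • ξ' - (x₀ + t • ξ) = t • h := by rw [hh, smul_sub]; abel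
    rw [hyy] at hlip hrem
    have hu'eq : u' t = D t + u t - t • α (x₀ + t • ξ) h (u t) := by simp only [hD]; abel
    have hξeq : ξ' = ξ + h := by rw [hh]; abel
    have hth : ‖t • h‖ ≤ ‖h‖ := by
      rw [norm_smul, Real.norm_eq_abs, abs_of_nonneg ht.1]
      exact mul_le_of_le_one_left (norm_nonneg _) ht.2
    set y := x₀ + t • ξ
    set y' := x₀ + t • ξ'
    have hident : -α y' ξ' (u' t) - -α y ξ (u t) +
        (t • (fderiv ℝ α y ξ h (u t) + α y h (-α y ξ (u t))) + (1 : ℝ) • α y h (u t)) =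
        -α y' ξ' (D t) - (α y' - α y - fderiv ℝ α y (t • h)) ξ (u t) - (α y' - α y) h (u t)
          + t • (((α y' - α y) ξ') (α y h (u t)) + α y h (α y h (u t))) := by
      -- Flatness enters here: it exchanges ξ and h in the derivative of α, which turns the
      -- first-order terms into a Taylor remainder. All that is left besides the term in D is
      -- quadratic in h.
      have e1 : fderiv ℝ α y ξ h (u t) = fderiv ℝ α y h ξ (u t) + α y h (α y ξ (u t)) -
          α y ξ (α y h (u t)) := by
        have := congrArg (fun T : V →L[ℝ] V => T (u t)) hfl
        simp only [_root_.sub_apply, ContinuousLinearMap.comp_apply] at this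
        rw [add_sub_assoc, ← this]; abel
      rw [e1, hu'eq, hξeq]
      simp only [map_add, map_sub, map_smul, map_neg, _root_.add_apply,
        _root_.sub_apply, _root_.smul_apply, smul_add, smul_sub,
        smul_neg, one_smul]
      abel
    rw [hident]
    have hBt := hB t ht
    have hB0 : 0 ≤ B := (norm_nonneg _).trans hBt
    have hξ1 : ‖ξ‖ ≤ 1 := (hξ.trans_le hδ1).le
    have hξ1' : ‖ξ'‖ ≤ 1 := (hξ'.trans_le hδ1).le
    have ap : ∀ (A : E →L[ℝ] V →L[ℝ] V) (x : E) (z : V) (a b c : ℝ), ‖A‖ ≤ a → ‖x‖ ≤ b →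
        ‖z‖ ≤ c → ‖A x z‖ ≤ a * b * c := by
      intro A x z a b c ha hb hc
      have ha0 : 0 ≤ a := (norm_nonneg A).trans ha
      have hb0 := (norm_nonneg _).trans hb
      calc ‖A x z‖ ≤ ‖A x‖ * ‖z‖ := (A x).le_opNorm z
        _ ≤ (‖A‖ * ‖x‖) * ‖z‖ := by gcongr; exact A.le_opNorm x
        _ ≤ _ := by gcongr
    have hh2 : ‖α y h (u t)‖ ≤ C * ‖h‖ * B := ap _ _ _ _ _ _ hay le_rfl hBt
    have b1 : ‖-α y' ξ' (D t)‖ ≤ C * 1 * ‖D t‖ := by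
      rw [norm_neg]; exact ap _ _ _ _ _ _ hay' hξ1' le_rfl
    have b2 := ap (α y' - α y - fderiv ℝ α y (t • h)) ξ (u t) _ _ _
      (hrem.trans (by gcongr : _ ≤ C * ‖h‖ ^ 2)) hξ1 hBt
    have hlip' := hlip.trans (by gcongr : _ ≤ C * ‖h‖)
    have b3 := ap (α y' - α y) h (u t) _ _ _ hlip' le_rfl hBt
    have b4 := ap (α y' - α y) ξ' (α y h (u t)) _ _ _ hlip' hξ1' hh2
    have b5 := ap (α y) h (α y h (u t)) _ _ _ hay le_rfl hh2
    have b6 : ‖t • (((α y' - α y) ξ') (α y h (u t)) + α y h (α y h (u t)))‖ ≤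
        C * ‖h‖ * 1 * (C * ‖h‖ * B) + C * ‖h‖ * (C * ‖h‖ * B) := by
      rw [norm_smul, Real.norm_eq_abs, abs_of_nonneg ht.1]
      exact (mul_le_of_le_one_left (norm_nonneg _) ht.2).trans ((norm_add_le _ _).trans
        (add_le_add b4 b5))
    refine (norm_add_le _ _).trans ?_
    have c1 := norm_sub_le (-α y' ξ' (D t) - (α y' - α y - fderiv ℝ α y (t • h)) ξ (u t))
      ((α y' - α y) h (u t))
    have c2 := norm_sub_le (-α y' ξ' (D t)) ((α y' - α y - fderiv ℝ α y (t • h)) ξ (u t))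
    nlinarith
  have hcont : ContinuousOn D (Icc 0 1) := fun t ht => (hderiv t ht).continuousWithinAt
  have hD0 : ‖D 0‖ ≤ 0 := by simp [hD, h0]
  have hG := norm_le_gronwallBound_of_norm_deriv_right_le hcont (fun t ht =>
    (hderiv t (Ico_subset_Icc_self ht)).mono_of_mem_nhdsWithin (Icc_mem_nhdsGE_of_mem ht))
    hD0 (fun t ht => hbound t (Ico_subset_Icc_self ht)) 1 (by simp)
  rw [gronwallBound_of_K_ne_0 hC.ne'] at hG
  simp only [hD, one_smul, sub_zero, mul_one, zero_mul, zero_add] at hG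
  refine hG.trans (le_of_eq ?_)
  ring

/-- **Frobenius' theorem** for linear systems `dv = -α v`. -/
theorem exists_hasFDerivAt_of_flat [CompleteSpace V] {α : E → E →L[ℝ] V →L[ℝ] V} {x₀ : E} {r : ℝ}
    (hr : 0 < r) (hα : ContDiffAt ℝ 2 α x₀)
    (hflat : ∀ x ∈ Metric.ball x₀ r, ∀ u w, fderiv ℝ α x u w - fderiv ℝ α x w u =
      (α x w).comp (α x u) - (α x u).comp (α x w)) (v₀ : V) :
    ∃ δ > 0, δ ≤ r ∧ ∃ v : E → V, v x₀ = v₀ ∧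
      ∀ x ∈ Metric.ball x₀ δ, HasFDerivAt v (-(α x).flip (v x)) x := by
  obtain ⟨C, hC, δ₀, hδ₀, hb⟩ := exists_quadratic_bounds hα
  -- Besides the domain of the bounds, δ ≤ 1 keeps the radial vectors of norm at most one, and δ ≤
  -- 1/(2C) makes the radial coefficients at most 1/2, as the existence of solutions on all of [0,1]
  -- requires.
  set δ := min (min r δ₀) (min 1 (1 / (2 * C)))
  have hδr : δ ≤ r := (min_le_left _ _).trans (min_le_left _ _)
  have hδδ : δ ≤ δ₀ := (min_le_left _ _).trans (min_le_right _ _)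
  have hδ1 : δ ≤ 1 := (min_le_right _ _).trans (min_le_left _ _)
  have hδC : δ ≤ 1 / (2 * C) := (min_le_right _ _).trans (min_le_right _ _)
  have hδ : 0 < δ := by positivity
  have hmem : ∀ η : E, ‖η‖ < δ → ∀ t ∈ Icc (0 : ℝ) 1, x₀ + t • η ∈ Metric.ball x₀ δ := by
    intro η hη t ht
    rw [mem_ball_iff_norm, add_sub_cancel_left, norm_smul, Real.norm_eq_abs, abs_of_nonneg ht.1]
    exact (mul_le_of_le_one_left (norm_nonneg _) ht.2).trans_lt hη
  have hsub := Metric.ball_subset_ball (x := x₀) hδδ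
  have hex : ∀ ξ : E, ∃ u : ℝ → V, u 0 = v₀ ∧ (‖ξ‖ < δ → ∀ t ∈ Icc (0 : ℝ) 1,
      HasDerivWithinAt u (-α (x₀ + t • ξ) ξ (u t)) (Icc 0 1) t) := by
    intro ξ
    by_cases hξ : ‖ξ‖ < δ
    · have hcont : ContinuousOn (fun t : ℝ => -α (x₀ + t • ξ) ξ) (Icc 0 1) := by
        intro t ht
        have hy := hsub (hmem ξ hξ t ht)
        have h1 : ContinuousAt (fun t : ℝ => α (x₀ + t • ξ)) t :=
          ContinuousAt.comp (f := fun t : ℝ => x₀ + t • ξ) (g := α)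
            (hb _ hy _ hy).1.continuousAt (by fun_prop)
        exact (h1.clm_apply continuousAt_const).neg.continuousWithinAt
      have hbd : ∀ t ∈ Icc (0 : ℝ) 1, ‖-α (x₀ + t • ξ) ξ‖ ≤ 1 / 2 := by
        intro t ht
        have hy := hsub (hmem ξ hξ t ht)
        rw [norm_neg]
        calc _ ≤ ‖α (x₀ + t • ξ)‖ * ‖ξ‖ := ContinuousLinearMap.le_opNorm _ _
          _ ≤ C * (1 / (2 * C)) := by
              gcongr
              · exact (hb _ hy _ hy).2.1
              · exact hξ.le.trans hδC
          _ = 1 / 2 := by field_simp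
      obtain ⟨u, hu0, hu⟩ := exists_linear_ode_solution hcont hbd v₀
      exact ⟨u, hu0, fun _ => hu⟩
    · exact ⟨fun _ => v₀, rfl, fun h => absurd h hξ⟩
  choose U hU0 hU using hex
  refine ⟨δ, hδ, hδr, fun x => U (x - x₀) 1, ?_, fun x hx => ?_⟩
  · have h0 := hU 0 (by simpa using hδ)
    have : ∀ t ∈ Icc (0 : ℝ) 1, U 0 t = U 0 0 := by
      refine constant_of_has_deriv_right_zero (fun t ht => (h0 t ht).continuousWithinAt) ?_
      intro t ht
      have := (h0 t (Ico_subset_Icc_self ht)).mono_of_mem_nhdsWithin (Icc_mem_nhdsGE_of_mem ht)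
      simpa using this
    simp only [sub_self]
    rw [this 1 (by simp), hU0]
  · set ξ := x - x₀ with hξdef
    have hξ : ‖ξ‖ < δ := mem_ball_iff_norm.1 hx
    have hxξ : x₀ + ξ = x := by rw [hξdef]; abel
    obtain ⟨B, hB⟩ := isCompact_Icc.exists_bound_of_continuousOn (f := U ξ)
      (fun t ht => (hU ξ hξ t ht).continuousWithinAt)
    rw [hasFDerivAt_iff_isLittleO_nhds_zero]
    set K := (2 * C + 2 * C ^ 2) * B / C * (Real.exp C - 1)
    have hO : (fun h : E => U (x + h - x₀) 1 - U (x - x₀) 1 -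
        (-(α x).flip (U (x - x₀) 1)) h) =O[𝓝 0] fun h => ‖h‖ ^ 2 := by
      refine Asymptotics.IsBigO.of_bound K ?_
      have : ∀ᶠ h : E in 𝓝 0, ‖ξ + h‖ < δ := by
        have : ContinuousAt (fun h : E => ‖ξ + h‖) 0 := by fun_prop
        exact this.eventually_lt_const (by simpa using hξ)
      filter_upwards [this] with h hh
      have hmain := norm_radial_sub_le hC hδ1
        (fun x hx y hy => hb x (hsub hx) y (hsub hy))
        (fun x hx => hflat x (Metric.ball_subset_ball hδr hx)) hξ hh
        ((hU0 ξ).trans (hU0 (ξ + h)).symm) (hU ξ hξ) (hU _ hh) hB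
      rw [add_sub_cancel_left, hxξ] at hmain
      have e : x + h - x₀ = ξ + h := by rw [hξdef]; abel
      rw [e, norm_pow, norm_norm, ← hξdef]
      simpa using hmain
    refine hO.trans_isLittleO ?_
    exact Asymptotics.isLittleO_norm_pow_id one_lt_two

/-- Solutions of a smooth linear system are smooth. -/
theorem contDiffOn_of_hasFDerivAt_flip {α : E → E →L[ℝ] V →L[ℝ] V} {s : Set E} (hs : IsOpen s)
    (hα : ContDiffOn ℝ ∞ α s) {v : E → V} (hv : ∀ x ∈ s, HasFDerivAt v (-(α x).flip (v x)) x) :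
    ContDiffOn ℝ ∞ v s := by
  rw [contDiffOn_infty]
  intro n
  induction n with
  | zero => exact contDiffOn_zero.2 fun x hx => (hv x hx).continuousAt.continuousWithinAt
  | succ n ih =>
    rw [Nat.cast_add, Nat.cast_one, contDiffOn_succ_iff_fderiv_of_isOpen hs]
    refine ⟨fun x hx => (hv x hx).differentiableAt.differentiableWithinAt, by simp, ?_⟩
    -- Bootstrapping: the derivative of v is α applied to v, hence as regular as v itself.
    have hα' := (contDiffOn_infty.1 hα) n
    have h1 : ContDiffOn ℝ n (fun x => (ContinuousLinearMap.apply ℝ V (v x)).comp (α x)) s := by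
      fun_prop
    refine h1.neg.congr fun x hx => ?_
    rw [(hv x hx).fderiv]
    rfl

end Frobenius

/-! ### Exterior derivatives of 1-forms on a surface, the Poincaré lemma and Frobenius' theorem in
charts -/

section ExteriorCalculus

variable {M : Type*} [TopologicalSpace M] [ChartedSpace E2 M]

/-- The inverse of the preferred chart at `p`. -/
abbrev param (p : M) : E2 → M := (extChartAt (𝓡 2) p).symm

/-- The part of the target of the preferred chart at `p` which parametrizes `U`. -/
def paramSet (U : Set M) (p : M) : Set E2 := (extChartAt (𝓡 2) p).target ∩ param p ⁻¹' U

/-- The differential of the inverse of the preferred chart at `p`. -/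
abbrev dparam (p : M) (y : E2) : E2 →L[ℝ] T (param p y) :=
  mfderiv 𝓘(ℝ, E2) (𝓡 2) (extChartAt (𝓡 2) p).symm y

theorem param_extChartAt {p x : M} (hs : x ∈ (extChartAt (𝓡 2) p).source) :
    param p (extChartAt (𝓡 2) p x) = x := (extChartAt (𝓡 2) p).left_inv hs

theorem isOpen_paramSet {U : Set M} (hU : IsOpen U) (p : M) : IsOpen (paramSet U p) :=
  (continuousOn_extChartAt_symm p).isOpen_inter_preimage (isOpen_extChartAt_target p) hU

theorem extChartAt_mem_paramSet {U : Set M} {p x : M} (hx : x ∈ U)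
    (hs : x ∈ (extChartAt (𝓡 2) p).source) : extChartAt (𝓡 2) p x ∈ paramSet U p :=
  ⟨(extChartAt (𝓡 2) p).map_source hs, by
    rw [mem_preimage, param_extChartAt hs]; exact hx⟩

variable [IsManifold (𝓡 2) ∞ M]

theorem mdifferentiableAt_param {p : M} {y : E2} (hy : y ∈ (extChartAt (𝓡 2) p).target) :
    MDifferentiableAt 𝓘(ℝ, E2) (𝓡 2) (param p) y := by
  have h : ContMDiffOn 𝓘(ℝ, E2) (𝓡 2) ∞ (param p) (extChartAt (𝓡 2) p).target :=
    contMDiffOn_extChartAt_symm p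
  exact (h.contMDiffAt ((isOpen_extChartAt_target p).mem_nhds hy)).mdifferentiableAt (by simp)

theorem bijective_dparam {p : M} {y : E2} (hy : y ∈ (extChartAt (𝓡 2) p).target) :
    Function.Bijective (dparam p y) := by
  have : IsManifold (𝓡 2) 1 M := IsManifold.of_le (n := ∞) (by simp)
  have h := isInvertible_mfderivWithin_extChartAt_symm (I := 𝓡 2) hy
  rw [ModelWithCorners.range_eq_univ, mfderivWithin_univ] at h
  exact h.bijective

section Smooth

variable {V : Type*} [NormedAddCommGroup V] [NormedSpace ℝ V] {U : Set M} {f : M → V}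

omit [IsManifold (𝓡 2) ∞ M] in
theorem SmoothOn.mono {W : Set M} (hf : SmoothOn U f) (h : W ⊆ U) : SmoothOn W f :=
  ContMDiffOn.mono hf h

omit [IsManifold (𝓡 2) ∞ M] in
theorem SmoothOn.congr {g : M → V} (hf : SmoothOn U f) (h : ∀ x ∈ U, g x = f x) : SmoothOn U g :=
  ContMDiffOn.congr hf h

omit [IsManifold (𝓡 2) ∞ M] in
theorem SmoothOn.mdifferentiableAt (hf : SmoothOn U f) (hU : IsOpen U) {x : M} (hx : x ∈ U) :
    MDifferentiableAt (𝓡 2) 𝓘(ℝ, V) f x :=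
  (ContMDiffOn.contMDiffAt hf (hU.mem_nhds hx)).mdifferentiableAt (by simp)

theorem SmoothOn.contDiffOn_param (hf : SmoothOn U f) (p : M) :
    ContDiffOn ℝ ∞ (f ∘ param p) (paramSet U p) := by
  rw [← contMDiffOn_iff_contDiffOn]
  have h : ContMDiffOn 𝓘(ℝ, E2) (𝓡 2) ∞ (param p) (extChartAt (𝓡 2) p).target :=
    contMDiffOn_extChartAt_symm p
  exact ContMDiffOn.comp (I' := 𝓡 2) hf (h.mono inter_subset_left) fun y hy => hy.2

theorem smoothOn_of_contDiffOn_param (hU : IsOpen U)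
    (h : ∀ p ∈ U, ContDiffOn ℝ ∞ (f ∘ param p) (paramSet U p)) : SmoothOn U f := by
  intro p hp
  have hmem := extChartAt_mem_paramSet hp (mem_extChartAt_source (I := 𝓡 2) p)
  have h1 : ContMDiffAt 𝓘(ℝ, E2) 𝓘(ℝ, V) ∞ (f ∘ param p) (extChartAt (𝓡 2) p p) :=
    ((h p hp).contDiffAt ((isOpen_paramSet hU p).mem_nhds hmem)).contMDiffAt
  have h2 : ContMDiffAt (𝓡 2) 𝓘(ℝ, V) ∞ ((f ∘ param p) ∘ extChartAt (𝓡 2) p) p :=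
    h1.comp p contMDiffAt_extChartAt
  refine (h2.congr_of_eventuallyEq ?_).contMDiffWithinAt
  filter_upwards [extChartAt_source_mem_nhds (I := 𝓡 2) p] with x hx
  simp only [Function.comp_apply]
  rw [param_extChartAt hx]

theorem fderiv_comp_param {p : M} {y : E2} (hy : y ∈ (extChartAt (𝓡 2) p).target)
    (hf : MDifferentiableAt (𝓡 2) 𝓘(ℝ, V) f (param p y)) :
    fderiv ℝ (f ∘ param p) y = (dd f (param p y)).comp (dparam p y) := by
  rw [← mfderiv_eq_fderiv]
  exact mfderiv_comp y hf (mdifferentiableAt_param hy)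

omit [IsManifold (𝓡 2) ∞ M] in
/-- Smoothness is a local property. -/
theorem smoothOn_of_locally
    (h : ∀ p ∈ U, ∃ W, IsOpen W ∧ p ∈ W ∧ SmoothOn W f) : SmoothOn U f := by
  intro p hp
  obtain ⟨W, hW, hpW, hf⟩ := h p hp
  exact (ContMDiffOn.contMDiffAt hf (hW.mem_nhds hpW)).contMDiffWithinAt

end Smooth

/-- A 1-form is smooth on `U` if its coefficients in all charts are. -/
def SmoothForm (U : Set M) (η : (x : M) → T x →L[ℝ] ℝ) : Prop :=
  ∀ p, ContDiffOn ℝ ∞ (chartForm η p) (paramSet U p)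

/-- The 1-form `η` is smooth on `U`, and its exterior derivative on `U` is `Ω`. -/
structure HasExtDeriv (U : Set M) (η : (x : M) → T x →L[ℝ] ℝ) (Ω : (x : M) → T x → T x → ℝ) :
    Prop where
  smooth : SmoothForm U η
  eq : ∀ p, ∀ y ∈ paramSet U p, ∀ u w : E2,
    fderiv ℝ (chartForm η p) y u w - fderiv ℝ (chartForm η p) y w u =
      Ω (param p y) (dparam p y u) (dparam p y w)

variable {U : Set M} {η η' : (x : M) → T x →L[ℝ] ℝ} {Ω Ω' : (x : M) → T x → T x → ℝ}

theorem chartForm_apply (p : M) (y u : E2) :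
    chartForm η p y u = η (param p y) (dparam p y u) := rfl

theorem SmoothForm.differentiableAt (h : SmoothForm U η) (hU : IsOpen U) {p : M} {y : E2}
    (hy : y ∈ paramSet U p) : DifferentiableAt ℝ (chartForm η p) y :=
  ((h p).contDiffAt ((isOpen_paramSet hU p).mem_nhds hy)).differentiableAt (by simp)

theorem SmoothForm.congr (h : SmoothForm U η) (he : ∀ x ∈ U, η' x = η x) : SmoothForm U η' :=
  fun p => (h p).congr fun y hy => by simp only [chartForm]; rw [he _ hy.2]

theorem HasExtDeriv.congr (h : HasExtDeriv U η Ω) (hU : IsOpen U) (he : ∀ x ∈ U, η' x = η x)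
    (hΩ : ∀ x ∈ U, ∀ X Y, Ω' x X Y = Ω x X Y) : HasExtDeriv U η' Ω' := by
  refine ⟨h.smooth.congr he, fun p y hy u w => ?_⟩
  have : chartForm η' p =ᶠ[𝓝 y] chartForm η p := by
    filter_upwards [(isOpen_paramSet hU p).mem_nhds hy] with z hz
    simp only [chartForm]; rw [he _ hz.2]
  rw [this.fderiv_eq, h.eq p y hy, hΩ _ hy.2]

theorem chartForm_dd {g : M → ℝ} (hg : SmoothOn U g) (hU : IsOpen U) {p : M} {y : E2}
    (hy : y ∈ paramSet U p) :
    chartForm (fun x => dd g x) p y = fderiv ℝ (g ∘ param p) y := by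
  rw [fderiv_comp_param hy.1 (hg.mdifferentiableAt hU hy.2)]
  rfl

/-- This is d² = 0, the symmetry of the second derivative read in a chart. -/
theorem HasExtDeriv.dd {g : M → ℝ} (hg : SmoothOn U g) (hU : IsOpen U) :
    HasExtDeriv U (fun x => dd g x) (fun _ _ _ => 0) := by
  have hsm : ∀ p, ContDiffOn ℝ ∞ (fderiv ℝ (g ∘ param p)) (paramSet U p) := fun p =>
    (hg.contDiffOn_param p).fderiv_of_isOpen (isOpen_paramSet hU p) (by simp)
  refine ⟨fun p => (hsm p).congr fun y hy => chartForm_dd hg hU hy, fun p y hy u w => ?_⟩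
  have hev : chartForm (fun x => Laguerre.dd g x) p =ᶠ[𝓝 y] fderiv ℝ (g ∘ param p) := by
    filter_upwards [(isOpen_paramSet hU p).mem_nhds hy] with z hz
    exact chartForm_dd hg hU hz
  have hsymm : IsSymmSndFDerivAt ℝ (g ∘ param p) y :=
    ((hg.contDiffOn_param p).contDiffAt ((isOpen_paramSet hU p).mem_nhds hy)).isSymmSndFDerivAt
      (by simpa using (ENat.LEInfty.out : (2 : WithTop ℕ∞) ≤ ∞))
  rw [hev.fderiv_eq, hsymm u w, sub_self]

theorem HasExtDeriv.smul {f : M → ℝ} (hf : SmoothOn U f) (h : HasExtDeriv U η Ω) (hU : IsOpen U) :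
    HasExtDeriv U (fun x => f x • η x)
      (fun x X Y => Laguerre.dd f x X * η x Y - Laguerre.dd f x Y * η x X + f x * Ω x X Y) := by
  have e : ∀ p, chartForm (fun x => f x • η x) p = fun y => (f ∘ param p) y • chartForm η p y :=
    fun p => rfl
  refine ⟨fun p => ?_, fun p y hy u w => ?_⟩
  · rw [e]
    exact (hf.contDiffOn_param p).smul (h.smooth p)
  · have h1 : DifferentiableAt ℝ (f ∘ param p) y :=
      ((hf.contDiffOn_param p).contDiffAt
        ((isOpen_paramSet hU p).mem_nhds hy)).differentiableAt (by simp)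
    have h2 := h.smooth.differentiableAt hU hy
    rw [e, fderiv_fun_smul h1 h2, fderiv_comp_param hy.1 (hf.mdifferentiableAt hU hy.2)]
    simp only [_root_.add_apply, _root_.smul_apply, ContinuousLinearMap.smulRight_apply,
      ContinuousLinearMap.comp_apply, smul_eq_mul, Function.comp_apply]
    rw [← h.eq p y hy]
    simp only [chartForm_apply]
    ring

theorem HasExtDeriv.add (h : HasExtDeriv U η Ω) (h' : HasExtDeriv U η' Ω') (hU : IsOpen U) :
    HasExtDeriv U (fun x => η x + η' x) (fun x X Y => Ω x X Y + Ω' x X Y) := by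
  have e : ∀ p, chartForm (fun x => η x + η' x) p = fun y => chartForm η p y + chartForm η' p y :=
    fun p => rfl
  refine ⟨fun p => ?_, fun p y hy u w => ?_⟩
  · rw [e]
    exact (h.smooth p).add (h'.smooth p)
  · rw [e, fderiv_fun_add (h.smooth.differentiableAt hU hy) (h'.smooth.differentiableAt hU hy)]
    simp only [_root_.add_apply]
    rw [← h.eq p y hy, ← h'.eq p y hy]
    ring

theorem HasExtDeriv.const_smul (c : ℝ) (h : HasExtDeriv U η Ω) (hU : IsOpen U) :
    HasExtDeriv U (fun x => c • η x) (fun x X Y => c * Ω x X Y) := by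
  have e : ∀ p, chartForm (fun x => c • η x) p = fun y => c • chartForm η p y :=
    fun p => rfl
  refine ⟨fun p => ?_, fun p y hy u w => ?_⟩
  · rw [e]
    exact (h.smooth p).const_smul c
  · rw [e, fderiv_fun_const_smul (h.smooth.differentiableAt hU hy)]
    simp only [_root_.smul_apply, smul_eq_mul]
    rw [← h.eq p y hy]
    ring

theorem HasExtDeriv.neg (h : HasExtDeriv U η Ω) (hU : IsOpen U) :
    HasExtDeriv U (fun x => -η x) (fun x X Y => -Ω x X Y) :=
  (h.const_smul (-1) hU).congr hU (fun x _ => (neg_one_smul ℝ (η x)).symm) fun x _ X Y => (neg_one_mul _).symm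

theorem HasExtDeriv.sub (h : HasExtDeriv U η Ω) (h' : HasExtDeriv U η' Ω') (hU : IsOpen U) :
    HasExtDeriv U (fun x => η x - η' x) (fun x X Y => Ω x X Y - Ω' x X Y) :=
  (h.add (h'.neg hU) hU).congr hU (fun x _ => sub_eq_add_neg _ _)
    fun x _ X Y => sub_eq_add_neg _ _

theorem HasExtDeriv.smul_dd {f g : M → ℝ} (hf : SmoothOn U f) (hg : SmoothOn U g)
    (hU : IsOpen U) : HasExtDeriv U (fun x => f x • Laguerre.dd g x)
      (fun x X Y => Laguerre.dd f x X * Laguerre.dd g x Y -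
        Laguerre.dd f x Y * Laguerre.dd g x X) :=
  ((HasExtDeriv.dd hg hU).smul hf hU).congr hU (fun _ _ => rfl) fun x _ X Y => by ring

omit [IsManifold (𝓡 2) ∞ M] in
theorem exists_param_eq {p x : M} (hx : x ∈ U) (hs : x ∈ (extChartAt (𝓡 2) p).source) :
    ∃ y ∈ paramSet U p, param p y = x :=
  ⟨_, extChartAt_mem_paramSet hx hs, (extChartAt (𝓡 2) p).left_inv hs⟩

/-- The chart differentials are bijective, so the values of Ω on all tangent vectors are determined
by the chart coefficients of η. Identities between functions arise by computing one exterior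
derivative twice. -/
theorem HasExtDeriv.unique (h : HasExtDeriv U η Ω) (h' : HasExtDeriv U η Ω') {x : M} (hx : x ∈ U)
    (X Y : T x) : Ω x X Y = Ω' x X Y := by
  -- The centre p of the chart is separated from x, so that x can be replaced by a parametrized
  -- point while the chart stays fixed.
  suffices H : ∀ p x, x ∈ U → x ∈ (extChartAt (𝓡 2) p).source → ∀ X Y : T x,
      Ω x X Y = Ω' x X Y from H x x hx (mem_extChartAt_source x) X Y
  intro p x hx hs X Y
  obtain ⟨y, hy, rfl⟩ := exists_param_eq hx hs
  obtain ⟨u, rfl⟩ := (bijective_dparam hy.1).2 X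
  obtain ⟨w, rfl⟩ := (bijective_dparam hy.1).2 Y
  rw [← h.eq p y hy, ← h'.eq p y hy]

theorem HasExtDeriv.isClosedForm (h : HasExtDeriv U η (fun _ _ _ => 0)) (hU : IsOpen U) :
    IsClosedForm U η := by
  intro p hp
  have hy := extChartAt_mem_paramSet hp (mem_extChartAt_source (I := 𝓡 2) p)
  exact ⟨h.smooth.differentiableAt hU hy, fun u w => sub_eq_zero.1 (h.eq p _ hy u w)⟩

/-- The preimage of a small ball under the preferred chart. -/
def chartBall (p : M) (δ : ℝ) : Set M :=
  (extChartAt (𝓡 2) p).source ∩ extChartAt (𝓡 2) p ⁻¹' Metric.ball (extChartAt (𝓡 2) p p) δ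

omit [IsManifold (𝓡 2) ∞ M] in
theorem isOpen_chartBall (p : M) (δ : ℝ) : IsOpen (chartBall p δ) :=
  (continuousOn_extChartAt p).isOpen_inter_preimage (isOpen_extChartAt_source p)
    Metric.isOpen_ball

omit [IsManifold (𝓡 2) ∞ M] in
theorem mem_chartBall (p : M) {δ : ℝ} (hδ : 0 < δ) : p ∈ chartBall p δ :=
  ⟨mem_extChartAt_source p, Metric.mem_ball_self hδ⟩

omit [IsManifold (𝓡 2) ∞ M] in
theorem exists_ball_subset_paramSet (hU : IsOpen U) {p : M} (hp : p ∈ U) :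
    ∃ δ > 0, Metric.ball (extChartAt (𝓡 2) p p) δ ⊆ paramSet U p :=
  Metric.isOpen_iff.1 (isOpen_paramSet hU p) _
    (extChartAt_mem_paramSet hp (mem_extChartAt_source p))

omit [IsManifold (𝓡 2) ∞ M] in
theorem chartBall_subset {p : M} {δ : ℝ}
    (h : Metric.ball (extChartAt (𝓡 2) p p) δ ⊆ paramSet U p) : chartBall p δ ⊆ U := by
  intro x hx
  have := (h hx.2).2
  rwa [mem_preimage, param_extChartAt hx.1] at this

omit [IsManifold (𝓡 2) ∞ M] in
theorem exists_ball_param {p x : M} {δ : ℝ} (hx : x ∈ chartBall p δ) :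
    ∃ y ∈ Metric.ball (extChartAt (𝓡 2) p p) δ, y ∈ (extChartAt (𝓡 2) p).target ∧
      param p y = x :=
  ⟨_, hx.2, (extChartAt (𝓡 2) p).map_source hx.1, (extChartAt (𝓡 2) p).left_inv hx.1⟩

/-- A function on a chart ball defined by a function on the ball. -/
theorem smoothOn_chartBall {V : Type*} [NormedAddCommGroup V] [NormedSpace ℝ V] {p : M} {δ : ℝ}
    {v : E2 → V} (hv : ContDiffOn ℝ ∞ v (Metric.ball (extChartAt (𝓡 2) p p) δ)) :
    SmoothOn (chartBall p δ) (v ∘ extChartAt (𝓡 2) p) := by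
  have h1 : ContMDiffOn (𝓡 2) 𝓘(ℝ, E2) ∞ (extChartAt (𝓡 2) p) (chartAt E2 p).source :=
    contMDiffOn_extChartAt
  exact ContMDiffOn.comp (I' := 𝓘(ℝ, E2)) hv.contMDiffOn (h1.mono fun x hx => by
    rw [← extChartAt_source (𝓡 2)]; exact hx.1) fun x hx => hx.2

omit [IsManifold (𝓡 2) ∞ M] in
theorem comp_extChartAt_comp_param {V : Type*} {p : M} {v : E2 → V} {y : E2}
    (hy : y ∈ (extChartAt (𝓡 2) p).target) :
    (v ∘ extChartAt (𝓡 2) p) ∘ param p =ᶠ[𝓝 y] v := by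
  filter_upwards [(isOpen_extChartAt_target (I := 𝓡 2) p).mem_nhds hy] with z hz
  simp only [Function.comp_apply]
  rw [(extChartAt (𝓡 2) p).right_inv hz]

theorem dd_comp_extChartAt {V : Type*} [NormedAddCommGroup V] [NormedSpace ℝ V] {p : M} {δ : ℝ}
    {v : E2 → V} (hv : ContDiffOn ℝ ∞ v (Metric.ball (extChartAt (𝓡 2) p p) δ)) {y : E2}
    (hy : y ∈ (extChartAt (𝓡 2) p).target) (hyb : y ∈ Metric.ball (extChartAt (𝓡 2) p p) δ)
    (u : E2) :
    dd (v ∘ extChartAt (𝓡 2) p) (param p y) (dparam p y u) = fderiv ℝ v y u := by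
  have hmem : param p y ∈ chartBall p δ := ⟨(extChartAt (𝓡 2) p).map_target hy, by
    rw [mem_preimage, (extChartAt (𝓡 2) p).right_inv hy]; exact hyb⟩
  rw [← (comp_extChartAt_comp_param hy).fderiv_eq, fderiv_comp_param hy
    ((smoothOn_chartBall hv).mdifferentiableAt (isOpen_chartBall p δ) hmem)]
  rfl

/-- Every point has a basis of neighbourhoods on which functions with vanishing differential are
constant. -/
theorem exists_nhds_const (hU : IsOpen U) {p : M} (hp : p ∈ U) :
    ∃ W, IsOpen W ∧ p ∈ W ∧ W ⊆ U ∧ ∀ f : M → ℝ, SmoothOn W f → (∀ x ∈ W, dd f x = 0) →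
      ∀ x ∈ W, f x = f p := by
  obtain ⟨δ, hδ, hsub⟩ := exists_ball_subset_paramSet hU hp
  refine ⟨chartBall p δ, isOpen_chartBall p δ, mem_chartBall p hδ, chartBall_subset hsub, ?_⟩
  intro f hf hdf x hx
  have hball : Metric.ball (extChartAt (𝓡 2) p p) δ ⊆ paramSet (chartBall p δ) p := by
    intro y hy
    have ht := (hsub hy).1
    exact ⟨ht, (extChartAt (𝓡 2) p).map_target ht, by
      rw [mem_preimage, (extChartAt (𝓡 2) p).right_inv ht]; exact hy⟩
  have key := (Metric.isOpen_ball (x := extChartAt (𝓡 2) p p) (ε := δ)).is_const_of_fderiv_eq_zero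
    (𝕜 := ℝ) (f := f ∘ param p) (convex_ball _ _).isPreconnected
    (((hf.contDiffOn_param p).mono hball).differentiableOn (by simp)) (fun y hy => by
      have hy' := hball hy
      rw [fderiv_comp_param hy'.1 (hf.mdifferentiableAt (isOpen_chartBall p δ) hy'.2),
        hdf _ hy'.2]
      rfl) hx.2 (Metric.mem_ball_self hδ)
  simp only [Function.comp_apply] at key
  rwa [param_extChartAt hx.1, param_extChartAt (mem_extChartAt_source p)] at key

/-- **Poincaré's lemma** on a surface. -/
theorem HasExtDeriv.exists_primitive (h : HasExtDeriv U η (fun _ _ _ => 0)) (hU : IsOpen U) {p : M}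
    (hp : p ∈ U) (c : ℝ) : ∃ (W : Set M) (r : M → ℝ), IsOpen W ∧ p ∈ W ∧ W ⊆ U ∧
      SmoothOn W r ∧ r p = c ∧ ∀ x ∈ W, Laguerre.dd r x = η x := by
  obtain ⟨δ, hδ, hsub⟩ := exists_ball_subset_paramSet hU hp
  set B := Metric.ball (extChartAt (𝓡 2) p p) δ
  have hsm : ContDiffOn ℝ ∞ (chartForm η p) B := (h.smooth p).mono hsub
  obtain ⟨f, hf⟩ := (convex_ball (extChartAt (𝓡 2) p p) δ).exists_forall_hasFDerivAt_of_fderiv_symmetric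
    Metric.isOpen_ball (hsm.differentiableOn (by simp))
    (fun a ha u w => sub_eq_zero.1 (h.eq p a (hsub ha) u w))
  have hfs : ContDiffOn ℝ ∞ f B := by
    -- Since ∞ = ∞ + 1, smoothness of the derivative already gives smoothness of f.
    rw [show (∞ : WithTop ℕ∞) = ∞ + 1 from rfl,
      contDiffOn_succ_iff_fderiv_of_isOpen Metric.isOpen_ball]
    exact ⟨fun x hx => (hf x hx).differentiableAt.differentiableWithinAt, by simp,
      hsm.congr fun x hx => (hf x hx).fderiv⟩
  have hfs' : ContDiffOn ℝ ∞ (fun y => f y - f (extChartAt (𝓡 2) p p) + c) B :=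
    (hfs.sub contDiffOn_const).add contDiffOn_const
  refine ⟨chartBall p δ, _, isOpen_chartBall p δ, mem_chartBall p hδ, chartBall_subset hsub,
    smoothOn_chartBall hfs', by simp, fun x hx => ?_⟩
  obtain ⟨y, hy, ht, rfl⟩ := exists_ball_param hx
  ext X
  obtain ⟨u, rfl⟩ := (bijective_dparam ht).2 X
  rw [dd_comp_extChartAt hfs' ht hy, fderiv_add_const, fderiv_sub_const, (hf y hy).fderiv]
  rfl

/-- **Frobenius' theorem** for a flat linear system on a surface. -/
theorem exists_solution_of_flat {n : ℕ} {β : Fin n → Fin n → (x : M) → T x →L[ℝ] ℝ}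
    (hU : IsOpen U)
    (h : ∀ i j, HasExtDeriv U (β i j)
      (fun x X Y => -∑ k, (β i k x X * β k j x Y - β i k x Y * β k j x X)))
    {p : M} (hp : p ∈ U) (v₀ : Fin n → ℝ) :
    ∃ (W : Set M) (v : M → Fin n → ℝ), IsOpen W ∧ p ∈ W ∧ W ⊆ U ∧ SmoothOn W v ∧ v p = v₀ ∧
      ∀ x ∈ W, ∀ X : T x, ∀ i, dd v x X i = -∑ j, β i j x X * v x j := by
  let E : Fin n → Fin n → (Fin n → ℝ) →L[ℝ] (Fin n → ℝ) := fun i j =>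
    (ContinuousLinearMap.proj (R := ℝ) (φ := fun _ : Fin n => ℝ) j).smulRight (Pi.single i 1)
  let α : E2 → E2 →L[ℝ] (Fin n → ℝ) →L[ℝ] (Fin n → ℝ) := fun y =>
    ∑ i, ∑ j, (chartForm (β i j) p y).smulRight (E i j)
  have hα_apply : ∀ y u v i, α y u v i = ∑ j, chartForm (β i j) p y u * v j := by
    intro y u v i
    simp only [α, E, _root_.sum_apply, ContinuousLinearMap.smulRight_apply,
      Finset.sum_apply, _root_.smul_apply, ContinuousLinearMap.proj_apply, smul_eq_mul,
      Pi.smul_apply, Pi.single_apply]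
    rw [Finset.sum_comm]
    simp
  have hαs : ContDiffOn ℝ ∞ α (paramSet U p) := by
    refine ContDiffOn.sum fun i _ => ContDiffOn.sum fun j _ => ?_
    exact ((h i j).smooth p).smulRight contDiffOn_const
  have hαd : ∀ y ∈ paramSet U p, ∀ u w v i, fderiv ℝ α y u w v i =
      ∑ j, fderiv ℝ (chartForm (β i j) p) y u w * v j := by
    intro y hy u w v i
    have hd : DifferentiableAt ℝ α y :=
      (hαs.contDiffAt ((isOpen_paramSet hU p).mem_nhds hy)).differentiableAt (by simp)
    have h1 := hasFDerivAt_pi'.1 ((hd.hasFDerivAt.clm_apply (hasFDerivAt_const w y)).clm_apply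
      (hasFDerivAt_const v y)) i
    have h2 : HasFDerivAt (fun z => α z w v i)
        (∑ j, v j • ((ContinuousLinearMap.apply ℝ ℝ w).comp
          (fderiv ℝ (chartForm (β i j) p) y))) y := by
      simp only [hα_apply]
      refine HasFDerivAt.fun_sum fun j _ => ?_
      exact (((ContinuousLinearMap.apply ℝ ℝ w).hasFDerivAt.comp y
        ((h i j).smooth.differentiableAt hU hy).hasFDerivAt)).mul_const (v j)
    have h3 := congrArg (fun L => L u) (h1.unique h2)
    simp only [ContinuousLinearMap.comp_apply, _root_.sum_apply,
      _root_.smul_apply, smul_eq_mul, ContinuousLinearMap.apply_apply,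
      ContinuousLinearMap.proj_apply, _root_.add_apply, ContinuousLinearMap.flip_apply,
      ContinuousLinearMap.comp_zero, _root_.zero_apply, zero_add, map_zero] at h3
    rw [h3]
    exact Finset.sum_congr rfl fun j _ => mul_comm _ _
  obtain ⟨r, hr, hsub⟩ := exists_ball_subset_paramSet hU hp
  have hα0 : ContDiffAt ℝ 2 α (extChartAt (𝓡 2) p p) :=
    (hαs.contDiffAt ((isOpen_paramSet hU p).mem_nhds (hsub (Metric.mem_ball_self hr)))).of_le
      (by simpa using (ENat.LEInfty.out : (2 : WithTop ℕ∞) ≤ ∞))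
  obtain ⟨δ, hδ, hδr, v, hv0, hv⟩ := exists_hasFDerivAt_of_flat hr hα0 (fun y hy u w => by
    have hy' := hsub hy
    ext z i
    simp only [_root_.sub_apply, Pi.sub_apply, ContinuousLinearMap.comp_apply]
    rw [hαd y hy', hαd y hy', ← Finset.sum_sub_distrib]
    have : ∀ j, fderiv ℝ (chartForm (β i j) p) y u w * z j -
        fderiv ℝ (chartForm (β i j) p) y w u * z j =
        ∑ k, (chartForm (β i k) p y w * (chartForm (β k j) p y u * z j) -
          chartForm (β i k) p y u * (chartForm (β k j) p y w * z j)) := by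
      intro j
      rw [← sub_mul, (h i j).eq p y hy', ← Finset.sum_neg_distrib, Finset.sum_mul]
      refine Finset.sum_congr rfl fun k _ => ?_
      simp only [chartForm_apply]
      ring
    -- The structure equations of β are the flatness condition for the matrix-valued form α.
    rw [Finset.sum_congr rfl fun j _ => this j, Finset.sum_comm]
    simp only [hα_apply, Finset.mul_sum, Finset.sum_sub_distrib]) v₀
  have hsubδ := (Metric.ball_subset_ball hδr).trans hsub
  have hvs : ContDiffOn ℝ ∞ v (Metric.ball (extChartAt (𝓡 2) p p) δ) :=
    contDiffOn_of_hasFDerivAt_flip Metric.isOpen_ball (hαs.mono hsubδ) hv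
  refine ⟨chartBall p δ, v ∘ extChartAt (𝓡 2) p, isOpen_chartBall p δ, mem_chartBall p hδ,
    chartBall_subset hsubδ, smoothOn_chartBall hvs, by simpa using hv0, fun x hx X i => ?_⟩
  obtain ⟨y, hy, ht, rfl⟩ := exists_ball_param hx
  obtain ⟨u, rfl⟩ := (bijective_dparam ht).2 X
  rw [dd_comp_extChartAt hvs ht hy, (hv y hy).fderiv]
  simp only [_root_.neg_apply, Pi.neg_apply, ContinuousLinearMap.flip_apply, hα_apply,
    Function.comp_apply]
  rw [(extChartAt (𝓡 2) p).right_inv ht]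
  rfl

end ExteriorCalculus

/-! ### Differentials of vector-valued functions on a surface -/

section Calculus

variable {M : Type*} [TopologicalSpace M] [ChartedSpace E2 M]
  {V V' : Type*} [NormedAddCommGroup V] [NormedSpace ℝ V] [NormedAddCommGroup V'] [NormedSpace ℝ V']
  {U : Set M} {x : M}

theorem dd_congr {f g : M → V} (hU : IsOpen U) (hx : x ∈ U) (h : ∀ z ∈ U, f z = g z) :
    dd f x = dd g x := by
  have : f =ᶠ[𝓝 x] g := by filter_upwards [hU.mem_nhds hx] with z hz using h z hz
  exact this.mfderiv_eq

theorem dd_const (c : V) : dd (fun _ : M => c) x = 0 := mfderiv_const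

theorem dd_comp {f : M → V} {Φ : V → V'} {Φ' : V →L[ℝ] V'}
    (hΦ : HasFDerivAt Φ Φ' (f x)) (hf : MDifferentiableAt (𝓡 2) 𝓘(ℝ, V) f x) :
    dd (fun z => Φ (f z)) x = Φ'.comp (dd f x) := by
  have h := hΦ.hasMFDerivAt.comp x hf.hasMFDerivAt
  exact h.mfderiv

theorem dd_clm {f : M → V} (L : V →L[ℝ] V') (hf : MDifferentiableAt (𝓡 2) 𝓘(ℝ, V) f x)
    (X : T x) : dd (fun z => L (f z)) x X = L (dd f x X) := by
  rw [dd_comp L.hasFDerivAt hf]; rfl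

theorem dd_apply {n : ℕ} {f : M → Fin n → ℝ}
    (hf : MDifferentiableAt (𝓡 2) 𝓘(ℝ, Fin n → ℝ) f x) (k : Fin n) (X : T x) :
    dd (fun z => f z k) x X = dd f x X k :=
  dd_clm (ContinuousLinearMap.proj (R := ℝ) (φ := fun _ : Fin n => ℝ) k) hf X

variable [IsManifold (𝓡 2) ∞ M]

theorem SmoothOn.comp {f : M → V} {Φ : V → V'} (hf : SmoothOn U f)
    (hΦ : ∀ x ∈ U, ContDiffAt ℝ ∞ Φ (f x)) : SmoothOn U (fun x => Φ (f x)) := fun x hx =>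
  ContMDiffAt.comp_contMDiffWithinAt x (hΦ x hx).contMDiffAt (hf x hx)

theorem SmoothOn.contDiff_comp {f : M → V} {Φ : V → V'} (hf : SmoothOn U f)
    (hΦ : ContDiff ℝ ∞ Φ) : SmoothOn U (fun x => Φ (f x)) :=
  hf.comp fun _ _ => hΦ.contDiffAt

theorem SmoothOn.clm {f : M → V} (hf : SmoothOn U f) (L : V →L[ℝ] V') :
    SmoothOn U (fun x => L (f x)) := hf.contDiff_comp L.contDiff

theorem SmoothOn.const (c : V) : SmoothOn U (fun _ : M => c) := contMDiffOn_const

theorem SmoothOn.prodMk {f : M → V} {g : M → V'} (hf : SmoothOn U f) (hg : SmoothOn U g) :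
    SmoothOn U (fun x => (f x, g x)) := ContMDiffOn.prodMk_space hf hg

theorem SmoothOn.add {f g : M → V} (hf : SmoothOn U f) (hg : SmoothOn U g) :
    SmoothOn U (fun x => f x + g x) :=
  (hf.prodMk hg).contDiff_comp (Φ := fun z => z.1 + z.2) (by fun_prop)

theorem SmoothOn.neg {f : M → V} (hf : SmoothOn U f) : SmoothOn U (fun x => -f x) :=
  hf.contDiff_comp (Φ := fun z => -z) (by fun_prop)

theorem SmoothOn.smul {c : M → ℝ} {f : M → V} (hc : SmoothOn U c) (hf : SmoothOn U f) :
    SmoothOn U (fun x => c x • f x) :=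
  (hc.prodMk hf).contDiff_comp (Φ := fun z => z.1 • z.2) (by fun_prop)

theorem SmoothOn.mul {A : Type*} [NormedRing A] [NormedAlgebra ℝ A] {f g : M → A}
    (hf : SmoothOn U f) (hg : SmoothOn U g) : SmoothOn U (fun x => f x * g x) :=
  (hf.prodMk hg).contDiff_comp (Φ := fun z => z.1 * z.2) (by fun_prop)

theorem SmoothOn.inv {f : M → ℝ} (hf : SmoothOn U f) (h0 : ∀ x ∈ U, f x ≠ 0) :
    SmoothOn U (fun x => (f x)⁻¹) :=
  hf.comp (Φ := fun z => z⁻¹) fun x hx => contDiffAt_inv ℝ (h0 x hx)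

theorem SmoothOn.div {f g : M → ℝ} (hf : SmoothOn U f) (hg : SmoothOn U g)
    (h0 : ∀ x ∈ U, g x ≠ 0) : SmoothOn U (fun x => f x / g x) :=
  (hf.mul (hg.inv h0)).congr fun _ _ => div_eq_mul_inv _ _

theorem SmoothOn.apply {n : ℕ} {f : M → Fin n → ℝ} (hf : SmoothOn U f) (k : Fin n) :
    SmoothOn U (fun x => f x k) :=
  hf.clm (ContinuousLinearMap.proj (R := ℝ) (φ := fun _ : Fin n => ℝ) k)

theorem SmoothOn.pi {n : ℕ} {f : M → Fin n → ℝ} (hf : ∀ k, SmoothOn U (fun x => f x k)) :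
    SmoothOn U f := contMDiffOn_pi_space.2 hf

theorem SmoothOn.sum {ι : Type*} {s : Finset ι} {f : ι → M → V} (hf : ∀ i ∈ s, SmoothOn U (f i)) :
    SmoothOn U (fun x => ∑ i ∈ s, f i x) := by
  classical
  induction s using Finset.induction_on with
  | empty => simpa using SmoothOn.const 0
  | insert a s ha ih =>
    simp only [Finset.sum_insert ha]
    exact (hf a (by simp)).add (ih fun i hi => hf i (by simp [hi]))

theorem SmoothOn.continuousOn {f : M → V} (hf : SmoothOn U f) : ContinuousOn f U :=
  ContMDiffOn.continuousOn hf

section Rules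

variable {f g : M → V} (hf : MDifferentiableAt (𝓡 2) 𝓘(ℝ, V) f x)
  (hg : MDifferentiableAt (𝓡 2) 𝓘(ℝ, V) g x)
include hf

theorem mdifferentiableAt_prod {h : M → V'} (hh : MDifferentiableAt (𝓡 2) 𝓘(ℝ, V') h x) :
    MDifferentiableAt (𝓡 2) 𝓘(ℝ, V × V') (fun z => (f z, h z)) x :=
  hf.prodMk_space hh

theorem dd_prod {h : M → V'} (hh : MDifferentiableAt (𝓡 2) 𝓘(ℝ, V') h x) (X : T x) :
    dd (fun z => (f z, h z)) x X = (dd f x X, dd h x X) := by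
  have hp := mdifferentiableAt_prod hf hh
  refine Prod.ext ?_ ?_
  · exact (dd_clm (ContinuousLinearMap.fst ℝ V V') hp X).symm
  · exact (dd_clm (ContinuousLinearMap.snd ℝ V V') hp X).symm

/-- Leibniz' rule for a bilinear map. -/
theorem dd_bilin {V'' : Type*} [NormedAddCommGroup V''] [NormedSpace ℝ V'']
    {B : V × V' → V''} (hB : IsBoundedBilinearMap ℝ B) {h : M → V'}
    (hh : MDifferentiableAt (𝓡 2) 𝓘(ℝ, V') h x) (X : T x) :
    dd (fun z => B (f z, h z)) x X = B (f x, dd h x X) + B (dd f x X, h x) := by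
  have h2 := dd_comp (f := fun z => (f z, h z)) (hB.hasFDerivAt (f x, h x))
    (mdifferentiableAt_prod hf hh)
  rw [h2, ContinuousLinearMap.comp_apply, dd_prod hf hh]
  rfl

theorem dd_smul {c : M → ℝ} (hc : MDifferentiableAt (𝓡 2) 𝓘(ℝ, ℝ) c x) (X : T x) :
    dd (fun z => c z • f z) x X = c x • dd f x X + dd c x X • f x :=
  dd_bilin hc isBoundedBilinearMap_smul hf X

include hg

theorem dd_add (X : T x) : dd (fun z => f z + g z) x X = dd f x X + dd g x X := by
  have := dd_clm (ContinuousLinearMap.fst ℝ V V + ContinuousLinearMap.snd ℝ V V)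
    (mdifferentiableAt_prod hf hg) X
  rw [dd_prod hf hg] at this
  exact this

end Rules

theorem dd_mul {A : Type*} [NormedRing A] [NormedAlgebra ℝ A] {f g : M → A}
    (hf : MDifferentiableAt (𝓡 2) 𝓘(ℝ, A) f x) (hg : MDifferentiableAt (𝓡 2) 𝓘(ℝ, A) g x)
    (X : T x) : dd (fun z => f z * g z) x X = f x * dd g x X + dd f x X * g x :=
  dd_bilin hf isBoundedBilinearMap_mul hg X

/-! ### Coframes -/

/-- `e, e'` is the frame dual to the coframe `θ, θ'`. -/
structure IsDualFrame (θ θ' : T x →L[ℝ] ℝ) (e e' : T x) : Prop where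
  left : θ e = 1
  left' : θ' e = 0
  right : θ e' = 0
  right' : θ' e' = 1
  expand : ∀ X, X = θ X • e + θ' X • e'

theorem exists_isDualFrame {θ θ' : T x →L[ℝ] ℝ} (h : ∀ X, θ X = 0 → θ' X = 0 → X = 0) :
    ∃ e e', IsDualFrame θ θ' e e' := by
  let L : T x →ₗ[ℝ] ℝ × ℝ := θ.toLinearMap.prod θ'.toLinearMap
  have : FiniteDimensional ℝ (T x) := inferInstanceAs (FiniteDimensional ℝ E2)
  have hrank : Module.finrank ℝ (T x) = 2 := (finrank_euclideanSpace_fin : Module.finrank ℝ E2 = 2)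
  have hinj : Function.Injective L := by
    rw [← LinearMap.ker_eq_bot, LinearMap.ker_eq_bot']
    intro X hX
    exact h X (congrArg Prod.fst hX) (congrArg Prod.snd hX)
  have hsurj : Function.Surjective L :=
    (LinearMap.injective_iff_surjective_of_finrank_eq_finrank (by simp [hrank])).1 hinj
  obtain ⟨e, he⟩ := hsurj (1, 0)
  obtain ⟨e', he'⟩ := hsurj (0, 1)
  have h1 : θ e = 1 := congrArg Prod.fst he
  have h2 : θ' e = 0 := congrArg Prod.snd he
  have h3 : θ e' = 0 := congrArg Prod.fst he'
  have h4 : θ' e' = 1 := congrArg Prod.snd he'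
  refine ⟨e, e', h1, h2, h3, h4, fun X => ?_⟩
  refine sub_eq_zero.1 (h _ ?_ ?_)
  · rw [map_sub, map_add, map_smul, map_smul, h1, h3]; simp
  · rw [map_sub, map_add, map_smul, map_smul, h2, h4]; simp

namespace IsDualFrame

variable {θ θ' : T x →L[ℝ] ℝ} {e e' : T x} (h : IsDualFrame θ θ' e e')
include h

theorem map_eq (L : T x →L[ℝ] V) (X : T x) : L X = θ X • L e + θ' X • L e' := by
  conv_lhs => rw [h.expand X]
  rw [L.map_add, L.map_smul, L.map_smul]

theorem eq_zero {X : T x} (h1 : θ X = 0) (h2 : θ' X = 0) : X = 0 := by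
  rw [h.expand X, h1, h2, zero_smul, zero_smul, add_zero]

end IsDualFrame

/-- The coefficients of a smooth form with respect to a smooth coframe are smooth. -/
theorem smoothOn_apply_dualFrame (hU : IsOpen U) {θ θ' η : (x : M) → T x →L[ℝ] ℝ}
    (hθ : SmoothForm U θ) (hθ' : SmoothForm U θ') (hη : SmoothForm U η) {e e' : (x : M) → T x}
    (hd : ∀ x ∈ U, IsDualFrame (θ x) (θ' x) (e x) (e' x)) :
    SmoothOn U (fun x => η x (e x)) ∧ SmoothOn U (fun x => η x (e' x)) := by
  let u : E2 := EuclideanSpace.single 0 1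
  let w : E2 := EuclideanSpace.single 1 1
  have huw : ∀ z : E2, z = z 0 • u + z 1 • w := by
    intro z; ext i; fin_cases i <;> simp [u, w]
  -- The dual frame is only chosen pointwise, with no smoothness assumed. Cramer's rule with this
  -- determinant of the coframe expresses the values on e and e' through smooth chart coefficients.
  let D : M → E2 → ℝ := fun p y => chartForm θ p y u * chartForm θ' p y w -
    chartForm θ p y w * chartForm θ' p y u
  have hsm : ∀ (p : M) (ζ : (x : M) → T x →L[ℝ] ℝ), SmoothForm U ζ → ∀ b : E2,
      ContDiffOn ℝ ∞ (fun y => chartForm ζ p y b) (paramSet U p) := fun p ζ hζ b =>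
    (hζ p).clm_apply contDiffOn_const
  have hD0 : ∀ p, ∀ y ∈ paramSet U p, D p y ≠ 0 := by
    intro p y hy h0
    obtain ⟨a, ha⟩ := (bijective_dparam hy.1).2 (e (param p y))
    obtain ⟨b, hb⟩ := (bijective_dparam hy.1).2 (e' (param p y))
    have hdd := hd _ hy.2
    have h1 : chartForm θ p y a = 1 := by rw [chartForm_apply, ha]; exact hdd.left
    have h2 : chartForm θ' p y a = 0 := by rw [chartForm_apply, ha]; exact hdd.left'
    have h3 : chartForm θ p y b = 0 := by rw [chartForm_apply, hb]; exact hdd.right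
    have h4 : chartForm θ' p y b = 1 := by rw [chartForm_apply, hb]; exact hdd.right'
    rw [huw a] at h1 h2
    rw [huw b] at h3 h4
    simp only [map_add, map_smul, smul_eq_mul] at h1 h2 h3 h4
    simp only [D] at h0
    have : (a 0 * b 1 - a 1 * b 0) * (chartForm θ p y u * chartForm θ' p y w -
      chartForm θ p y w * chartForm θ' p y u) = 1 := by
      linear_combination (chartForm θ' p y u * b 0 + chartForm θ' p y w * b 1) * h1 + h4
        - (b 0 * chartForm θ p y u + b 1 * chartForm θ p y w) * h2
    rw [h0] at this
    simp at this
  have key : ∀ p, ∀ y ∈ paramSet U p,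
      η (param p y) (e (param p y)) = (chartForm η p y u * chartForm θ' p y w -
        chartForm η p y w * chartForm θ' p y u) / D p y ∧
      η (param p y) (e' (param p y)) = (chartForm θ p y u * chartForm η p y w -
        chartForm θ p y w * chartForm η p y u) / D p y := by
    intro p y hy
    have hdd := hd _ hy.2
    have h1 := hdd.map_eq (η (param p y)) (dparam p y u)
    have h2 := hdd.map_eq (η (param p y)) (dparam p y w)
    have h0 := hD0 p y hy
    simp only [← chartForm_apply, smul_eq_mul] at h1 h2
    rw [eq_div_iff h0, eq_div_iff h0, h1, h2]
    constructor <;> simp only [D] <;> ring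
  constructor
  · refine smoothOn_of_contDiffOn_param hU fun p _ => ?_
    refine ContDiffOn.congr ?_ fun y hy => (key p y hy).1
    exact (((hsm p η hη u).mul (hsm p θ' hθ' w)).sub ((hsm p η hη w).mul (hsm p θ' hθ' u))).div
      (((hsm p θ hθ u).mul (hsm p θ' hθ' w)).sub ((hsm p θ hθ w).mul (hsm p θ' hθ' u)))
      (hD0 p)
  · refine smoothOn_of_contDiffOn_param hU fun p _ => ?_
    refine ContDiffOn.congr ?_ fun y hy => (key p y hy).2
    exact (((hsm p θ hθ u).mul (hsm p η hη w)).sub ((hsm p θ hθ w).mul (hsm p η hη u))).div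
      (((hsm p θ hθ u).mul (hsm p θ' hθ' w)).sub ((hsm p θ hθ w).mul (hsm p θ' hθ' u)))
      (hD0 p)

end Calculus

/-! ### The Lorentz product, space and time components -/

theorem lor_comm (u w : R41) : lor u w = lor w u := by simp only [lor]; ring

theorem lor_add_left (u u' w : R41) : lor (u + u') w = lor u w + lor u' w := by
  simp only [lor, Pi.add_apply]; ring

theorem lor_add_right (u w w' : R41) : lor u (w + w') = lor u w + lor u w' := by
  simp only [lor, Pi.add_apply]; ring

theorem lor_neg_left (u w : R41) : lor (-u) w = -lor u w := by
  simp only [lor, Pi.neg_apply]; ring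

theorem lor_neg_right (u w : R41) : lor u (-w) = -lor u w := by
  simp only [lor, Pi.neg_apply]; ring

theorem lor_smul_left (c : ℝ) (u w : R41) : lor (c • u) w = c * lor u w := by
  simp only [lor, Pi.smul_apply, smul_eq_mul]; ring

theorem lor_smul_right (c : ℝ) (u w : R41) : lor u (c • w) = c * lor u w := by
  simp only [lor, Pi.smul_apply, smul_eq_mul]; ring

theorem isBoundedBilinearMap_lor : IsBoundedBilinearMap ℝ (fun z : R41 × R41 => lor z.1 z.2) where
  add_left := lor_add_left
  add_right := lor_add_right
  smul_left := lor_smul_left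
  smul_right := fun c u w => lor_smul_right c u w
  bound := by
    refine ⟨4, by norm_num, fun u w => ?_⟩
    have hm : ∀ i j, |u i * w j| ≤ ‖u‖ * ‖w‖ := fun i j => by
      rw [abs_mul]
      exact mul_le_mul (norm_le_pi_norm u i) (norm_le_pi_norm w j) (abs_nonneg _) (norm_nonneg _)
    have h0 := abs_le.1 (hm 0 3)
    have h1 := abs_le.1 (hm 3 0)
    have h2 := abs_le.1 (hm 1 1)
    have h3 := abs_le.1 (hm 2 2)
    rw [Real.norm_eq_abs, abs_le]
    simp only [lor]
    constructor <;> linarith [h0.1, h0.2, h1.1, h1.2, h2.1, h2.2, h3.1, h3.2]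

theorem contDiff_lor : ContDiff ℝ ∞ (fun z : R41 × R41 => lor z.1 z.2) :=
  isBoundedBilinearMap_lor.contDiff

/-- The time component of a vector. -/
def tm : R41 →L[ℝ] ℝ :=
  (Real.sqrt 2)⁻¹ • (ContinuousLinearMap.proj (R := ℝ) (φ := fun _ : Fin 4 => ℝ) 0 +
    ContinuousLinearMap.proj (R := ℝ) (φ := fun _ : Fin 4 => ℝ) 3)

theorem tm_apply (y : R41) : tm y = (Real.sqrt 2)⁻¹ * (y 0 + y 3) := rfl

/-- The space component of a vector. -/
def sp : R41 →L[ℝ] E3 :=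
  (EuclideanSpace.equiv (Fin 3) ℝ).symm.toContinuousLinearMap.comp
    (ContinuousLinearMap.pi ![(Real.sqrt 2)⁻¹ •
      (ContinuousLinearMap.proj (R := ℝ) (φ := fun _ : Fin 4 => ℝ) 0 -
        ContinuousLinearMap.proj (R := ℝ) (φ := fun _ : Fin 4 => ℝ) 3),
      ContinuousLinearMap.proj (R := ℝ) (φ := fun _ : Fin 4 => ℝ) 1,
      ContinuousLinearMap.proj (R := ℝ) (φ := fun _ : Fin 4 => ℝ) 2])

theorem sp_zero (y : R41) : sp y 0 = (Real.sqrt 2)⁻¹ * (y 0 - y 3) := rfl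
theorem sp_one (y : R41) : sp y 1 = y 1 := rfl
theorem sp_two (y : R41) : sp y 2 = y 2 := rfl

theorem sqrt_two_inv_mul : (Real.sqrt 2)⁻¹ * (Real.sqrt 2)⁻¹ = 1 / 2 := by
  rw [← mul_inv, Real.mul_self_sqrt (by norm_num)]; norm_num

theorem tm_sphereVec (x : E3) (t : ℝ) : tm (sphereVec x t) = t := by
  simp only [tm_apply, sphereVec, Matrix.cons_val]
  have := sqrt_two_inv_mul
  rw [div_eq_mul_inv, div_eq_mul_inv]
  linear_combination (2 * t) * this

theorem sp_sphereVec (x : E3) (t : ℝ) : sp (sphereVec x t) = x := by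
  have := sqrt_two_inv_mul
  ext i
  fin_cases i
  · simp only [Fin.zero_eta, sp_zero, sphereVec, Matrix.cons_val]
    rw [div_eq_mul_inv, div_eq_mul_inv]
    linear_combination (2 * x 0) * this
  · rfl
  · rfl

theorem sphereVec_sp_tm (y : R41) : sphereVec (sp y) (tm y) = y := by
  have := sqrt_two_inv_mul
  ext i
  fin_cases i
  · simp only [sphereVec, tm_apply, sp_zero, div_eq_mul_inv, Fin.zero_eta, Matrix.cons_val]
    linear_combination (2 * y 0) * this
  · rfl
  · rfl
  · simp only [sphereVec, tm_apply, sp_zero, div_eq_mul_inv, Fin.reduceFinMk, Matrix.cons_val]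
    linear_combination (2 * y 3) * this

theorem ext_sp_tm {y z : R41} (h : sp y = sp z) (h' : tm y = tm z) : y = z := by
  rw [← sphereVec_sp_tm y, h, h', sphereVec_sp_tm]

/-- In space and time components the product takes its diagonal form, which relates null lines to
the Euclidean data of contact elements. -/
theorem lor_eq_inner (y z : R41) : lor y z = inner ℝ (sp y) (sp z) - tm y * tm z := by
  have := sqrt_two_inv_mul
  simp only [PiLp.inner_apply, RCLike.inner_apply, conj_trivial, Fin.sum_univ_three, sp_zero,
    sp_one, sp_two, tm_apply, lor]
  linear_combination (2 * (y 0 * z 3 + y 3 * z 0)) * this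

theorem tm_pos_of_mem_lightCone {y : R41} (h : y ∈ lightCone) : 0 < tm y := by
  rw [tm_apply]
  exact mul_pos (by positivity) h.2

theorem sphereVec_add (x y : E3) (s t : ℝ) :
    sphereVec (x + y) (s + t) = sphereVec x s + sphereVec y t := by
  apply ext_sp_tm
  · rw [map_add, sp_sphereVec, sp_sphereVec, sp_sphereVec]
  · rw [map_add, tm_sphereVec, tm_sphereVec, tm_sphereVec]

theorem sphereVec_smul (c : ℝ) (x : E3) (t : ℝ) :
    sphereVec (c • x) (c * t) = c • sphereVec x t := by
  apply ext_sp_tm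
  · rw [map_smul, sp_sphereVec, sp_sphereVec]
  · rw [map_smul, tm_sphereVec, tm_sphereVec, smul_eq_mul]

theorem ContactElement.line_eq (e : ContactElement) :
    e.line = affLine (sphereVec e.pt 0) e.dir := by
  ext y
  simp only [ContactElement.line, affLine, mem_ofPred_eq, ContactElement.dir]
  refine exists_congr fun t => ?_
  rw [← sphereVec_smul, ← sphereVec_add, zero_add, mul_one, smul_neg, sub_eq_add_neg]

theorem ContactElement.tm_dir (e : ContactElement) : tm e.dir = 1 := tm_sphereVec _ _

theorem ContactElement.sp_dir (e : ContactElement) : sp e.dir = -e.normal := sp_sphereVec _ _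

/-- The point and the direction of a contact element in terms of any point and any future
pointing direction of its line. -/
theorem ContactElement.eq_of_line {e : ContactElement} {b₀ b₁ : R41} (h1 : tm b₁ ≠ 0)
    (h : e.line = affLine b₀ b₁) :
    sphereVec e.pt 0 = b₀ + (-(tm b₀) * (tm b₁)⁻¹) • b₁ ∧ e.dir = (tm b₁)⁻¹ • b₁ := by
  rw [e.line_eq] at h
  have hp : sphereVec e.pt 0 ∈ affLine b₀ b₁ := h ▸ ⟨0, by simp⟩
  have hq : sphereVec e.pt 0 + e.dir ∈ affLine b₀ b₁ := h ▸ ⟨1, by simp⟩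
  obtain ⟨t, ht⟩ := hp
  obtain ⟨t', ht'⟩ := hq
  have e1 := congrArg tm ht
  have e2 := congrArg tm ht'
  simp only [map_add, map_smul, tm_sphereVec, smul_eq_mul, e.tm_dir] at e1 e2
  have htt : t = -(tm b₀) * (tm b₁)⁻¹ := by field_simp; linarith
  have htt' : t' - t = (tm b₁)⁻¹ := by field_simp; linarith
  refine ⟨by rw [ht, htt], ?_⟩
  rw [← htt', sub_smul]
  have : e.dir = (sphereVec e.pt 0 + e.dir) - sphereVec e.pt 0 := by abel
  rw [this, ht', ht]
  abel

theorem affLine_eq {b₀ b₁ : R41} {c τ : ℝ} (hc : c ≠ 0) :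
    affLine (b₀ + τ • b₁) (c • b₁) = affLine b₀ b₁ := by
  ext y
  constructor
  · rintro ⟨t, rfl⟩
    exact ⟨τ + t * c, by rw [add_smul, mul_smul]; abel⟩
  · rintro ⟨t, rfl⟩
    refine ⟨(t - τ) * c⁻¹, ?_⟩
    rw [smul_smul, mul_assoc, inv_mul_cancel₀ hc, mul_one, sub_smul]
    abel

/-- Every null line is the line of a contact element. -/
theorem exists_contactElement {b₀ b₁ : R41} (h : b₁ ∈ lightCone) :
    ∃ e : ContactElement, e.line = affLine b₀ b₁ := by
  have hpos := tm_pos_of_mem_lightCone h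
  have hnorm : ‖-sp ((tm b₁)⁻¹ • b₁)‖ = 1 := by
    have h1 := lor_eq_inner b₁ b₁
    rw [h.1, real_inner_self_eq_norm_sq] at h1
    have h2 : ‖sp b₁‖ = tm b₁ := by
      rw [← abs_of_pos hpos, ← abs_norm, ← sq_eq_sq_iff_abs_eq_abs]; linarith
    rw [norm_neg, map_smul, norm_smul, h2, Real.norm_eq_abs, abs_of_pos (inv_pos.2 hpos),
      inv_mul_cancel₀ hpos.ne']
  refine ⟨⟨sp (b₀ + (-(tm b₀) * (tm b₁)⁻¹) • b₁), -sp ((tm b₁)⁻¹ • b₁), hnorm⟩, ?_⟩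
  rw [ContactElement.line_eq]
  refine (congrArg₂ affLine ?_ ?_).trans (affLine_eq (inv_ne_zero hpos.ne')
    (τ := -(tm b₀) * (tm b₁)⁻¹))
  · conv_rhs => rw [← sphereVec_sp_tm (b₀ + (-(tm b₀) * (tm b₁)⁻¹) • b₁)]
    congr 1
    rw [map_add, map_smul, smul_eq_mul, mul_assoc, inv_mul_cancel₀ hpos.ne']
    ring
  · simp only [ContactElement.dir, neg_neg]
    conv_rhs => rw [← sphereVec_sp_tm ((tm b₁)⁻¹ • b₁)]
    congr 1
    rw [map_smul, smul_eq_mul, inv_mul_cancel₀ hpos.ne']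

/-! ### Families of null lines -/

section Lines

variable {M : Type*} [TopologicalSpace M] [ChartedSpace E2 M] [IsManifold (𝓡 2) ∞ M]

theorem dd_lor {f g : M → R41} {x : M} (hf : MDifferentiableAt (𝓡 2) 𝓘(ℝ, R41) f x)
    (hg : MDifferentiableAt (𝓡 2) 𝓘(ℝ, R41) g x) (X : T x) :
    dd (fun z => lor (f z) (g z)) x X = lor (f x) (dd g x X) + lor (dd f x X) (g x) :=
  dd_bilin hf isBoundedBilinearMap_lor hg X

theorem SmoothOn.lor {f g : M → R41} {U : Set M} (hf : SmoothOn U f) (hg : SmoothOn U g) :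
    SmoothOn U (fun x => lor (f x) (g x)) := (hf.prodMk hg).contDiff_comp contDiff_lor

/-- `b₀` and `b₁` are smooth fields of points and of future pointing directions of the null lines
of `F` on `U`. -/
structure IsLineField (U : Set M) (F : M → ContactElement) (b₀ b₁ : M → R41) : Prop where
  smooth₀ : SmoothOn U b₀
  smooth₁ : SmoothOn U b₁
  mem : ∀ p ∈ U, b₁ p ∈ lightCone
  line : ∀ p ∈ U, (F p).line = affLine (b₀ p) (b₁ p)

namespace IsLineField

variable {U : Set M} {F : M → ContactElement} {b₀ b₁ : M → R41} (h : IsLineField U F b₀ b₁)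
  (hU : IsOpen U)
include h

theorem tm_pos {p : M} (hp : p ∈ U) : 0 < tm (b₁ p) := tm_pos_of_mem_lightCone (h.mem p hp)

theorem smooth_inv : SmoothOn U (fun p => (tm (b₁ p))⁻¹) :=
  (h.smooth₁.clm tm).inv fun p hp => (h.tm_pos hp).ne'

theorem smooth_shift : SmoothOn U (fun p => -(tm (b₀ p)) * (tm (b₁ p))⁻¹) :=
  (h.smooth₀.clm tm).neg.mul h.smooth_inv

theorem pt_eq {p : M} (hp : p ∈ U) : sphereVec (F p).pt 0 =
    b₀ p + (-(tm (b₀ p)) * (tm (b₁ p))⁻¹) • b₁ p :=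
  (ContactElement.eq_of_line (h.tm_pos hp).ne' (h.line p hp)).1

theorem dir_eq {p : M} (hp : p ∈ U) : (F p).dir = (tm (b₁ p))⁻¹ • b₁ p :=
  (ContactElement.eq_of_line (h.tm_pos hp).ne' (h.line p hp)).2

theorem smooth_sphereVec_pt : SmoothOn U (fun p => sphereVec (F p).pt 0) :=
  (h.smooth₀.add (h.smooth_shift.smul h.smooth₁)).congr fun p hp => h.pt_eq hp

theorem smooth_dir : SmoothOn U (fun p => (F p).dir) :=
  (h.smooth_inv.smul h.smooth₁).congr fun p hp => h.dir_eq hp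

theorem smooth_pt : SmoothOn U (fun p => (F p).pt) :=
  (h.smooth_sphereVec_pt.clm sp).congr fun p hp => (sp_sphereVec _ _).symm

theorem smooth_normal : SmoothOn U (fun p => (F p).normal) :=
  (h.smooth_dir.clm sp).neg.congr fun p hp => by rw [ContactElement.sp_dir, neg_neg]

include hU

theorem dd_dir {p : M} (hp : p ∈ U) (X : T p) : dd (fun x => (F x).dir) p X =
    (tm (b₁ p))⁻¹ • dd b₁ p X + dd (fun x => (tm (b₁ x))⁻¹) p X • b₁ p := by
  rw [dd_congr hU hp fun z hz => h.dir_eq hz]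
  exact dd_smul (h.smooth₁.mdifferentiableAt hU hp) (h.smooth_inv.mdifferentiableAt hU hp) X

theorem dd_sphereVec_pt {p : M} (hp : p ∈ U) (X : T p) :
    dd (fun x => sphereVec (F x).pt 0) p X =
    dd b₀ p X + ((-(tm (b₀ p)) * (tm (b₁ p))⁻¹) • dd b₁ p X +
      dd (fun x => -(tm (b₀ x)) * (tm (b₁ x))⁻¹) p X • b₁ p) := by
  rw [dd_congr hU hp fun z hz => h.pt_eq hz,
    dd_add (h.smooth₀.mdifferentiableAt hU hp)
      ((h.smooth_shift.smul h.smooth₁).mdifferentiableAt hU hp),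
    dd_smul (h.smooth₁.mdifferentiableAt hU hp) (h.smooth_shift.mdifferentiableAt hU hp)]

theorem sp_dd_pt {p : M} (hp : p ∈ U) (X : T p) :
    dd (fun x => (F x).pt) p X = sp (dd (fun x => sphereVec (F x).pt 0) p X) := by
  rw [← dd_clm sp (h.smooth_sphereVec_pt.mdifferentiableAt hU hp)]
  simp only [sp_sphereVec]

theorem sp_dd_dir {p : M} (hp : p ∈ U) (X : T p) :
    dd (fun x => (F x).normal) p X = -sp (dd (fun x => (F x).dir) p X) := by
  rw [← dd_clm sp (h.smooth_dir.mdifferentiableAt hU hp)]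
  simp only [ContactElement.sp_dir]
  have := dd_clm (-ContinuousLinearMap.id ℝ E3) (h.smooth_normal.mdifferentiableAt hU hp) X
  simp only [_root_.neg_apply, ContinuousLinearMap.id_apply] at this
  rw [this, neg_neg]

theorem tm_dd_pt {p : M} (hp : p ∈ U) (X : T p) :
    tm (dd (fun x => sphereVec (F x).pt 0) p X) = 0 := by
  rw [← dd_clm tm (h.smooth_sphereVec_pt.mdifferentiableAt hU hp)]
  simp only [tm_sphereVec]
  rw [dd_const]; rfl

theorem tm_dd_dir {p : M} (hp : p ∈ U) (X : T p) : tm (dd (fun x => (F x).dir) p X) = 0 := by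
  rw [← dd_clm tm (h.smooth_dir.mdifferentiableAt hU hp)]
  simp only [ContactElement.tm_dir]
  rw [dd_const]; rfl

theorem lor_dd_self {p : M} (hp : p ∈ U) (X : T p) : lor (dd b₁ p X) (b₁ p) = 0 := by
  have hm := h.smooth₁.mdifferentiableAt hU hp
  have h1 := dd_lor hm hm X
  rw [dd_congr hU hp (g := fun _ => (0 : ℝ)) fun z hz => (h.mem z hz).1, dd_const,
    lor_comm (b₁ p)] at h1
  have : (0 : T p →L[ℝ] ℝ) X = 0 := rfl
  linarith

/-- The point and direction of the contact element differ from b₀ and a multiple of b₁ by multiples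
of b₁ only, and ⟨b₁,b₁⟩ = ⟨db₁,b₁⟩ = 0. So the contact condition reads ⟨db₀,b₁⟩ = 0 for any choice
of fields. -/
theorem inner_dd_pt_normal {p : M} (hp : p ∈ U) (X : T p) :
    inner ℝ (dd (fun x => (F x).pt) p X) (F p).normal = -((tm (b₁ p))⁻¹ * lor (dd b₀ p X) (b₁ p)) := by
  have h1 := lor_eq_inner (dd (fun x => sphereVec (F x).pt 0) p X) (F p).dir
  rw [h.tm_dd_pt hU hp, ← h.sp_dd_pt hU hp, ContactElement.sp_dir, inner_neg_right, zero_mul,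
    sub_zero, h.dd_sphereVec_pt hU hp, h.dir_eq hp] at h1
  simp only [lor_add_left, lor_smul_left, lor_smul_right, h.lor_dd_self hU hp, (h.mem p hp).1] at h1
  linarith

/-- Rescaling b₁ adds to its differential only multiples of b₁, which are orthogonal to b₁ and db₁.
Hence III is computed up to a positive factor from any direction field, in particular from a₁ and
from w. -/
theorem thirdForm_eq {p : M} (hp : p ∈ U) (X Y : T p) :
    thirdForm F p X Y = (tm (b₁ p))⁻¹ ^ 2 * lor (dd b₁ p X) (dd b₁ p Y) := by
  have h1 := lor_eq_inner (dd (fun x => (F x).dir) p X) (dd (fun x => (F x).dir) p Y)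
  rw [h.tm_dd_dir hU hp, zero_mul, sub_zero] at h1
  rw [thirdForm, h.sp_dd_dir hU hp, h.sp_dd_dir hU hp, inner_neg_neg, ← h1, h.dd_dir hU hp,
    h.dd_dir hU hp]
  simp only [lor_add_left, lor_smul_left, lor_smul_right, lor_add_right, h.lor_dd_self hU hp,
    (h.mem p hp).1, lor_comm (b₁ p) (dd b₁ p Y)]
  ring

variable (hc : ∀ p ∈ U, ∀ X : T p, lor (dd b₀ p X) (b₁ p) = 0)
include hc

/-- The terms along b₁ drop out as for III; those paired with db₀ vanish by the Legendre condition.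
The shift by a multiple of db₁ comes from sliding b₀ along its line to time zero. -/
theorem secondForm_eq {p : M} (hp : p ∈ U) (X Y : T p) :
    secondForm F p X Y = (tm (b₁ p))⁻¹ *
      lor (dd b₀ p X + (-(tm (b₀ p)) * (tm (b₁ p))⁻¹) • dd b₁ p X) (dd b₁ p Y) := by
  have h1 := lor_eq_inner (dd (fun x => sphereVec (F x).pt 0) p X) (dd (fun x => (F x).dir) p Y)
  rw [h.tm_dd_pt hU hp, zero_mul, sub_zero] at h1
  rw [secondForm, h.sp_dd_dir hU hp, h.sp_dd_pt hU hp, inner_neg_right, neg_neg, ← h1,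
    h.dd_dir hU hp, h.dd_sphereVec_pt hU hp]
  simp only [lor_add_left, lor_smul_left, lor_smul_right, lor_add_right, h.lor_dd_self hU hp,
    (h.mem p hp).1, lor_comm (b₁ p) (dd b₁ p Y), hc p hp]
  ring

theorem isLegendreImmersion
    (hIII : ∀ p ∈ U, ∀ X : T p, X ≠ 0 → 0 < lor (dd b₁ p X) (dd b₁ p X)) :
    IsLegendreImmersion U F where
  smooth_pt := h.smooth_pt
  smooth_normal := h.smooth_normal
  contact p hp X := by rw [h.inner_dd_pt_normal hU hp, hc p hp, mul_zero, neg_zero]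
  immersion p hp X _ hX := by
    by_contra h0
    have h1 := h.thirdForm_eq hU hp X X
    rw [thirdForm, hX, inner_zero_left] at h1
    have := mul_pos (pow_pos (inv_pos.2 (h.tm_pos hp)) 2) (hIII p hp X h0)
    linarith

omit hc in
theorem congruenceForm_eq {S : M → R41} {p : M} (hp : p ∈ U) (X Y : T p)
    (hS : lor (dd S p X) (b₁ p) = 0) :
    congruenceForm S F p X Y = (tm (b₁ p))⁻¹ * lor (dd S p X) (dd b₁ p Y) := by
  rw [congruenceForm, h.dd_dir hU hp]
  simp only [lor_smul_right, lor_add_right, hS]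
  ring

omit hc in
/-- A tangent vector is principal if the differentials of a point and of a direction of the null
line are linearly dependent modulo the direction. -/
theorem isPrincipalDirection {p : M} (hp : p ∈ U) {X : T p} (hX : X ≠ 0) {a b l : ℝ}
    (hab : a ≠ 0 ∨ b ≠ 0) (hl : a • dd b₀ p X + b • dd b₁ p X = l • b₁ p) :
    IsPrincipalDirection F p X := by
  have ht := h.tm_pos hp
  set c := tm (b₁ p) with hcdef
  set τ := -(tm (b₀ p)) * c⁻¹ with hτ
  -- With pt = b₀ + τb₁ and dir = c⁻¹b₁, this is the coefficient for which a·d(pt) - c(aτ-b)·d(dir)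
  -- equals a·db₀ + b·db₁ modulo b₁, that is, a multiple of b₁. Having time component 0, it
  -- vanishes. The sign changes because the space part of dir is -n.
  refine ⟨hX, a, c * (a * τ - b), ?_, ?_⟩
  · by_contra hne
    push Not at hne
    obtain ⟨h1, h2⟩ := hne
    rw [h1] at h2 hab
    simp [ht.ne'] at h2
    simp [h2] at hab
  · set Z := a • dd (fun x => sphereVec (F x).pt 0) p X -
      (c * (a * τ - b)) • dd (fun x => (F x).dir) p X with hZ
    have htm : tm Z = 0 := by
      rw [hZ, map_sub, map_smul, map_smul, h.tm_dd_pt hU hp, h.tm_dd_dir hU hp]; simp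
    have hZ' : ∃ k : ℝ, Z = k • b₁ p := by
      refine ⟨l + a * dd (fun x => -(tm (b₀ x)) * (tm (b₁ x))⁻¹) p X -
        c * (a * τ - b) * dd (fun x => (tm (b₁ x))⁻¹) p X, ?_⟩
      rw [hZ, h.dd_dir hU hp, h.dd_sphereVec_pt hU hp, ← hcdef, ← hτ]
      have hcc : c * (a * τ - b) * c⁻¹ = a * τ - b := by field_simp
      rw [sub_smul, add_smul, ← hl, smul_add _ (c⁻¹ • dd b₁ p X), smul_smul _ c⁻¹, hcc]
      module
    obtain ⟨k, hk⟩ := hZ'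
    have hk0 : k = 0 := by
      rw [hk, map_smul, smul_eq_mul] at htm
      exact (mul_eq_zero.1 htm).resolve_right ht.ne'
    have hZ0 : sp Z = 0 := by rw [hk, hk0, zero_smul, map_zero]
    rw [h.sp_dd_pt hU hp, h.sp_dd_dir hU hp, ← hZ0, hZ, map_sub, map_smul, map_smul, smul_neg]
    abel

end IsLineField

end Lines

/-! ### Null frames -/

/-- The frame which is dual to `a` with respect to the Lorentz product. -/
def dualVec (a : Fin 4 → R41) : Fin 4 → R41 := ![-a 3, a 1, a 2, -a 0]

theorem frameMatrix_mulVec (a : Fin 4 → R41) (v : R41) :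
    (frameMatrix a).mulVec v = ∑ i, v i • a i := by
  ext k
  simp only [frameMatrix, Matrix.mulVec, dotProduct, Matrix.transpose_apply, Matrix.of_apply,
    Finset.sum_apply, Pi.smul_apply, smul_eq_mul]
  exact Finset.sum_congr rfl fun i _ => mul_comm _ _

theorem sum_single_smul (a : Fin 4 → R41) (j : Fin 4) :
    ∑ i, (Pi.single j 1 : R41) i • a i = a j := by
  simp [Pi.single_apply]

section Frame

variable {a : Fin 4 → R41} (h : frameMatrix a ∈ properLorentz)
include h

theorem lor_frame (i j : Fin 4) : lor (a i) (a j) = lor (Pi.single i 1) (Pi.single j 1) := by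
  have := h.1 (Pi.single i 1) (Pi.single j 1)
  rwa [frameMatrix_mulVec, frameMatrix_mulVec, sum_single_smul, sum_single_smul] at this

theorem lor_dualVec (i j : Fin 4) : lor (dualVec a i) (a j) = if i = j then 1 else 0 := by
  fin_cases i <;> fin_cases j <;>
    simp [dualVec, lor_neg_left, lor_frame h] <;> simp [lor]

/-- By duality the rows of the inverse matrix are Lorentz products with the dual frame. The
connection forms thus become products ⟨·,da⟩, and the inverse matrix never has to be differentiated.
-/
theorem inv_frameMatrix_mulVec (b : R41) (i : Fin 4) :
    ∑ k, (frameMatrix a)⁻¹ i k * b k = lor (dualVec a i) b := by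
  have hmul : (Matrix.of fun i k => lor (dualVec a i) (Pi.single k 1)) * frameMatrix a = 1 := by
    ext i j
    rw [Matrix.one_apply, ← lor_dualVec h i j]
    simp [Matrix.mul_apply, frameMatrix, Fin.sum_univ_four, lor]
    ring
  rw [Matrix.inv_eq_left_inv hmul]
  simp [Fin.sum_univ_four, lor]
  ring

theorem frame_expand (b : R41) : b = ∑ i, lor (dualVec a i) b • a i := by
  have hdet : IsUnit (frameMatrix a).det := by rw [h.2.1]; exact isUnit_one
  conv_lhs => rw [← Matrix.one_mulVec b, ← Matrix.mul_nonsing_inv _ hdet, ← Matrix.mulVec_mulVec,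
    frameMatrix_mulVec]
  refine Finset.sum_congr rfl fun i _ => ?_
  rw [← inv_frameMatrix_mulVec h]
  rfl

theorem lor_sum_frame (v w : R41) : lor (∑ i, v i • a i) (∑ i, w i • a i) = lor v w := by
  rw [← frameMatrix_mulVec, ← frameMatrix_mulVec, h.1]

theorem lor_sum_frame_right (v : R41) :
    lor (a 0) (∑ i, v i • a i) = -v 3 ∧ lor (a 1) (∑ i, v i • a i) = v 1 ∧
      lor (a 2) (∑ i, v i • a i) = v 2 ∧ lor (a 3) (∑ i, v i • a i) = -v 0 := by
  have hs : ∀ j, lor (a j) (∑ i, v i • a i) = lor (Pi.single j 1) v := by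
    intro j
    have := lor_sum_frame h (Pi.single j 1) v
    rwa [sum_single_smul] at this
  refine ⟨?_, ?_, ?_, ?_⟩ <;> rw [hs] <;> simp [lor]

theorem lor_eq_components (b c : R41) : lor b c =
    -(lor (dualVec a 0) b * lor (dualVec a 3) c) - lor (dualVec a 3) b * lor (dualVec a 0) c +
      lor (dualVec a 1) b * lor (dualVec a 1) c + lor (dualVec a 2) b * lor (dualVec a 2) c := by
  conv_lhs => rw [frame_expand h b, frame_expand h c]
  exact lor_sum_frame h _ _

theorem sum_frame_mem_lightCone {v : R41} (hv : v ∈ lightCone) : ∑ i, v i • a i ∈ lightCone := by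
  rw [← frameMatrix_mulVec]; exact h.2.2 v hv

theorem frame_zero_mem_lightCone : a 0 ∈ lightCone := by
  have := sum_frame_mem_lightCone h (v := Pi.single 0 1) ⟨by simp [lor], by simp⟩
  simpa using this

end Frame

/-! ### The connection form of a principal frame: structure equations and flatness of the
deformation -/

section Framing

variable {M : Type*} [TopologicalSpace M] [ChartedSpace E2 M] [IsManifold (𝓡 2) ∞ M]

/-- The 1-form `⟨f, dg⟩`. -/
def lorForm (f g : M → R41) (x : M) : T x →L[ℝ] ℝ :=
  -(f x 0 • dd (fun z => g z 3) x) - f x 3 • dd (fun z => g z 0) x +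
    f x 1 • dd (fun z => g z 1) x + f x 2 • dd (fun z => g z 2) x

theorem lorForm_apply {f g : M → R41} {x : M} (hg : MDifferentiableAt (𝓡 2) 𝓘(ℝ, R41) g x)
    (X : T x) : lorForm f g x X = lor (f x) (dd g x X) := by
  simp only [lorForm, _root_.add_apply, _root_.sub_apply, _root_.neg_apply, _root_.smul_apply,
    smul_eq_mul, dd_apply hg, lor]

theorem hasExtDeriv_lorForm {f g : M → R41} {U : Set M} (hU : IsOpen U) (hf : SmoothOn U f)
    (hg : SmoothOn U g) : HasExtDeriv U (lorForm f g)
      (fun x X Y => lor (dd f x X) (dd g x Y) - lor (dd f x Y) (dd g x X)) := by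
  have hs : ∀ i j, HasExtDeriv U (fun x => f x i • dd (fun z => g z j) x) (fun x X Y =>
      dd (fun z => f z i) x X * dd (fun z => g z j) x Y -
        dd (fun z => f z i) x Y * dd (fun z => g z j) x X) :=
    fun i j => HasExtDeriv.smul_dd (hf.apply i) (hg.apply j) hU
  refine (((((hs 0 3).neg hU).sub (hs 3 0) hU).add (hs 1 1) hU).add (hs 2 2) hU).congr hU
    (fun x hx => rfl) fun x hx X Y => ?_
  have hfx := hf.mdifferentiableAt hU hx
  have hgx := hg.mdifferentiableAt hU hx
  simp only [dd_apply hfx, dd_apply hgx, lor]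
  ring

variable {U : Set M} {F : M → ContactElement} {A : FrameField M}

theorem FrameField.conn_apply {p : M} (h : frameMatrix (A.vec p) ∈ properLorentz) (i j : Fin 4)
    (X : T p) : A.conn p i j X = lor (dualVec (A.vec p) i) (dd (fun x => A.vec x j) p X) := by
  rw [← inv_frameMatrix_mulVec h]
  simp only [FrameField.conn, _root_.sum_apply, _root_.smul_apply, smul_eq_mul]
  rfl

theorem FrameField.conn₀_apply {p : M} (h : frameMatrix (A.vec p) ∈ properLorentz) (i : Fin 4)
    (X : T p) : A.conn₀ p i X = lor (dualVec (A.vec p) i) (dd A.pos p X) := by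
  rw [← inv_frameMatrix_mulVec h]
  simp only [FrameField.conn₀, _root_.sum_apply, _root_.smul_apply, smul_eq_mul]
  rfl

namespace IsPrincipalFraming

variable (hA : IsPrincipalFraming U F A) (hU : IsOpen U)
include hA

theorem isLineField : IsLineField U F A.pos (fun x => A.vec x 0) where
  smooth₀ := hA.smooth_pos
  smooth₁ := hA.smooth_vec 0
  mem p hp := frame_zero_mem_lightCone (hA.lorentz p hp)
  line p hp := (hA.along p hp).symm

theorem conn_apply {p : M} (hp : p ∈ U) (i j : Fin 4) (X : T p) :
    A.conn p i j X = lor (dualVec (A.vec p) i) (dd (fun x => A.vec x j) p X) :=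
  FrameField.conn_apply (hA.lorentz p hp) i j X

theorem conn₀_apply {p : M} (hp : p ∈ U) (i : Fin 4) (X : T p) :
    A.conn₀ p i X = lor (dualVec (A.vec p) i) (dd A.pos p X) :=
  FrameField.conn₀_apply (hA.lorentz p hp) i X

theorem dd_vec {p : M} (hp : p ∈ U) (j : Fin 4) (X : T p) :
    dd (fun x => A.vec x j) p X = ∑ i, A.conn p i j X • A.vec p i := by
  rw [frame_expand (hA.lorentz p hp) (dd (fun x => A.vec x j) p X)]
  simp only [hA.conn_apply hp]

theorem dd_pos {p : M} (hp : p ∈ U) (X : T p) :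
    dd A.pos p X = ∑ i, A.conn₀ p i X • A.vec p i := by
  rw [frame_expand (hA.lorentz p hp) (dd A.pos p X)]
  simp only [hA.conn₀_apply hp]

theorem lor_dd_vec_dd_vec {p : M} (hp : p ∈ U) (i j : Fin 4) (X Y : T p) :
    lor (dd (fun x => A.vec x i) p X) (dd (fun x => A.vec x j) p Y) =
      -(A.conn p 0 i X * A.conn p 3 j Y) - A.conn p 3 i X * A.conn p 0 j Y +
        A.conn p 1 i X * A.conn p 1 j Y + A.conn p 2 i X * A.conn p 2 j Y := by
  rw [lor_eq_components (hA.lorentz p hp)]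
  simp only [hA.conn_apply hp]

include hU

theorem lor_dd_vec {p : M} (hp : p ∈ U) (i j : Fin 4) (X : T p) :
    lor (A.vec p i) (dd (fun x => A.vec x j) p X) +
      lor (A.vec p j) (dd (fun x => A.vec x i) p X) = 0 := by
  have h1 := dd_lor ((hA.smooth_vec i).mdifferentiableAt hU hp)
    ((hA.smooth_vec j).mdifferentiableAt hU hp) X
  rw [dd_congr hU hp (g := fun _ => lor (Pi.single i 1) (Pi.single j 1)) fun z hz =>
    lor_frame (hA.lorentz z hz) i j, dd_const] at h1
  rw [lor_comm (A.vec p j), ← h1]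
  rfl

/-- The linear part of the connection form takes values in the Lie algebra of the Lorentz
group. -/
theorem conn_skew {p : M} (hp : p ∈ U) :
    A.conn p 3 0 = 0 ∧ A.conn p 0 3 = 0 ∧ A.conn p 1 1 = 0 ∧ A.conn p 2 2 = 0 ∧
      A.conn p 3 1 = A.conn p 1 0 ∧ A.conn p 3 2 = A.conn p 2 0 ∧ A.conn p 3 3 = -A.conn p 0 0 ∧
      A.conn p 1 3 = A.conn p 0 1 ∧ A.conn p 2 3 = A.conn p 0 2 ∧
      A.conn p 1 2 = -A.conn p 2 1 := by
  have hs := fun i j X => hA.lor_dd_vec hU hp i j X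
  refine ⟨?_, ?_, ?_, ?_, ?_, ?_, ?_, ?_, ?_, ?_⟩ <;> ext X <;>
    simp only [hA.conn_apply hp, _root_.neg_apply, _root_.zero_apply, dualVec, Matrix.cons_val,
      lor_neg_left]
  · linarith [hs 0 0 X]
  · linarith [hs 3 3 X]
  · linarith [hs 1 1 X]
  · linarith [hs 2 2 X]
  · linarith [hs 0 1 X]
  · linarith [hs 0 2 X]
  · linarith [hs 0 3 X]
  · linarith [hs 1 3 X]
  · linarith [hs 2 3 X]
  · linarith [hs 1 2 X]

theorem smooth_dualVec (i : Fin 4) : SmoothOn U (fun x => dualVec (A.vec x) i) := by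
  fin_cases i
  · exact (hA.smooth_vec 3).neg
  · exact hA.smooth_vec 1
  · exact hA.smooth_vec 2
  · exact (hA.smooth_vec 0).neg

theorem smoothForm_conn₀ (i : Fin 4) : SmoothForm U (fun x => A.conn₀ x i) :=
  (hasExtDeriv_lorForm hU (hA.smooth_dualVec hU i) hA.smooth_pos).smooth.congr fun x hx => by
    ext X
    rw [hA.conn₀_apply hx, lorForm_apply (hA.smooth_pos.mdifferentiableAt hU hx)]

theorem dd_neg_vec {p : M} (hp : p ∈ U) (i : Fin 4) (X : T p) :
    dd (fun x => -A.vec x i) p X = -dd (fun x => A.vec x i) p X := by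
  have := dd_clm (-ContinuousLinearMap.id ℝ R41) ((hA.smooth_vec i).mdifferentiableAt hU hp) X
  simpa only [_root_.neg_apply, ContinuousLinearMap.id_apply] using this

/-- The structure equations `dα = -α ∧ α`. -/
theorem hasExtDeriv_conn (i j : Fin 4) : HasExtDeriv U (fun x => A.conn x i j)
    (fun x X Y => -∑ k, (A.conn x i k X * A.conn x k j Y - A.conn x i k Y * A.conn x k j X)) := by
  -- As αⁱⱼ is the product of the i-th dual vector with daⱼ, its exterior derivative is the product
  -- of the differentials of both. Each dual vector is plus or minus a frame vector, so expanding in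
  -- the frame and using skewness gives -α∧α.
  refine (hasExtDeriv_lorForm hU (hA.smooth_dualVec hU i) (hA.smooth_vec j)).congr hU
    (fun x hx => ?_) fun x hx X Y => ?_
  · ext X
    rw [hA.conn_apply hx, lorForm_apply ((hA.smooth_vec j).mdifferentiableAt hU hx)]
  · obtain ⟨h30, h03, h11, h22, h31, h32, h33, h13, h23, h12⟩ := hA.conn_skew hU hx
    fin_cases i <;>
      simp only [Fin.zero_eta, Fin.mk_one, Fin.reduceFinMk, dualVec, Matrix.cons_val,
        hA.dd_neg_vec hU hx, lor_neg_left, hA.lor_dd_vec_dd_vec hx, Fin.sum_univ_four, h30, h03,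
        h11, h22, h31, h32, h33, h13, h23, h12, _root_.neg_apply, _root_.zero_apply] <;>
      ring

/-- The coframe `α²₁, α³₁`. -/
theorem lor_dd_vec_zero {p : M} (hp : p ∈ U) (X Y : T p) :
    lor (dd (fun x => A.vec x 0) p X) (dd (fun x => A.vec x 0) p Y) =
      A.conn p 1 0 X * A.conn p 1 0 Y + A.conn p 2 0 X * A.conn p 2 0 Y := by
  rw [hA.lor_dd_vec_dd_vec hp, (hA.conn_skew hU hp).1]
  simp

variable (hF : IsLegendreImmersion U F)
  (hpos : ∀ p ∈ U, ∀ X : T p, X ≠ 0 → 0 < thirdForm F p X X)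

include hF in
-- Since α⁴₀ = -⟨a₁,da₀⟩, this is the contact condition.
theorem conn₀_three {p : M} (hp : p ∈ U) : A.conn₀ p 3 = 0 := by
  ext X
  have h1 := hA.isLineField.inner_dd_pt_normal hU hp X
  rw [hF.contact p hp] at h1
  have h2 := (inv_pos.2 (hA.isLineField.tm_pos hp)).ne'
  have h3 := (mul_eq_zero.1 (neg_eq_zero.1 h1.symm)).resolve_left h2
  rw [hA.conn₀_apply hp]
  simp only [dualVec, Matrix.cons_val, lor_neg_left, _root_.zero_apply]
  rw [lor_comm, h3, neg_zero]

include hpos in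
theorem coframe {p : M} (hp : p ∈ U) {X : T p} (h1 : A.conn p 1 0 X = 0)
    (h2 : A.conn p 2 0 X = 0) : X = 0 := by
  by_contra h0
  have h3 := hpos p hp X h0
  rw [hA.isLineField.thirdForm_eq hU hp, hA.lor_dd_vec_zero hU hp, h1, h2] at h3
  simp at h3

include hpos in
-- Positivity of III makes θ₂, θ₃ a coframe. The frame is chosen point by point; coefficients with
-- respect to it are smooth by `smoothOn_apply_dualFrame`.
theorem exists_dualFrame : ∃ e e' : (x : M) → T x,
    ∀ x ∈ U, IsDualFrame (A.conn x 1 0) (A.conn x 2 0) (e x) (e' x) := by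
  have : ∀ x, ∃ z : T x × T x, x ∈ U → IsDualFrame (A.conn x 1 0) (A.conn x 2 0) z.1 z.2 := by
    intro x
    by_cases hx : x ∈ U
    · obtain ⟨e, e', h⟩ := exists_isDualFrame (θ := A.conn x 1 0) (θ' := A.conn x 2 0)
        fun X h1 h2 => hA.coframe hU hpos hx h1 h2
      exact ⟨(e, e'), fun _ => h⟩
    · exact ⟨(0, 0), fun h => absurd h hx⟩
  choose z hz using this
  exact ⟨fun x => (z x).1, fun x => (z x).2, hz⟩

omit hU in
-- The principal conditions make α²₀ proportional to θ₂ and α³₀ to θ₃; evaluating on the dual frame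
-- gives the factors, called a and b in the overview.
theorem conn₀_eq {p : M} (hp : p ∈ U) {e e' : T p}
    (he : IsDualFrame (A.conn p 1 0) (A.conn p 2 0) e e') (X : T p) :
    A.conn₀ p 1 X = A.conn₀ p 1 e * A.conn p 1 0 X ∧
      A.conn₀ p 2 X = A.conn₀ p 2 e' * A.conn p 2 0 X := by
  have h1 := hA.principal₂ p hp X e
  have h2 := hA.principal₃ p hp X e'
  rw [he.left] at h1
  rw [he.right'] at h2
  constructor <;> linarith

variable {ρ : M → ℝ} (hρ : IsPotential U A ρ)
include hρ

omit hA hU in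
/-- The differential of a potential. -/
theorem _root_.Laguerre.IsPotential.exists_dd (hU : IsOpen U) {p : M} (hp : p ∈ U) : ∃ b c : ℝ,
    (∀ X, A.conn p 2 1 X = b * A.conn p 1 0 X + c * A.conn p 2 0 X) ∧
    ∀ X, dd ρ p X = -(2 * ρ p * (A.conn p 0 0 X - (b * A.conn p 2 0 X - c * A.conn p 1 0 X))) := by
  obtain ⟨σ, ⟨b, c, h1, h2⟩, h3⟩ := hρ.eq p hp
  refine ⟨b, c, fun X => by rw [h1]; rfl, fun X => ?_⟩
  have hne := (hρ.pos p hp).ne'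
  have h4 := dd_comp (Real.hasDerivAt_log hne).hasFDerivAt (hρ.smooth.mdifferentiableAt hU hp)
  have h5 := congrArg (fun L => L X) h3
  rw [h2] at h5
  rw [h4] at h5
  have h6 : 2 * (A.conn p 0 0 X - (b * A.conn p 2 0 X - c * A.conn p 1 0 X)) =
    -(dd ρ p X * (ρ p)⁻¹) := h5
  rw [mul_assoc, mul_left_comm, h6]
  field_simp

/-- The deformed connection form is flat. -/
theorem hasExtDeriv_connRho (i j : Fin 4) : HasExtDeriv U (fun x => A.connRho ρ x i j)
    (fun x X Y => -∑ k, (A.connRho ρ x i k X * A.connRho ρ x k j Y -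
      A.connRho ρ x i k Y * A.connRho ρ x k j X)) := by
  have hc := hA.hasExtDeriv_conn hU
  have hθ₂ := (hc 1 0).smul hρ.smooth hU
  have hθ₃ := ((hc 2 0).smul hρ.smooth hU).neg hU
  -- W₂ and W₃ are the exterior derivatives of ρθ₂ and ρθ₃, the entries of the added matrix N up to
  -- sign.
  set W₂ : (x : M) → T x → T x → ℝ := fun x X Y => dd ρ x X * A.conn x 1 0 Y -
    dd ρ x Y * A.conn x 1 0 X + ρ x * -∑ k, (A.conn x 1 k X * A.conn x k 0 Y -
      A.conn x 1 k Y * A.conn x k 0 X) with hW₂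
  set W₃ : (x : M) → T x → T x → ℝ := fun x X Y => dd ρ x X * A.conn x 2 0 Y -
    dd ρ x Y * A.conn x 2 0 X + ρ x * -∑ k, (A.conn x 2 k X * A.conn x k 0 Y -
      A.conn x 2 k Y * A.conn x k 0 X) with hW₃
  have hcomm : ∀ x ∈ U, ∀ i j (X : T x), A.connRho ρ x i j X = A.conn x i j X + ρ x *
      (!![0, A.conn x 1 0 X, -A.conn x 2 0 X, 0;
        0, 0, 0, A.conn x 1 0 X;
        0, 0, 0, -A.conn x 2 0 X;
        0, 0, 0, 0] : Matrix (Fin 4) (Fin 4) ℝ) i j := by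
    intro x hx i j X
    fin_cases i <;> fin_cases j <;> rfl
  -- The algebraic core: -(α'+N)∧(α'+N) = -α'∧α' + dN. Substituting dρ from (∗) accounts for the
  -- mixed terms, and N∧N contributes only θ₂∧θ₂ and θ₃∧θ₃.
  have hpt : ∀ x ∈ U, ∀ X Y : T x, ∀ i j, -∑ k, (A.connRho ρ x i k X * A.connRho ρ x k j Y -
        A.connRho ρ x i k Y * A.connRho ρ x k j X) = (-∑ k, (A.conn x i k X * A.conn x k j Y -
        A.conn x i k Y * A.conn x k j X)) +
      (!![0, W₂ x X Y, -W₃ x X Y, 0; 0, 0, 0, W₂ x X Y; 0, 0, 0, -W₃ x X Y; 0, 0, 0, 0] :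
        Matrix (Fin 4) (Fin 4) ℝ) i j := by
    intro x hx X Y i j
    obtain ⟨h30, h03, h11, h22, h31, h32, h33, h13, h23, h12⟩ := hA.conn_skew hU hx
    obtain ⟨b, c, h21, hdρ⟩ := hρ.exists_dd hU hx
    have hdX := hdρ X
    have hdY := hdρ Y
    have h21X := h21 X
    have h21Y := h21 Y
    fin_cases i <;> fin_cases j <;>
      simp only [Fin.zero_eta, Fin.mk_one, Fin.reduceFinMk, hcomm x hx, W₂, W₃, Matrix.of_apply,
        Matrix.cons_val', Matrix.cons_val, Fin.sum_univ_four, h30, h03, h11, h22, h31, h32, h33,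
        h13, h23, h12, h21X, h21Y, hdX, hdY, _root_.neg_apply, _root_.zero_apply] <;>
      ring
  -- Each of the sixteen entries of N is 0, ρθ₂ or -ρθ₃.
  have hcase : ∀ i j, ∃ (N : (x : M) → T x →L[ℝ] ℝ) (ΩN : (x : M) → T x → T x → ℝ),
      HasExtDeriv U N ΩN ∧ (∀ x ∈ U, ∀ X, N x X = ρ x *
      (!![0, A.conn x 1 0 X, -A.conn x 2 0 X, 0;
        0, 0, 0, A.conn x 1 0 X;
        0, 0, 0, -A.conn x 2 0 X;
        0, 0, 0, 0] : Matrix (Fin 4) (Fin 4) ℝ) i j) ∧ ∀ x ∈ U, ∀ X Y, ΩN x X Y =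
      (!![0, W₂ x X Y, -W₃ x X Y, 0; 0, 0, 0, W₂ x X Y; 0, 0, 0, -W₃ x X Y; 0, 0, 0, 0] :
        Matrix (Fin 4) (Fin 4) ℝ) i j := by
    have hz : HasExtDeriv U (fun x : M => (0 : T x →L[ℝ] ℝ)) (fun _ _ _ => 0) :=
      ((hc 0 0).const_smul 0 hU).congr hU (fun x _ => (zero_smul ℝ _).symm)
        fun x _ X Y => (zero_mul _).symm
    intro i j
    fin_cases i <;> fin_cases j
    all_goals first
      | exact ⟨_, _, hz, fun x _ X => (mul_zero _).symm, fun x _ X Y => rfl⟩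
      | exact ⟨_, _, hθ₂, fun x _ X => rfl, fun x _ X Y => rfl⟩
      | exact ⟨_, _, hθ₃, fun x _ X => (mul_neg _ _).symm, fun x _ X Y => rfl⟩
  obtain ⟨N, ΩN, hN, h1, h2⟩ := hcase i j
  refine ((hc i j).add hN hU).congr hU (fun x hx => ?_) fun x hx X Y => ?_
  · ext X
    rw [hcomm x hx, _root_.add_apply, h1 x hx]
  · rw [hpt x hx, h2 x hx]

end IsPrincipalFraming

end Framing

section Transform

variable {M : Type*} [TopologicalSpace M] [ChartedSpace E2 M] [IsManifold (𝓡 2) ∞ M]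
  {U : Set M} {F : M → ContactElement} {A : FrameField M} {ρ : M → ℝ} {v : M → R41}

/-! ### Restriction to smaller open sets -/

theorem IsPrincipalFraming.mono {W : Set M} (h : IsPrincipalFraming U F A) (hW : W ⊆ U) :
    IsPrincipalFraming W F A where
  smooth_pos := h.smooth_pos.mono hW
  smooth_vec j := (h.smooth_vec j).mono hW
  lorentz p hp := h.lorentz p (hW hp)
  along p hp := h.along p (hW hp)
  principal₂ p hp := h.principal₂ p (hW hp)
  principal₃ p hp := h.principal₃ p (hW hp)

theorem IsPotential.mono {W : Set M} (h : IsPotential U A ρ) (hW : W ⊆ U) : IsPotential W A ρ where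
  smooth := h.smooth.mono hW
  pos p hp := h.pos p (hW hp)
  eq p hp := h.eq p (hW hp)

theorem IsSolution.mono {W : Set M} (h : IsSolution U A ρ v) (hW : W ⊆ U) : IsSolution W A ρ v :=
  ⟨h.1.mono hW, fun p hp => h.2 p (hW hp)⟩

theorem IsLegendreImmersion.mono {W : Set M} (h : IsLegendreImmersion U F) (hW : W ⊆ U) :
    IsLegendreImmersion W F where
  smooth_pt := h.smooth_pt.mono hW
  smooth_normal := h.smooth_normal.mono hW
  contact p hp := h.contact p (hW hp)
  immersion p hp := h.immersion p (hW hp)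

theorem IsLIsothermicWith.mono {W : Set M} {J : (x : M) → T x →L[ℝ] T x} {q : (x : M) → T x → ℂ}
    {μ : M → ℝ} (h : IsLIsothermicWith U F J q μ) (hWo : IsOpen W) (hW : W ⊆ U) :
    IsLIsothermicWith W F J q μ where
  legendre := h.legendre.mono hW
  third_pos p hp := h.third_pos p (hW hp)
  polarization := by
    refine ⟨fun p hp => h.polarization.sq p (hW hp), fun p hp => ?_⟩
    obtain ⟨V, hV, hpV, hVU, z, k, hz, hk, hx⟩ := h.polarization.holomorphic p (hW hp)
    exact ⟨V ∩ W, hV.inter hWo, ⟨hpV, hp⟩, inter_subset_right, z, k, hz.mono inter_subset_left,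
      hk.mono inter_subset_left, fun x hx' => hx x hx'.1⟩
  conformal p hp := h.conformal p (hW hp)
  smooth_mu := h.smooth_mu.mono hW
  hopf p hp := h.hopf p (hW hp)

/-! ### The linear system -/

theorem connRho_apply (x : M) (i j : Fin 4) (X : T x) :
    A.connRho ρ x i j X = A.conn x i j X + ρ x *
      (!![0, A.conn x 1 0 X, -A.conn x 2 0 X, 0;
        0, 0, 0, A.conn x 1 0 X;
        0, 0, 0, -A.conn x 2 0 X;
        0, 0, 0, 0] : Matrix (Fin 4) (Fin 4) ℝ) i j := by
  fin_cases i <;> fin_cases j <;> rfl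

theorem IsSolution.dd_eq {p : M} (hv : IsSolution U A ρ v) (hp : p ∈ U) (X : T p) (i : Fin 4) :
    dd v p X i = -∑ j, A.conn p i j X * v p j - ρ p *
      (![A.conn p 1 0 X * v p 1 - A.conn p 2 0 X * v p 2, A.conn p 1 0 X * v p 3,
        -(A.conn p 2 0 X * v p 3), 0] : Fin 4 → ℝ) i := by
  rw [hv.2 p hp]
  simp only [connRho_apply, Fin.sum_univ_four]
  fin_cases i <;>
    simp only [Fin.zero_eta, Fin.mk_one, Fin.reduceFinMk, Matrix.of_apply, Matrix.cons_val',
      Matrix.cons_val] <;> ring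

/-- The added entries respect the symmetries of `conn_skew`, so α'_ρ still takes values in the
Lorentz algebra and the quadratic form is preserved along solutions. -/
theorem IsSolution.dd_lor_self {p : M} (hv : IsSolution U A ρ v) (hA : IsPrincipalFraming U F A)
    (hU : IsOpen U) (hp : p ∈ U) : dd (fun x => lor (v x) (v x)) p = 0 := by
  ext X
  have hm := hv.1.mdifferentiableAt hU hp
  rw [dd_lor hm hm]
  obtain ⟨h30, h03, h11, h22, h31, h32, h33, h13, h23, h12⟩ := hA.conn_skew hU hp
  simp only [lor, hv.dd_eq hp, Fin.sum_univ_four, Matrix.cons_val, h30, h03, h11, h22, h31, h32,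
    h33, h13, h23, h12, _root_.neg_apply, _root_.zero_apply]
  ring

/-- Complete integrability of the deformed system, with solutions in the light cone. -/
theorem exists_isSolution (hU : IsOpen U) (hA : IsPrincipalFraming U F A)
    (hρ : IsPotential U A ρ) {p : M} (hp : p ∈ U) (v₀ : R41) :
    ∃ (W : Set M) (v : M → R41), IsOpen W ∧ p ∈ W ∧ W ⊆ U ∧ IsSolution W A ρ v ∧ v p = v₀ ∧
      (v₀ ∈ lightCone → ∀ x ∈ W, v x ∈ lightCone) := by
  obtain ⟨W, v, hW, hpW, hWU, hvs, hvp, hv⟩ :=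
    exists_solution_of_flat hU (hA.hasExtDeriv_connRho hU hρ) hp v₀
  have hsol : IsSolution W A ρ v := ⟨hvs, hv⟩
  by_cases h0 : v₀ ∈ lightCone
  -- Being null propagates from p because ⟨v,v⟩ is locally constant; being future pointing is an
  -- open condition.
  · have hopen : IsOpen (W ∩ (fun x => v x 0 + v x 3) ⁻¹' Ioi 0) :=
      ((hvs.apply 0).add (hvs.apply 3)).continuousOn.isOpen_inter_preimage hW isOpen_Ioi
    obtain ⟨W', hW', hpW', hsub, hconst⟩ := exists_nhds_const hopen
      (p := p) ⟨hpW, by rw [mem_preimage, hvp]; exact h0.2⟩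
    refine ⟨W', v, hW', hpW', fun x hx => hWU (hsub hx).1, hsol.mono fun x hx => (hsub hx).1, hvp,
      fun _ x hx => ⟨?_, (hsub hx).2⟩⟩
    have hs' : SmoothOn W' v := hvs.mono fun x hx => (hsub hx).1
    rw [hconst (fun x => lor (v x) (v x)) (hs'.lor hs')
      (fun x hx => hsol.dd_lor_self (hA.mono hWU) hW (hsub hx).1) x hx, hvp]
    exact h0.1
  · exact ⟨W, v, hW, hpW, hWU, hsol, hvp, fun h => absurd h h0⟩

/-! ### The transform -/

/-- A principal framing with its dual frame, a potential, and a solution in the light cone of the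
corresponding linear system. -/
structure IsDarbouxData (U : Set M) (F : M → ContactElement) (A : FrameField M) (ρ : M → ℝ)
    (v : M → R41) (e e' : (x : M) → T x) : Prop where
  isOpen : IsOpen U
  framing : IsPrincipalFraming U F A
  legendre : IsLegendreImmersion U F
  dual : ∀ x ∈ U, IsDualFrame (A.conn x 1 0) (A.conn x 2 0) (e x) (e' x)
  potential : IsPotential U A ρ
  solution : IsSolution U A ρ v
  cone : ∀ x ∈ U, v x ∈ lightCone

/-- The null vector field `∑ vⁱ aᵢ`. -/
def FrameField.comb (A : FrameField M) (v : M → R41) (x : M) : R41 := ∑ i, v x i • A.vec x i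

/-- The vector a₁ is null and orthogonal to a₂ and a₃, so its coefficients do not matter. The
differentials of a₀, a₁, w and S all lie in the span of a₁, a₂, a₃. -/
theorem lor_comb_three {a : Fin 4 → R41} (h : frameMatrix a ∈ properLorentz)
    (x₀ x₁ x₂ y₀ y₁ y₂ : ℝ) :
    lor (x₀ • a 0 + x₁ • a 1 + x₂ • a 2) (y₀ • a 0 + y₁ • a 1 + y₂ • a 2) = x₁ * y₁ + x₂ * y₂ := by
  have := lor_sum_frame h ![x₀, x₁, x₂, 0] ![y₀, y₁, y₂, 0]
  simpa [Fin.sum_univ_four, lor] using this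

namespace IsDarbouxData

variable {e e' : (x : M) → T x} (h : IsDarbouxData U F A ρ v e e')
include h

theorem mono {W : Set M} (hWo : IsOpen W) (hW : W ⊆ U) : IsDarbouxData W F A ρ v e e' where
  isOpen := hWo
  framing := h.framing.mono hW
  legendre := h.legendre.mono hW
  dual x hx := h.dual x (hW hx)
  potential := h.potential.mono hW
  solution := h.solution.mono hW
  cone x hx := h.cone x (hW hx)

theorem smooth_comb : SmoothOn U (A.comb v) :=
  SmoothOn.sum fun i _ => (h.solution.1.apply i).smul (h.framing.smooth_vec i)

theorem comb_mem {p : M} (hp : p ∈ U) : A.comb v p ∈ lightCone :=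
  sum_frame_mem_lightCone (h.framing.lorentz p hp) (h.cone p hp)

theorem dd_vec_zero {p : M} (hp : p ∈ U) (X : T p) : dd (fun x => A.vec x 0) p X =
    A.conn p 0 0 X • A.vec p 0 + A.conn p 1 0 X • A.vec p 1 + A.conn p 2 0 X • A.vec p 2 := by
  rw [h.framing.dd_vec hp, Fin.sum_univ_four, (h.framing.conn_skew h.isOpen hp).1]
  simp

theorem dd_pos {p : M} (hp : p ∈ U) (X : T p) : dd A.pos p X =
    A.conn₀ p 0 X • A.vec p 0 + A.conn₀ p 1 X • A.vec p 1 + A.conn₀ p 2 X • A.vec p 2 := by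
  rw [h.framing.dd_pos hp, Fin.sum_univ_four, h.framing.conn₀_three h.isOpen h.legendre hp]
  simp

/-- In dw = ∑ (dv + α'v)ⁱaᵢ the equation for v cancels α', and only the added matrix N survives. It
has no a₄ component, and the coefficients of a₂ and a₃ carry opposite signs. -/
theorem dd_comb {p : M} (hp : p ∈ U) (X : T p) : dd (A.comb v) p X =
    (-ρ p * (A.conn p 1 0 X * v p 1 - A.conn p 2 0 X * v p 2)) • A.vec p 0 +
      (-ρ p * v p 3 * A.conn p 1 0 X) • A.vec p 1 +
      (ρ p * v p 3 * A.conn p 2 0 X) • A.vec p 2 := by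
  have hvi : ∀ i, MDifferentiableAt (𝓡 2) 𝓘(ℝ, ℝ) (fun x => v x i) p := fun i =>
    (h.solution.1.apply i).mdifferentiableAt h.isOpen hp
  have hai : ∀ i, MDifferentiableAt (𝓡 2) 𝓘(ℝ, R41) (fun x => A.vec x i) p := fun i =>
    (h.framing.smooth_vec i).mdifferentiableAt h.isOpen hp
  have hs : ∀ i, SmoothOn U (fun x => v x i • A.vec x i) := fun i =>
    (h.solution.1.apply i).smul (h.framing.smooth_vec i)
  have hm : ∀ i, MDifferentiableAt (𝓡 2) 𝓘(ℝ, R41) (fun x => v x i • A.vec x i) p := fun i =>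
    (hs i).mdifferentiableAt h.isOpen hp
  have e1 : dd (A.comb v) p X = dd (fun x => v x 0 • A.vec x 0 + v x 1 • A.vec x 1 +
      v x 2 • A.vec x 2 + v x 3 • A.vec x 3) p X := by
    rw [dd_congr h.isOpen hp fun z _ => ?_]
    exact Fin.sum_univ_four _
  rw [e1, dd_add ((((hs 0).add (hs 1)).add (hs 2)).mdifferentiableAt h.isOpen hp) (hm 3),
    dd_add (((hs 0).add (hs 1)).mdifferentiableAt h.isOpen hp) (hm 2), dd_add (hm 0) (hm 1),
    dd_smul (hai 0) (hvi 0), dd_smul (hai 1) (hvi 1), dd_smul (hai 2) (hvi 2),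
    dd_smul (hai 3) (hvi 3)]
  simp only [dd_apply (h.solution.1.mdifferentiableAt h.isOpen hp), h.solution.dd_eq hp,
    h.framing.dd_vec hp, Fin.sum_univ_four, Matrix.cons_val]
  module

/-- The form `γ` is `⟨∑ vⁱ aᵢ, da₀⟩`, and it is closed. -/
theorem hasExtDeriv_gam : HasExtDeriv U (A.gam v) (fun _ _ _ => 0) := by
  refine (hasExtDeriv_lorForm h.isOpen h.smooth_comb h.framing.smooth_pos).congr h.isOpen
    (fun x hx => ?_) fun x hx X Y => ?_
  · ext X
    rw [lorForm_apply (h.framing.smooth_pos.mdifferentiableAt h.isOpen hx), h.dd_pos hx, lor_comm]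
    obtain ⟨l0, l1, l2, -⟩ := lor_sum_frame_right (h.framing.lorentz x hx) (v x)
    simp only [FrameField.comb, lor_add_left, lor_smul_left, l0, l1, l2]
    simp only [FrameField.gam, _root_.add_apply, _root_.sub_apply, _root_.smul_apply, smul_eq_mul]
    ring
  · rw [h.dd_comb hx, h.dd_comb hx, h.dd_pos hx, h.dd_pos hx,
      lor_comb_three (h.framing.lorentz x hx), lor_comb_three (h.framing.lorentz x hx)]
    have h2 := h.framing.principal₂ x hx X Y
    have h3 := h.framing.principal₃ x hx X Y
    -- dγ is a combination of θ₂∧α²₀ and θ₃∧α³₀, both zero for a principal frame.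
    linear_combination (-ρ x * v x 3) * h2 + (ρ x * v x 3) * h3

/-- The coefficient functions `α²₀ = a α²₁` and `α³₀ = b α³₁` are smooth. -/
theorem smooth_coeff : SmoothOn U (fun x => A.conn₀ x 1 (e x)) ∧
    SmoothOn U (fun x => A.conn₀ x 2 (e' x)) := by
  have hc := fun i j => (h.framing.hasExtDeriv_conn h.isOpen i j).smooth
  exact ⟨(smoothOn_apply_dualFrame h.isOpen (hc 1 0) (hc 2 0)
      (h.framing.smoothForm_conn₀ h.isOpen 1) h.dual).1,
    (smoothOn_apply_dualFrame h.isOpen (hc 1 0) (hc 2 0)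
      (h.framing.smoothForm_conn₀ h.isOpen 2) h.dual).2⟩

variable {r : M → ℝ} (hr : SmoothOn U r) (hv3 : ∀ p ∈ U, v p 3 ≠ 0)
include hr hv3

theorem smooth_ratio : SmoothOn U (fun x => r x / v x 3) := hr.div (h.solution.1.apply 3) hv3

theorem smooth_congr : SmoothOn U (A.congr v r) :=
  h.framing.smooth_pos.add ((h.smooth_ratio hr hv3).smul (h.framing.smooth_vec 0))

/-- Sliding a₀ along a₁ by s adds s to both coefficients a and b. -/
theorem dd_congruence {p : M} (hp : p ∈ U) (X : T p) : dd (A.congr v r) p X =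
    (A.conn₀ p 0 X + r p / v p 3 * A.conn p 0 0 X + dd (fun x => r x / v x 3) p X) • A.vec p 0 +
      ((A.conn₀ p 1 (e p) + r p / v p 3) * A.conn p 1 0 X) • A.vec p 1 +
      ((A.conn₀ p 2 (e' p) + r p / v p 3) * A.conn p 2 0 X) • A.vec p 2 := by
  have hs := h.smooth_ratio hr hv3
  have e1 : dd (A.congr v r) p X = dd (fun x => A.pos x + (r x / v x 3) • A.vec x 0) p X := rfl
  obtain ⟨h1, h2⟩ := h.framing.conn₀_eq hp (h.dual p hp) X
  rw [e1, dd_add (h.framing.smooth_pos.mdifferentiableAt h.isOpen hp)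
      ((hs.smul (h.framing.smooth_vec 0)).mdifferentiableAt h.isOpen hp),
    dd_smul ((h.framing.smooth_vec 0).mdifferentiableAt h.isOpen hp)
      (hs.mdifferentiableAt h.isOpen hp), h.dd_pos hp, h.dd_vec_zero hp, h1, h2]
  module

theorem lor_dd_congruence_vec_zero {p : M} (hp : p ∈ U) (X : T p) :
    lor (dd (A.congr v r) p X) (A.vec p 0) = 0 := by
  rw [h.dd_congruence hr hv3 hp]
  have := lor_comb_three (h.framing.lorentz p hp) (A.conn₀ p 0 X + r p / v p 3 * A.conn p 0 0 X +
    dd (fun x => r x / v x 3) p X) ((A.conn₀ p 1 (e p) + r p / v p 3) * A.conn p 1 0 X)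
    ((A.conn₀ p 2 (e' p) + r p / v p 3) * A.conn p 2 0 X) 1 0 0
  simpa using this

theorem lor_dd_congruence_dd_vec {p : M} (hp : p ∈ U) (X Y : T p) :
    lor (dd (A.congr v r) p X) (dd (fun x => A.vec x 0) p Y) =
      (A.conn₀ p 1 (e p) + r p / v p 3) * A.conn p 1 0 X * A.conn p 1 0 Y +
      (A.conn₀ p 2 (e' p) + r p / v p 3) * A.conn p 2 0 X * A.conn p 2 0 Y := by
  rw [h.dd_congruence hr hv3 hp, h.dd_vec_zero hp, lor_comb_three (h.framing.lorentz p hp)]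

theorem lor_dd_congruence_dd_comb {p : M} (hp : p ∈ U) (X Y : T p) :
    lor (dd (A.congr v r) p X) (dd (A.comb v) p Y) = -ρ p * v p 3 *
      ((A.conn₀ p 1 (e p) + r p / v p 3) * A.conn p 1 0 X * A.conn p 1 0 Y -
      (A.conn₀ p 2 (e' p) + r p / v p 3) * A.conn p 2 0 X * A.conn p 2 0 Y) := by
  rw [h.dd_congruence hr hv3 hp, h.dd_comb hp, lor_comb_three (h.framing.lorentz p hp)]
  ring

theorem lor_dd_congruence_self {p : M} (hp : p ∈ U) (X Y : T p) :
    lor (dd (A.congr v r) p X) (dd (A.congr v r) p Y) =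
      (A.conn₀ p 1 (e p) + r p / v p 3) ^ 2 * A.conn p 1 0 X * A.conn p 1 0 Y +
      (A.conn₀ p 2 (e' p) + r p / v p 3) ^ 2 * A.conn p 2 0 X * A.conn p 2 0 Y := by
  rw [h.dd_congruence hr hv3 hp, h.dd_congruence hr hv3 hp,
    lor_comb_three (h.framing.lorentz p hp)]
  ring

omit hr in
theorem lor_dd_comb_dd_comb {p : M} (hp : p ∈ U) (X Y : T p) :
    lor (dd (A.comb v) p X) (dd (A.comb v) p Y) = (ρ p * v p 3) ^ 2 *
      (A.conn p 1 0 X * A.conn p 1 0 Y + A.conn p 2 0 X * A.conn p 2 0 Y) := by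
  rw [h.dd_comb hp, h.dd_comb hp, lor_comb_three (h.framing.lorentz p hp)]
  ring

/-- The congruence is an immersion where no curvature vanishes. -/
theorem injective_dd_congruence {p : M} (hp : p ∈ U)
    (h1 : A.conn₀ p 1 (e p) + r p / v p 3 ≠ 0) (h2 : A.conn₀ p 2 (e' p) + r p / v p 3 ≠ 0) :
    Function.Injective (dd (A.congr v r) p) := by
  rw [injective_iff_map_eq_zero]
  intro X hX
  have e1 := h.lor_dd_congruence_dd_vec hr hv3 hp X (e p)
  have e2 := h.lor_dd_congruence_dd_vec hr hv3 hp X (e' p)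
  have hz : ∀ y, lor 0 y = 0 := fun y => by simp [lor]
  have hd := h.dual p hp
  rw [hX, hz, hd.left, hd.left'] at e1
  rw [hX, hz, hd.right, hd.right'] at e2
  refine hd.eq_zero ?_ ?_
  · simpa [h1] using e1
  · simpa [h2] using e2

variable (hdr : ∀ p ∈ U, dd r p = A.gam v p)
include hdr

/-- The congruence is enveloped by the null lines of direction `∑ vⁱ aᵢ`. -/
theorem congruence_coeff {p : M} (hp : p ∈ U) (X : T p) :
    (A.conn₀ p 0 X + r p / v p 3 * A.conn p 0 0 X + dd (fun x => r x / v x 3) p X) * v p 3 =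
      (A.conn₀ p 1 (e p) + r p / v p 3) * A.conn p 1 0 X * v p 1 +
      (A.conn₀ p 2 (e' p) + r p / v p 3) * A.conn p 2 0 X * v p 2 := by
  have hs := h.smooth_ratio hr hv3
  -- Differentiating r = s·v⁴ brings in ds, which is the unknown part of the a₁ component of dS.
  have hprod : dd r p X = r p / v p 3 * dd v p X 3 + dd (fun x => r x / v x 3) p X * v p 3 := by
    rw [← dd_apply (h.solution.1.mdifferentiableAt h.isOpen hp),
      ← dd_mul (hs.mdifferentiableAt h.isOpen hp)
        ((h.solution.1.apply 3).mdifferentiableAt h.isOpen hp),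
      dd_congr h.isOpen hp fun z hz => (div_mul_cancel₀ (r z) (hv3 z hz)).symm]
  obtain ⟨h1, h2⟩ := h.framing.conn₀_eq hp (h.dual p hp) X
  obtain ⟨h30, -, -, -, h31, h32, h33, -⟩ := h.framing.conn_skew h.isOpen hp
  rw [hdr p hp, h.solution.dd_eq hp] at hprod
  simp only [FrameField.gam, _root_.add_apply, _root_.sub_apply, _root_.smul_apply, smul_eq_mul,
    Fin.sum_univ_four, Matrix.cons_val, h30, h31, h32, h33, _root_.neg_apply, _root_.zero_apply,
    h1, h2] at hprod
  linear_combination -hprod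

/-- The formula for the a₁ component of dS is equivalent to orthogonality to w, which is the
Legendre condition for the lines [S,w]. -/
theorem lor_dd_congruence_comb {p : M} (hp : p ∈ U) (X : T p) :
    lor (dd (A.congr v r) p X) (A.comb v p) = 0 := by
  rw [h.dd_congruence hr hv3 hp]
  obtain ⟨l0, l1, l2, -⟩ := lor_sum_frame_right (h.framing.lorentz p hp) (v p)
  simp only [FrameField.comb, lor_add_left, lor_smul_left, l0, l1, l2]
  linear_combination -(h.congruence_coeff hr hv3 hdr hp X)

/-- If the congruence is an immersion, no curvature vanishes. -/
theorem coeff_ne_zero {p : M} (hp : p ∈ U) (hinj : Function.Injective (dd (A.congr v r) p)) :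
    A.conn₀ p 1 (e p) + r p / v p 3 ≠ 0 ∧ A.conn₀ p 2 (e' p) + r p / v p 3 ≠ 0 := by
  rw [injective_iff_map_eq_zero] at hinj
  have hd := h.dual p hp
  have hne : e p ≠ 0 := fun h0 => by have := hd.left; rw [h0, map_zero] at this; simp at this
  have hne' : e' p ≠ 0 := fun h0 => by have := hd.right'; rw [h0, map_zero] at this; simp at this
  constructor
  · intro h0
    refine hne (hinj _ ?_)
    -- Along e the a₁ component of dS is proportional to a+s too, so a+s = 0 would give dS(e) = 0.
    have hk := h.congruence_coeff hr hv3 hdr hp (e p)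
    rw [h0, hd.left'] at hk
    have hk' := (mul_eq_zero.1 (hk.trans (by ring))).resolve_right (hv3 p hp)
    rw [h.dd_congruence hr hv3 hp, hk', h0, hd.left']
    simp
  · intro h0
    refine hne' (hinj _ ?_)
    have hk := h.congruence_coeff hr hv3 hdr hp (e' p)
    rw [h0, hd.right] at hk
    have hk' := (mul_eq_zero.1 (hk.trans (by ring))).resolve_right (hv3 p hp)
    rw [h.dd_congruence hr hv3 hp, hk', h0, hd.right]
    simp

end IsDarbouxData

end Transform

/-! ### The transform is L-isothermic and the congruence is nondegenerate Darboux -/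

section Transform

variable {M : Type*} [TopologicalSpace M] [ChartedSpace E2 M] [IsManifold (𝓡 2) ∞ M]
  {U : Set M} {F G : M → ContactElement} {A : FrameField M} {ρ : M → ℝ} {v : M → R41}

/-- The differential of a complex function with given real and imaginary parts. -/
theorem dd_complex {f g : M → ℝ} {x : M} (hf : MDifferentiableAt (𝓡 2) 𝓘(ℝ, ℝ) f x)
    (hg : MDifferentiableAt (𝓡 2) 𝓘(ℝ, ℝ) g x) (X : T x) :
    dd (fun z => f z • (1 : ℂ) + g z • Complex.I) x X = dd f x X • (1 : ℂ) + dd g x X • Complex.I := by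
  have hL := dd_clm ((ContinuousLinearMap.fst ℝ ℝ ℝ).smulRight (1 : ℂ) +
    (ContinuousLinearMap.snd ℝ ℝ ℝ).smulRight Complex.I) (mdifferentiableAt_prod hf hg) X
  rw [dd_prod hf hg] at hL
  exact hL

theorem SmoothOn.complex {f g : M → ℝ} (hf : SmoothOn U f) (hg : SmoothOn U g) :
    SmoothOn U (fun z => f z • (1 : ℂ) + g z • Complex.I) :=
  (hf.smul (SmoothOn.const _)).add (hg.smul (SmoothOn.const _))

/-- The `(2,0)`-part of a diagonal form. -/
theorem part20_diagonal {p : M} {θ θ' : T p →L[ℝ] ℝ} {J : T p →L[ℝ] T p}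
    (h1 : ∀ X, θ (J X) = -θ' X) (h2 : ∀ X, θ' (J X) = θ X) {B : T p → T p → ℝ} {a b : ℝ}
    (hB : ∀ X Y, B X Y = a * θ X * θ Y + b * θ' X * θ' Y) (X : T p) :
    part20 J B X = (((a - b) / 4 : ℝ) : ℂ) * ((θ X : ℂ) + (θ' X : ℂ) * Complex.I) ^ 2 := by
  simp only [part20, hB, h1, h2]
  push_cast
  linear_combination (-((a : ℂ) - b) / 4 * (θ' X) ^ 2) * Complex.I_sq

/-- By the structure equations dθ₂ and dθ₃ involve only α¹₁ and α³₂, and (∗) says precisely that the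
factor √ρ compensates both. The two closed forms integrate to an isothermal coordinate. -/
theorem hasExtDeriv_sqrt_smul (hU : IsOpen U) (hA : IsPrincipalFraming U F A)
    (hρ : IsPotential U A ρ) :
    HasExtDeriv U (fun x => Real.sqrt (ρ x) • A.conn x 1 0) (fun _ _ _ => 0) ∧
      HasExtDeriv U (fun x => Real.sqrt (ρ x) • A.conn x 2 0) (fun _ _ _ => 0) := by
  have hsm : SmoothOn U (fun x => Real.sqrt (ρ x)) :=
    hρ.smooth.comp (Φ := Real.sqrt) fun x hx => Real.contDiffAt_sqrt (hρ.pos x hx).ne'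
  have hd : ∀ x ∈ U, ∀ X, dd (fun x => Real.sqrt (ρ x)) x X = dd ρ x X * (1 / (2 * Real.sqrt (ρ x))) := by
    intro x hx X
    have := dd_comp (Real.hasDerivAt_sqrt (hρ.pos x hx).ne').hasFDerivAt
      (hρ.smooth.mdifferentiableAt hU hx)
    rw [this]
    rfl
  have key : ∀ x ∈ U, ∃ b c : ℝ,
      (∀ X, A.conn x 2 1 X = b * A.conn x 1 0 X + c * A.conn x 2 0 X) ∧
      ∀ X, dd (fun x => Real.sqrt (ρ x)) x X =
        -(Real.sqrt (ρ x) * (A.conn x 0 0 X - (b * A.conn x 2 0 X - c * A.conn x 1 0 X))) := by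
    intro x hx
    obtain ⟨b, c, h1, h2⟩ := hρ.exists_dd hU hx
    refine ⟨b, c, h1, fun X => ?_⟩
    have hs := Real.sqrt_pos.2 (hρ.pos x hx)
    rw [hd x hx, h2]
    have : ρ x = Real.sqrt (ρ x) * Real.sqrt (ρ x) := (Real.mul_self_sqrt (hρ.pos x hx).le).symm
    field_simp
    rw [Real.sq_sqrt (hρ.pos x hx).le]
    ring
  have hc := hA.hasExtDeriv_conn hU
  constructor
  · refine ((hc 1 0).smul hsm hU).congr hU (fun _ _ => rfl) fun x hx X Y => ?_
    obtain ⟨b, c, h21, hs⟩ := key x hx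
    obtain ⟨h30, h03, h11, h22, h31, h32, h33, h13, h23, h12⟩ := hA.conn_skew hU hx
    simp only [Fin.sum_univ_four, h30, h11, h12, hs, h21, _root_.neg_apply, _root_.zero_apply]
    ring
  · refine ((hc 2 0).smul hsm hU).congr hU (fun _ _ => rfl) fun x hx X Y => ?_
    obtain ⟨b, c, h21, hs⟩ := key x hx
    obtain ⟨h30, h03, h11, h22, h31, h32, h33, h13, h23, h12⟩ := hA.conn_skew hU hx
    simp only [Fin.sum_univ_four, h30, h22, hs, h21, _root_.neg_apply, _root_.zero_apply]
    ring

/-- The complex structure for which `θ + i θ'` is of type `(1,0)`. -/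
theorem exists_complexStructure {x : M} {θ θ' : T x →L[ℝ] ℝ} {e e' : T x}
    (h : IsDualFrame θ θ' e e') : ∃ J : T x →L[ℝ] T x,
      (∀ X, θ (J X) = -θ' X) ∧ ∀ X, θ' (J X) = θ X := by
  refine ⟨θ.smulRight e' - θ'.smulRight e, fun X => ?_, fun X => ?_⟩
  · rw [_root_.sub_apply, map_sub, ContinuousLinearMap.smulRight_apply,
      ContinuousLinearMap.smulRight_apply, map_smul, map_smul, h.left, h.right]
    simp
  · rw [_root_.sub_apply, map_sub, ContinuousLinearMap.smulRight_apply,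
      ContinuousLinearMap.smulRight_apply, map_smul, map_smul, h.left', h.right']
    simp

/-- The quadratic differential `ρ (α²₁ + i α³₁)²` of a potential is holomorphic. -/
theorem isPolarization_of_isPotential (hU : IsOpen U) (hA : IsPrincipalFraming U F A)
    (hρ : IsPotential U A ρ) (hco : ∀ x ∈ U, ∀ X, A.conn x 1 0 X = 0 → A.conn x 2 0 X = 0 → X = 0)
    {J : (x : M) → T x →L[ℝ] T x}
    (hJ : ∀ x ∈ U, ∀ X, A.conn x 1 0 (J x X) = -A.conn x 2 0 X)
    (hJ' : ∀ x ∈ U, ∀ X, A.conn x 2 0 (J x X) = A.conn x 1 0 X) :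
    IsPolarization U J (fun x X => (ρ x : ℂ) *
      ((A.conn x 1 0 X : ℂ) + (A.conn x 2 0 X : ℂ) * Complex.I) ^ 2) where
  sq p hp X := by
    refine eq_neg_of_add_eq_zero_left (hco p hp _ ?_ ?_)
    · rw [map_add, hJ p hp, hJ' p hp]; ring
    · rw [map_add, hJ' p hp, hJ p hp]; ring
  holomorphic p hp := by
    obtain ⟨h2, h3⟩ := hasExtDeriv_sqrt_smul hU hA hρ
    -- With primitives f, g of the two closed forms, z = f + ig satisfies dz = √ρ(θ₂ + iθ₃), so the
    -- quadratic differential is dz², with coefficient function 1.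
    obtain ⟨W, f, hW, hpW, hWU, hf, -, hdf⟩ := h2.exists_primitive hU hp 0
    obtain ⟨W', g, hW', hpW', hWU', hg, -, hdg⟩ := h3.exists_primitive hU hp 0
    have hf' := hf.mono (inter_subset_left (t := W'))
    have hg' := hg.mono (inter_subset_right (s := W))
    have hdz : ∀ x ∈ W ∩ W', ∀ X : T x, dd (fun z => f z • (1 : ℂ) + g z • Complex.I) x X =
        (Real.sqrt (ρ x) : ℂ) * ((A.conn x 1 0 X : ℂ) + (A.conn x 2 0 X : ℂ) * Complex.I) := by
      intro x hx X
      rw [dd_complex (hf'.mdifferentiableAt (hW.inter hW') hx)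
        (hg'.mdifferentiableAt (hW.inter hW') hx), hdf x hx.1, hdg x hx.2]
      simp only [_root_.smul_apply, Complex.real_smul, smul_eq_mul]
      push_cast
      ring
    refine ⟨W ∩ W', hW.inter hW', ⟨hpW, hpW'⟩, fun x hx => hWU hx.1, _, fun _ => 1,
      hf'.complex hg', SmoothOn.const _, fun x hx => ⟨fun X hX => ?_, fun X => ?_, fun X => ?_,
        fun X => ?_⟩⟩
    · have hs : (Real.sqrt (ρ x) : ℂ) ≠ 0 :=
        Complex.ofReal_ne_zero.2 (Real.sqrt_pos.2 (hρ.pos x (hWU hx.1))).ne'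
      rw [hdz x hx] at hX
      have h0 := (mul_eq_zero.1 hX).resolve_left hs
      have hre := congrArg Complex.re h0
      have him := congrArg Complex.im h0
      simp at hre him
      exact hco x (hWU hx.1) X hre him
    · rw [hdz x hx, hdz x hx, hJ x (hWU hx.1), hJ' x (hWU hx.1)]
      push_cast
      linear_combination (-(Real.sqrt (ρ x) : ℂ) * (A.conn x 2 0 X : ℂ)) * Complex.I_sq
    · rw [dd_const]; simp
    · rw [hdz x hx, mul_pow, ← Complex.ofReal_pow, Real.sq_sqrt (hρ.pos x (hWU hx.1)).le, one_mul]

namespace IsDarbouxData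

variable {e e' : (x : M) → T x} (h : IsDarbouxData U F A ρ v e e')
  {r : M → ℝ} (hr : SmoothOn U r) (hv3 : ∀ p ∈ U, v p 3 ≠ 0)
  (hdr : ∀ p ∈ U, dd r p = A.gam v p)
  (hG : ∀ p ∈ U, (G p).line = affLine (A.congr v r p) (A.comb v p))
include h hr hv3 hdr hG

theorem isLineField : IsLineField U G (A.congr v r) (A.comb v) where
  smooth₀ := h.smooth_congr hr hv3
  smooth₁ := h.smooth_comb
  mem p hp := h.comb_mem hp
  line := hG

omit hr hdr hG in
theorem lor_dd_comb_pos {p : M} (hp : p ∈ U) {X : T p} (hX : X ≠ 0) :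
    0 < lor (dd (A.comb v) p X) (dd (A.comb v) p X) := by
  rw [h.lor_dd_comb_dd_comb hv3 hp]
  have h1 : 0 < (ρ p * v p 3) ^ 2 :=
    sq_pos_of_ne_zero (mul_ne_zero (h.potential.pos p hp).ne' (hv3 p hp))
  refine mul_pos h1 ?_
  by_contra hle
  have h2 : A.conn p 1 0 X = 0 := by nlinarith [mul_self_nonneg (A.conn p 1 0 X), mul_self_nonneg (A.conn p 2 0 X)]
  have h3 : A.conn p 2 0 X = 0 := by nlinarith [mul_self_nonneg (A.conn p 1 0 X), mul_self_nonneg (A.conn p 2 0 X)]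
  exact hX ((h.dual p hp).eq_zero h2 h3)

theorem isLegendreImmersion_transform : IsLegendreImmersion U G :=
  (h.isLineField hr hv3 hdr hG).isLegendreImmersion h.isOpen
    (fun p hp X => h.lor_dd_congruence_comb hr hv3 hdr hp X)
    fun p hp X hX => h.lor_dd_comb_pos hv3 hp hX

theorem thirdForm_transform {p : M} (hp : p ∈ U) (X Y : T p) :
    thirdForm G p X Y = ((tm (A.comb v p))⁻¹ * (ρ p * v p 3)) ^ 2 *
      (A.conn p 1 0 X * A.conn p 1 0 Y + A.conn p 2 0 X * A.conn p 2 0 Y) := by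
  rw [(h.isLineField hr hv3 hdr hG).thirdForm_eq h.isOpen hp, h.lor_dd_comb_dd_comb hv3 hp]
  ring

/-- The transform of an L-isothermic immersion is L-isothermic. -/
theorem isLIsothermic_transform : IsLIsothermic U G := by
  have hL := h.isLineField hr hv3 hdr hG
  have hex : ∀ x, ∃ J : T x →L[ℝ] T x, x ∈ U →
      (∀ X, A.conn x 1 0 (J X) = -A.conn x 2 0 X) ∧ ∀ X, A.conn x 2 0 (J X) = A.conn x 1 0 X := by
    intro x
    by_cases hx : x ∈ U
    · obtain ⟨J, hJ⟩ := exists_complexStructure (h.dual x hx)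
      exact ⟨J, fun _ => hJ⟩
    · exact ⟨0, fun h => absurd h hx⟩
  choose J hJ using hex
  have hIII := fun p hp (X : T p) hX => h.lor_dd_comb_pos hv3 hp (X := X) hX
  have hc := fun p hp (X : T p) => h.lor_dd_congruence_comb hr hv3 hdr hp X
  -- The second form of the transform is diagonal in θ₂, θ₃. A quarter of the difference of its two
  -- coefficients, divided by ρ, is this μ; the shift to time zero contributes equally to both and
  -- cancels.
  refine ⟨J, fun x X => (ρ x : ℂ) * ((A.conn x 1 0 X : ℂ) + (A.conn x 2 0 X : ℂ) * Complex.I) ^ 2,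
    fun x => -((tm (A.comb v x))⁻¹ * v x 3) * (A.conn₀ x 1 (e x) + A.conn₀ x 2 (e' x) +
      2 * (r x / v x 3)) / 4, h.isLegendreImmersion_transform hr hv3 hdr hG, ?_, ?_, ?_, ?_, ?_⟩
  · intro p hp X hX
    rw [hL.thirdForm_eq h.isOpen hp]
    exact mul_pos (pow_pos (inv_pos.2 (hL.tm_pos hp)) 2) (hIII p hp X hX)
  · exact isPolarization_of_isPotential h.isOpen h.framing h.potential
      (fun x hx X h1 h2 => (h.dual x hx).eq_zero h1 h2) (fun x hx => (hJ x hx).1)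
      fun x hx => (hJ x hx).2
  · intro p hp X
    rw [h.thirdForm_transform hr hv3 hdr hG hp, h.thirdForm_transform hr hv3 hdr hG hp,
      (hJ p hp).1, (hJ p hp).2]
    ring
  · obtain ⟨ha, hb⟩ := h.smooth_coeff
    have hs := h.smooth_ratio hr hv3
    refine ((((hL.smooth_inv.mul (h.solution.1.apply 3)).neg.mul ((ha.add hb).add
      ((SmoothOn.const 2).mul hs))).mul (SmoothOn.const (1 / 4)))).congr fun x hx => ?_
    ring
  · intro p hp X
    set k := (tm (A.comb v p))⁻¹
    set s := r p / v p 3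
    set τ := -(tm (A.congr v r p)) * k
    rw [part20_diagonal (hJ p hp).1 (hJ p hp).2
      (a := k * (-ρ p * v p 3 * (A.conn₀ p 1 (e p) + s) + τ * (ρ p * v p 3) ^ 2))
      (b := k * (ρ p * v p 3 * (A.conn₀ p 2 (e' p) + s) + τ * (ρ p * v p 3) ^ 2))]
    · push_cast
      ring
    · intro X Y
      rw [hL.secondForm_eq h.isOpen hc hp, lor_add_left, lor_smul_left,
        h.lor_dd_congruence_dd_comb hr hv3 hp, h.lor_dd_comb_dd_comb hv3 hp]
      ring

variable (hinj : ∀ p ∈ U, Function.Injective (dd (A.congr v r) p))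
include hinj

/-- The congruence is a nondegenerate Darboux congruence. -/
theorem isNondegenerateDarboux : IsNondegenerateDarboux U (A.congr v r) F G := by
  have hL := h.isLineField hr hv3 hdr hG
  have hLF := h.framing.isLineField
  have hne := fun p hp => h.coeff_ne_zero hr hv3 hdr hp (hinj p hp)
  have hd := h.dual
  have he : ∀ p ∈ U, e p ≠ 0 := fun p hp h0 => by
    have := (hd p hp).left; rw [h0, map_zero] at this; simp at this
  have he' : ∀ p ∈ U, e' p ≠ 0 := fun p hp h0 => by
    have := (hd p hp).right'; rw [h0, map_zero] at this; simp at this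
  have hli : ∀ p ∈ U, LinearIndependent ℝ ![e p, e' p] := by
    intro p hp
    rw [LinearIndependent.pair_iff]
    intro s t hst
    have h1 := congrArg (A.conn p 1 0) hst
    have h2 := congrArg (A.conn p 2 0) hst
    rw [map_add, map_smul, map_smul, (hd p hp).left, (hd p hp).right, map_zero] at h1
    rw [map_add, map_smul, map_smul, (hd p hp).left', (hd p hp).right', map_zero] at h2
    simp at h1 h2
    exact ⟨h1, h2⟩
  have hρv : ∀ p ∈ U, ρ p * v p 3 ≠ 0 := fun p hp =>
    mul_ne_zero (h.potential.pos p hp).ne' (hv3 p hp)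
  have hFIII : ∀ p ∈ U, ∀ X Y, thirdForm F p X Y = (tm (A.vec p 0))⁻¹ ^ 2 *
      (A.conn p 1 0 X * A.conn p 1 0 Y + A.conn p 2 0 X * A.conn p 2 0 Y) := by
    intro p hp X Y
    rw [hLF.thirdForm_eq h.isOpen hp, h.framing.lor_dd_vec_zero h.isOpen hp]
  have hmemline : ∀ b₀ b₁ : R41, b₀ ∈ affLine b₀ b₁ := fun b₀ b₁ => ⟨0, by simp⟩
  have hFline : ∀ p ∈ U, A.congr v r p ∈ (F p).line := fun p hp => by
    rw [← h.framing.along p hp]; exact ⟨r p / v p 3, rfl⟩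
  refine { smooth := h.smooth_congr hr hv3, spacelike := ?_, legendre_left := h.legendre,
           legendre_right := h.isLegendreImmersion_transform hr hv3 hdr hG,
           envelope_left := hFline, envelope_right := ?_, distinct := ?_, ribaucour := ?_,
           conformal := ?_, opposite := ?_ }
  · intro p hp X hX
    rw [h.lor_dd_congruence_self hr hv3 hp]
    by_contra hle
    have h1 : (A.conn₀ p 1 (e p) + r p / v p 3) * A.conn p 1 0 X = 0 := by
      nlinarith [sq_nonneg ((A.conn₀ p 1 (e p) + r p / v p 3) * A.conn p 1 0 X),
        sq_nonneg ((A.conn₀ p 2 (e' p) + r p / v p 3) * A.conn p 2 0 X)]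
    have h2 : (A.conn₀ p 2 (e' p) + r p / v p 3) * A.conn p 2 0 X = 0 := by
      nlinarith [sq_nonneg ((A.conn₀ p 1 (e p) + r p / v p 3) * A.conn p 1 0 X),
        sq_nonneg ((A.conn₀ p 2 (e' p) + r p / v p 3) * A.conn p 2 0 X)]
    exact hX ((hd p hp).eq_zero ((mul_eq_zero.1 h1).resolve_left (hne p hp).1)
      ((mul_eq_zero.1 h2).resolve_left (hne p hp).2))
  · intro p hp
    rw [hG p hp]
    exact hmemline _ _
  · intro p hp heq
    have hSF := hFline p hp
    have h1 : A.congr v r p + A.comb v p ∈ (F p).line := by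
      rw [heq, hG p hp]; exact ⟨1, by simp⟩
    rw [← h.framing.along p hp] at hSF h1
    obtain ⟨t, ht⟩ := hSF
    obtain ⟨t', ht'⟩ := h1
    -- If the lines agreed, w would be a multiple of the null vector a₁, contradicting ⟨a₁,w⟩ = -v⁴
    -- ≠ 0.
    have hw : A.comb v p = (t' - t) • A.vec p 0 := by
      have : A.comb v p = (A.congr v r p + A.comb v p) - A.congr v r p := by abel
      rw [this, ht', ht, sub_smul]; abel
    have h3 := (lor_sum_frame_right (h.framing.lorentz p hp) (v p)).1
    have h4 : lor (A.vec p 0) (A.comb v p) = 0 := by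
      rw [hw, lor_smul_right, (frame_zero_mem_lightCone (h.framing.lorentz p hp)).1, mul_zero]
    rw [FrameField.comb, h3] at h4
    exact hv3 p hp (by linarith)
  · intro p hp
    obtain ⟨h1, h1'⟩ := h.framing.conn₀_eq hp (hd p hp) (e p)
    obtain ⟨h2, h2'⟩ := h.framing.conn₀_eq hp (hd p hp) (e' p)
    refine ⟨e p, e' p, hli p hp, ?_, ?_, ?_, ?_, ?_⟩
    · rw [hFIII p hp, (hd p hp).left', (hd p hp).right]; ring
    · refine hLF.isPrincipalDirection h.isOpen hp (he p hp) (a := 1)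
        (b := -A.conn₀ p 1 (e p))
        (l := A.conn₀ p 0 (e p) - A.conn₀ p 1 (e p) * A.conn p 0 0 (e p)) (Or.inl one_ne_zero) ?_
      rw [h.dd_pos hp, h.dd_vec_zero hp, h1', (hd p hp).left, (hd p hp).left']
      module
    · refine hLF.isPrincipalDirection h.isOpen hp (he' p hp) (a := 1)
        (b := -A.conn₀ p 2 (e' p))
        (l := A.conn₀ p 0 (e' p) - A.conn₀ p 2 (e' p) * A.conn p 0 0 (e' p))
        (Or.inl one_ne_zero) ?_
      rw [h.dd_pos hp, h.dd_vec_zero hp, h2, (hd p hp).right, (hd p hp).right']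
      module
    -- On e the vectors dS and dw are proportional, with ratio -(a+s)/(ρv⁴); on e' the ratio has the
    -- opposite sign pattern.
    · refine hL.isPrincipalDirection h.isOpen hp (he p hp) (a := ρ p * v p 3)
        (b := A.conn₀ p 1 (e p) + r p / v p 3) (l := 0) (Or.inl (hρv p hp)) ?_
      have hk := h.congruence_coeff hr hv3 hdr hp (e p)
      rw [(hd p hp).left, (hd p hp).left'] at hk
      rw [h.dd_congruence hr hv3 hp, h.dd_comb hp, (hd p hp).left, (hd p hp).left']
      linear_combination (norm := module) (ρ p * hk) • (A.vec p 0)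
    · refine hL.isPrincipalDirection h.isOpen hp (he' p hp) (a := ρ p * v p 3)
        (b := -(A.conn₀ p 2 (e' p) + r p / v p 3)) (l := 0) (Or.inl (hρv p hp)) ?_
      have hk := h.congruence_coeff hr hv3 hdr hp (e' p)
      rw [(hd p hp).right, (hd p hp).right'] at hk
      rw [h.dd_congruence hr hv3 hp, h.dd_comb hp, (hd p hp).right, (hd p hp).right']
      linear_combination (norm := module) (ρ p * hk) • (A.vec p 0)
  · intro p hp
    refine ⟨((tm (A.comb v p))⁻¹ * (ρ p * v p 3)) ^ 2 * (tm (A.vec p 0)) ^ 2, ?_, fun X Y => ?_⟩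
    · have h1 := (inv_pos.2 (hL.tm_pos hp)).ne'
      have h2 := hLF.tm_pos hp
      have h3 := hρv p hp
      positivity
    · have h2 := (hLF.tm_pos hp).ne'
      rw [h.thirdForm_transform hr hv3 hdr hG hp, hFIII p hp]
      field_simp
  · intro p hp X Y hXY
    have hF : ∀ X Y, congruenceForm (A.congr v r) F p X Y = (tm (A.vec p 0))⁻¹ *
        ((A.conn₀ p 1 (e p) + r p / v p 3) * A.conn p 1 0 X * A.conn p 1 0 Y +
        (A.conn₀ p 2 (e' p) + r p / v p 3) * A.conn p 2 0 X * A.conn p 2 0 Y) := fun X Y => by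
      rw [hLF.congruenceForm_eq h.isOpen hp X Y (h.lor_dd_congruence_vec_zero hr hv3 hp X),
        h.lor_dd_congruence_dd_vec hr hv3 hp]
    have hG' : ∀ X Y, congruenceForm (A.congr v r) G p X Y = (tm (A.comb v p))⁻¹ *
        (-ρ p * v p 3 * ((A.conn₀ p 1 (e p) + r p / v p 3) * A.conn p 1 0 X * A.conn p 1 0 Y -
        (A.conn₀ p 2 (e' p) + r p / v p 3) * A.conn p 2 0 X * A.conn p 2 0 Y)) := fun X Y => by
      rw [hL.congruenceForm_eq h.isOpen hp X Y (h.lor_dd_congruence_comb hr hv3 hdr hp X),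
        h.lor_dd_congruence_dd_comb hr hv3 hp]
    have hdet : A.conn p 1 0 X * A.conn p 2 0 Y - A.conn p 1 0 Y * A.conn p 2 0 X ≠ 0 := by
      intro h0
      rw [LinearIndependent.pair_iff] at hXY
      have hX0 : X ≠ 0 := fun h0 => by
        have := hXY 1 0 (by rw [h0]; simp)
        simp at this
      have k1 := hXY (A.conn p 1 0 Y) (-A.conn p 1 0 X) ((hd p hp).eq_zero
        (by rw [map_add, map_smul, map_smul, smul_eq_mul, smul_eq_mul]; ring)
        (by rw [map_add, map_smul, map_smul, smul_eq_mul, smul_eq_mul]; linarith))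
      have k2 := hXY (A.conn p 2 0 Y) (-A.conn p 2 0 X) ((hd p hp).eq_zero
        (by rw [map_add, map_smul, map_smul, smul_eq_mul, smul_eq_mul]; linarith)
        (by rw [map_add, map_smul, map_smul, smul_eq_mul, smul_eq_mul]; ring))
      exact hX0 ((hd p hp).eq_zero (neg_eq_zero.1 k1.2) (neg_eq_zero.1 k2.2))
    -- Up to factors, the two forms are (a+s)θ₂² + (b+s)θ₃² and (a+s)θ₂² - (b+s)θ₃². The product of
    -- their discriminants is minus this square.
    have hpos : 0 < ((tm (A.vec p 0))⁻¹ * (tm (A.comb v p))⁻¹ * (ρ p * v p 3) *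
        ((A.conn₀ p 1 (e p) + r p / v p 3) * (A.conn₀ p 2 (e' p) + r p / v p 3)) *
        (A.conn p 1 0 X * A.conn p 2 0 Y - A.conn p 1 0 Y * A.conn p 2 0 X) ^ 2) ^ 2 := by
      have h1 := (inv_pos.2 (hL.tm_pos hp)).ne'
      have h2 := (inv_pos.2 (hLF.tm_pos hp)).ne'
      exact sq_pos_of_ne_zero (mul_ne_zero (mul_ne_zero (mul_ne_zero (mul_ne_zero h2 h1) (hρv p hp))
        (mul_ne_zero (hne p hp).1 (hne p hp).2)) (pow_ne_zero 2 hdet))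
    simp only [disc, hF, hG']
    linear_combination hpos

end IsDarbouxData

/-- Transforms exist around every point. -/
theorem exists_transform_data {e e' : (x : M) → T x} (hU : IsOpen U)
    (hA : IsPrincipalFraming U F A) (hF : IsLegendreImmersion U F) (hρ : IsPotential U A ρ)
    (hd : ∀ x ∈ U, IsDualFrame (A.conn x 1 0) (A.conn x 2 0) (e x) (e' x)) {p : M} (hp : p ∈ U) :
    ∃ (W : Set M) (v : M → R41) (r : M → ℝ), IsOpen W ∧ p ∈ W ∧ W ⊆ U ∧
      IsSolution W A ρ v ∧ (∀ x ∈ W, v x ∈ lightCone ∧ v x 3 ≠ 0) ∧ SmoothOn W r ∧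
      (∀ x ∈ W, dd r x = A.gam v x) ∧ ∀ x ∈ W, Function.Injective (dd (A.congr v r) x) := by
  have hv₀ : (![0, 0, 0, 1] : R41) ∈ lightCone := ⟨by simp [lor], by simp⟩
  -- The initial direction is w = a₄ at p, for which v⁴ = 1.
  obtain ⟨W, v, hW, hpW, hWU, hv, hvp, hcone⟩ := exists_isSolution hU hA hρ hp ![0, 0, 0, 1]
  have hv3p : v p 3 = 1 := by rw [hvp]; rfl
  set W₁ := W ∩ (fun x => v x 3) ⁻¹' Ioi 0 with hW₁def
  have hW₁ : IsOpen W₁ := (hv.1.apply 3).continuousOn.isOpen_inter_preimage hW isOpen_Ioi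
  have hpW₁ : p ∈ W₁ := ⟨hpW, by show 0 < v p 3; rw [hv3p]; norm_num⟩
  have hW₁U : W₁ ⊆ U := fun x hx => hWU hx.1
  have hv3 : ∀ x ∈ W₁, v x 3 ≠ 0 := fun x hx => ne_of_gt hx.2
  have hdata : IsDarbouxData W₁ F A ρ v e e' :=
    ⟨hW₁, hA.mono hW₁U, hF.mono hW₁U, fun x hx => hd x (hW₁U hx), hρ.mono hW₁U,
      hv.mono inter_subset_left, fun x hx => hcone hv₀ x hx.1⟩
  -- With this constant of integration a+s and b+s are both positive at p, so their product stays
  -- positive nearby.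
  obtain ⟨W₂, r, hW₂, hpW₂, hW₂₁, hr, hrp, hdr⟩ := hdata.hasExtDeriv_gam.exists_primitive hW₁ hpW₁
    (|A.conn₀ p 1 (e p)| + |A.conn₀ p 2 (e' p)| + 1)
  have hdata₂ := hdata.mono hW₂ hW₂₁
  have hv3₂ : ∀ x ∈ W₂, v x 3 ≠ 0 := fun x hx => hv3 x (hW₂₁ hx)
  obtain ⟨ha, hb⟩ := hdata₂.smooth_coeff
  have hs := hdata₂.smooth_ratio hr hv3₂
  have hopen : IsOpen (W₂ ∩ (fun x => (A.conn₀ x 1 (e x) + r x / v x 3) *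
      (A.conn₀ x 2 (e' x) + r x / v x 3)) ⁻¹' Ioi 0) :=
    ((ha.add hs).mul (hb.add hs)).continuousOn.isOpen_inter_preimage hW₂ isOpen_Ioi
  have hsub : W₂ ∩ (fun x => (A.conn₀ x 1 (e x) + r x / v x 3) *
      (A.conn₀ x 2 (e' x) + r x / v x 3)) ⁻¹' Ioi 0 ⊆ W₂ := inter_subset_left
  refine ⟨_, v, r, hopen, ⟨hpW₂, ?_⟩, fun x hx => hW₁U (hW₂₁ hx.1),
    hv.mono fun x hx => (hW₂₁ hx.1).1, fun x hx => ⟨hdata₂.cone x hx.1, hv3₂ x hx.1⟩,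
    hr.mono hsub, fun x hx => hdr x hx.1, fun x hx => ?_⟩
  · show 0 < (A.conn₀ p 1 (e p) + r p / v p 3) * (A.conn₀ p 2 (e' p) + r p / v p 3)
    rw [hrp, hv3p, div_one]
    refine mul_pos ?_ ?_
    · linarith [neg_abs_le (A.conn₀ p 1 (e p)), abs_nonneg (A.conn₀ p 2 (e' p))]
    · linarith [neg_abs_le (A.conn₀ p 2 (e' p)), abs_nonneg (A.conn₀ p 1 (e p))]
  · have hx2 : 0 < (A.conn₀ x 1 (e x) + r x / v x 3) * (A.conn₀ x 2 (e' x) + r x / v x 3) := hx.2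
    exact hdata₂.injective_dd_congruence hr hv3₂ hx.1 (left_ne_zero_of_mul hx2.ne')
      (right_ne_zero_of_mul hx2.ne')

end Transform

/-! ### Existence of ρ from the holomorphy of the polarization -/

section Potential

variable {M : Type*} [TopologicalSpace M] [ChartedSpace E2 M] [IsManifold (𝓡 2) ∞ M]
  {U : Set M} {F : M → ContactElement} {A : FrameField M}

/-- A conformal complex structure is a rotation by a right angle in every orthonormal frame. -/
theorem exists_sign_of_conformal {p : M} {θ θ' : T p →L[ℝ] ℝ} {e e' : T p}
    (hd : IsDualFrame θ θ' e e') {J : T p →L[ℝ] T p} (hJ : ∀ X, J (J X) = -X)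
    (hc : ∀ X, θ (J X) ^ 2 + θ' (J X) ^ 2 = θ X ^ 2 + θ' X ^ 2) :
    ∃ ε : ℝ, ε * ε = 1 ∧ (∀ X, θ (J X) = -(ε * θ' X)) ∧ ∀ X, θ' (J X) = ε * θ X := by
  have h1 := congrArg θ (hJ e)
  have h2 := congrArg θ' (hJ e)
  have h3 := congrArg θ (hJ e')
  have h4 := congrArg θ' (hJ e')
  have e1 := hd.map_eq (θ.comp J)
  have e2 := hd.map_eq (θ'.comp J)
  simp only [ContinuousLinearMap.comp_apply, smul_eq_mul] at e1 e2
  rw [map_neg, e1, hd.left] at h1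
  rw [map_neg, e2, hd.left'] at h2
  rw [map_neg, e1, hd.right] at h3
  rw [map_neg, e2, hd.right'] at h4
  have h5 := hc e
  have h6 := hc e'
  rw [hd.left, hd.left'] at h5
  rw [hd.right, hd.right'] at h6
  suffices H : ∃ ε : ℝ, ε * ε = 1 ∧ θ (J e) = 0 ∧ θ (J e') = -ε ∧ θ' (J e) = ε ∧ θ' (J e') = 0 by
    obtain ⟨ε, hε, k1, k2, k3, k4⟩ := H
    exact ⟨ε, hε, fun X => by rw [e1, k1, k2]; ring, fun X => by rw [e2, k3, k4]; ring⟩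
  clear e1 e2
  generalize θ (J e) = α at *
  generalize θ' (J e) = β at *
  generalize θ (J e') = γ at *
  generalize θ' (J e') = δ at *
  have hβ : β ≠ 0 := by rintro rfl; nlinarith
  have hδ : δ = -α := mul_left_cancel₀ hβ (by linarith)
  subst hδ
  -- From J² = -1 and preservation of lengths one gets (β+γ)² = -4α².
  have hα : α = 0 := by nlinarith [sq_nonneg (β + γ)]
  subst hα
  have hγ : γ = -β := mul_left_cancel₀ hβ (by nlinarith)
  subst hγ
  exact ⟨β, by nlinarith, rfl, rfl, rfl, neg_zero⟩

/-- The `(2,0)`-part of a diagonal form. -/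
theorem part20_diagonal_of_sign {p : M} {θ θ' : T p →L[ℝ] ℝ} {J : T p →L[ℝ] T p} {ε : ℝ}
    (hε : ε * ε = 1) (h1 : ∀ X, θ (J X) = -(ε * θ' X)) (h2 : ∀ X, θ' (J X) = ε * θ X)
    {B : T p → T p → ℝ} {a b : ℝ}
    (hB : ∀ X Y, B X Y = a * θ X * θ Y + b * θ' X * θ' Y) (X : T p) :
    part20 J B X = (((a - b) / 4 : ℝ) : ℂ) * ((θ X : ℂ) + ε * (θ' X : ℂ) * Complex.I) ^ 2 := by
  have hε' : (ε : ℂ) * ε = 1 := by exact_mod_cast hε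
  simp only [part20, hB, h1, h2]
  push_cast
  linear_combination (-((a : ℂ) - b) / 4 * (θ' X) ^ 2 * ε * ε) * Complex.I_sq +
    (-(b : ℂ) * ((θ X : ℂ) ^ 2 + (θ' X : ℂ) ^ 2) / 4) * hε'

section Polarization

variable {μ : M → ℝ} {J : (x : M) → T x →L[ℝ] T x} {q : (x : M) → T x → ℂ}
  (hF : IsLIsothermicWith U F J q μ) (hU : IsOpen U) (hA : IsPrincipalFraming U F A)
  {e e' : (x : M) → T x}
  (hd : ∀ x ∈ U, IsDualFrame (A.conn x 1 0) (A.conn x 2 0) (e x) (e' x))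

include hU hA in
-- For a principal frame the directions dual to θ₂, θ₃ are curvature directions, so the Hopf
-- differential is real on e.
theorem secondForm_framing (hF : IsLegendreImmersion U F) {p : M} (hp : p ∈ U)
    (hd : IsDualFrame (A.conn p 1 0) (A.conn p 2 0) (e p) (e' p)) :
    ∃ a b : ℝ, ∀ X Y, secondForm F p X Y =
      a * A.conn p 1 0 X * A.conn p 1 0 Y + b * A.conn p 2 0 X * A.conn p 2 0 Y := by
  have hL := hA.isLineField
  set k := (tm (A.vec p 0))⁻¹
  set τ := -(tm (A.pos p)) * k
  refine ⟨k * (A.conn₀ p 1 (e p) + τ), k * (A.conn₀ p 2 (e' p) + τ), fun X Y => ?_⟩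
  have hc : ∀ p ∈ U, ∀ X : T p, lor (dd A.pos p X) (A.vec p 0) = 0 := by
    intro p hp X
    have h := hA.conn₀_apply hp 3 X
    rw [hA.conn₀_three hU hF hp] at h
    simp only [dualVec, Matrix.cons_val, lor_neg_left, _root_.zero_apply] at h
    rw [lor_comm]
    linarith
  rw [hL.secondForm_eq hU hc hp, lor_add_left, lor_smul_left, hA.lor_dd_vec_zero hU hp,
    lor_eq_components (hA.lorentz p hp)]
  simp only [← hA.conn_apply hp, ← hA.conn₀_apply hp]
  rw [(hA.conn_skew hU hp).1, hA.conn₀_three hU hF hp, (hA.conn₀_eq hp hd X).1,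
    (hA.conn₀_eq hp hd X).2]
  simp only [_root_.zero_apply]
  ring

include hF hU hA

/-- The complex structure J need not induce the orientation of the coframe θ₂, θ₃; the sign ε
records which case occurs. -/
theorem exists_sign {p : M} (hp : p ∈ U)
    (hd : IsDualFrame (A.conn p 1 0) (A.conn p 2 0) (e p) (e' p)) :
    ∃ ε : ℝ, ε * ε = 1 ∧ (∀ X, A.conn p 1 0 (J p X) = -(ε * A.conn p 2 0 X)) ∧
      ∀ X, A.conn p 2 0 (J p X) = ε * A.conn p 1 0 X := by
  refine exists_sign_of_conformal hd (hF.polarization.sq p hp) fun X => ?_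
  have h := hF.conformal p hp X
  have hk := pow_pos (inv_pos.2 (hA.isLineField.tm_pos hp)) 2
  rw [hA.isLineField.thirdForm_eq hU hp, hA.isLineField.thirdForm_eq hU hp,
    hA.lor_dd_vec_zero hU hp, hA.lor_dd_vec_zero hU hp] at h
  have := mul_left_cancel₀ hk.ne' h
  linarith

include hd

/-- The polarization of a principal frame is real where `μ` does not vanish. -/
theorem im_polarization_eq_zero {p : M} (hp : p ∈ U) (hμ : μ p ≠ 0) : (q p (e p)).im = 0 := by
  obtain ⟨a, b, hB⟩ := secondForm_framing hU hA hF.legendre hp (hd p hp)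
  obtain ⟨ε, hε, h1, h2⟩ := exists_sign hF hU hA hp (hd p hp)
  have h := hF.hopf p hp (e p)
  rw [part20_diagonal_of_sign hε h1 h2 hB, (hd p hp).left, (hd p hp).left'] at h
  have := congrArg Complex.im h
  simp at this
  exact this.resolve_left hμ

end Polarization

section Frame

variable (hU : IsOpen U) (hA : IsPrincipalFraming U F A) {e e' : (x : M) → T x}
  (hd : ∀ x ∈ U, IsDualFrame (A.conn x 1 0) (A.conn x 2 0) (e x) (e' x))
include hU hA hd

theorem smoothOn_dd_frame {g : M → ℝ} (hg : SmoothOn U g) :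
    SmoothOn U (fun x => dd g x (e x)) ∧ SmoothOn U (fun x => dd g x (e' x)) :=
  smoothOn_apply_dualFrame hU (hA.hasExtDeriv_conn hU 1 0).smooth
    (hA.hasExtDeriv_conn hU 2 0).smooth (HasExtDeriv.dd hg hU).smooth hd

/-- The mixed second derivatives of a function in the frame dual to `α²₁, α³₁`. -/
theorem dd_dd_frame {g : M → ℝ} (hg : SmoothOn U g) {p : M} (hp : p ∈ U) :
    dd (fun x => dd g x (e x)) p (e' p) +
        dd g p (e p) * (A.conn p 0 0 (e' p) - A.conn p 2 1 (e p)) =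
      dd (fun x => dd g x (e' x)) p (e p) +
        dd g p (e' p) * (A.conn p 0 0 (e p) + A.conn p 2 1 (e' p)) := by
  obtain ⟨h1, h2⟩ := smoothOn_dd_frame hU hA hd hg
  have hc := hA.hasExtDeriv_conn hU
  -- Here dg is written in the coframe; its exterior derivative, computed from the structure
  -- equations, is compared with d(dg) = 0.
  have k := (((hc 1 0).smul h1 hU).add ((hc 2 0).smul h2 hU) hU).congr hU (η' := fun x => dd g x)
    (fun x hx => by
      ext X
      rw [(hd x hx).map_eq (dd g x) X, _root_.add_apply, _root_.smul_apply, _root_.smul_apply]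
      simp only [smul_eq_mul]
      ring) fun x hx X Y => rfl
  have hu := k.unique (HasExtDeriv.dd hg hU) hp (e p) (e' p)
  obtain ⟨h30, h03, h11, h22, h31, h32, h33, h13, h23, h12⟩ := hA.conn_skew hU hp
  simp only [Fin.sum_univ_four, h30, h11, h22, h12, _root_.neg_apply, _root_.zero_apply,
    (hd p hp).left, (hd p hp).left', (hd p hp).right, (hd p hp).right'] at hu
  linarith

theorem smoothOn_dd_frame_complex {z : M → ℂ} (hz : SmoothOn U z) :
    SmoothOn U (fun x => dd z x (e x)) ∧ SmoothOn U (fun x => dd z x (e' x)) := by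
  have hre := smoothOn_dd_frame hU hA hd (hz.clm Complex.reCLM)
  have him := smoothOn_dd_frame hU hA hd (hz.clm Complex.imCLM)
  have key : ∀ x ∈ U, ∀ X : T x, dd z x X = dd (fun y => Complex.reCLM (z y)) x X • (1 : ℂ) +
      dd (fun y => Complex.imCLM (z y)) x X • Complex.I := by
    intro x hx X
    rw [dd_clm _ (hz.mdifferentiableAt hU hx), dd_clm _ (hz.mdifferentiableAt hU hx)]
    apply Complex.ext <;> simp
  exact ⟨(hre.1.complex him.1).congr fun x hx => key x hx _,
    (hre.2.complex him.2).congr fun x hx => key x hx _⟩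

theorem dd_dd_frame_complex {z : M → ℂ} (hz : SmoothOn U z) {p : M} (hp : p ∈ U) :
    dd (fun x => dd z x (e x)) p (e' p) +
        dd z p (e p) * ((A.conn p 0 0 (e' p) - A.conn p 2 1 (e p) : ℝ) : ℂ) =
      dd (fun x => dd z x (e' x)) p (e p) +
        dd z p (e' p) * ((A.conn p 0 0 (e p) + A.conn p 2 1 (e' p) : ℝ) : ℂ) := by
  obtain ⟨h1, h2⟩ := smoothOn_dd_frame_complex hU hA hd hz
  have key : ∀ L : ℂ →L[ℝ] ℝ, L (dd (fun x => dd z x (e x)) p (e' p)) +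
        L (dd z p (e p)) * (A.conn p 0 0 (e' p) - A.conn p 2 1 (e p)) =
      L (dd (fun x => dd z x (e' x)) p (e p)) +
        L (dd z p (e' p)) * (A.conn p 0 0 (e p) + A.conn p 2 1 (e' p)) := by
    intro L
    have h := dd_dd_frame hU hA hd (hz.clm L) hp
    rw [dd_clm L (hz.mdifferentiableAt hU hp), dd_clm L (hz.mdifferentiableAt hU hp),
      dd_congr hU hp (f := fun x => dd (fun y => L (z y)) x (e x)) fun x hx =>
        dd_clm L (hz.mdifferentiableAt hU hx) (e x),
      dd_congr hU hp (f := fun x => dd (fun y => L (z y)) x (e' x)) fun x hx =>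
        dd_clm L (hz.mdifferentiableAt hU hx) (e' x), dd_clm L (h1.mdifferentiableAt hU hp),
      dd_clm L (h2.mdifferentiableAt hU hp)] at h
    exact h
  apply Complex.ext
  · have := key Complex.reCLM
    simpa using this
  · have := key Complex.imCLM
    simpa using this

end Frame

section Existence

variable {μ : M → ℝ} {J : (x : M) → T x →L[ℝ] T x} {q : (x : M) → T x → ℂ}
  (hF : IsLIsothermicWith univ F J q μ) (hU : IsOpen U) (hA : IsPrincipalFraming U F A)
  {e e' : (x : M) → T x}
  (hd : ∀ x ∈ U, IsDualFrame (A.conn x 1 0) (A.conn x 2 0) (e x) (e' x))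
include hF hU hA hd

/-- The coefficient of the polarization in a principal frame in which it is real. -/
theorem exists_local_coefficient (hq : ∀ p ∈ U, q p ≠ 0) {p : M} (hp : p ∈ U) :
    ∃ (V : Set M) (κ : M → ℂ), IsOpen V ∧ p ∈ V ∧ V ⊆ U ∧ SmoothOn V κ ∧
      ∀ x ∈ V, κ x = q x (e x) ∧ κ x ≠ 0 ∧ ∃ ε : ℝ, ε * ε = 1 ∧
        dd κ x (e' x) + 2 * κ x * ((A.conn x 0 0 (e' x) - A.conn x 2 1 (e x) : ℝ) : ℂ) =
          ε * Complex.I * (dd κ x (e x) +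
            2 * κ x * ((A.conn x 0 0 (e x) + A.conn x 2 1 (e' x) : ℝ) : ℂ)) := by
  obtain ⟨V₀, hV₀, hpV₀, -, z, h, hz, hh, hzh⟩ := hF.polarization.holomorphic p (mem_univ p)
  have hV : IsOpen (U ∩ V₀) := hU.inter hV₀
  have hVU : U ∩ V₀ ⊆ U := inter_subset_left
  have hdV : ∀ x ∈ U ∩ V₀, IsDualFrame (A.conn x 1 0) (A.conn x 2 0) (e x) (e' x) :=
    fun x hx => hd x hx.1
  have hAV := hA.mono hVU
  replace hz := hz.mono (inter_subset_right (s := U))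
  replace hh := hh.mono (inter_subset_right (s := U))
  obtain ⟨hζ, hζ'⟩ := smoothOn_dd_frame_complex hV hAV hdV hz
  have hsign : ∀ x ∈ U ∩ V₀, ∃ ε : ℝ, ε * ε = 1 ∧ J x (e x) = ε • e' x := by
    intro x hx
    obtain ⟨ε, hε, h1, h2⟩ := exists_sign (hF.mono hV (subset_univ _)) hV hAV hx (hdV x hx)
    refine ⟨ε, hε, ?_⟩
    rw [(hdV x hx).expand (J x (e x)), h1, h2, (hdV x hx).left, (hdV x hx).left']
    simp
  have hCR : ∀ x ∈ U ∩ V₀, ∀ ε : ℝ, ε * ε = 1 → J x (e x) = ε • e' x → ∀ g : M → ℂ,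
      (∀ X : T x, dd g x (J x X) = Complex.I * dd g x X) →
      dd g x (e' x) = ε * Complex.I * dd g x (e x) := by
    intro x hx ε hε hJ g hg
    have h1 := hg (e x)
    rw [hJ, map_smul, Complex.real_smul] at h1
    have hε' : (ε : ℂ) * ε = 1 := by exact_mod_cast hε
    linear_combination (ε : ℂ) * h1 - dd g x (e' x) * hε'
  -- The sign ε is only known pointwise, so the relation dz(e') = εi·dz(e) cannot be differentiated
  -- directly. Its square is free of ε.
  have hsq : ∀ x ∈ U ∩ V₀, dd z x (e' x) * dd z x (e' x) = -(dd z x (e x) * dd z x (e x)) := by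
    intro x hx
    obtain ⟨ε, hε, hJ⟩ := hsign x hx
    have hε' : (ε : ℂ) * ε = 1 := by exact_mod_cast hε
    rw [hCR x hx ε hε hJ z (hzh x hx.2).2.1]
    linear_combination (dd z x (e x)) ^ 2 * ε * ε * Complex.I_sq - (dd z x (e x)) ^ 2 * hε'
  have hκ : SmoothOn (U ∩ V₀) (fun x => h x * (dd z x (e x) * dd z x (e x))) :=
    hh.mul (hζ.mul hζ)
  refine ⟨U ∩ V₀, _, hV, ⟨hp, hpV₀⟩, hVU, hκ, fun x hx => ?_⟩
  obtain ⟨hinj, hzJ, hhJ, hqx⟩ := hzh x hx.2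
  have he : e x ≠ 0 := fun h0 => by
    have := (hdV x hx).left
    rw [h0, map_zero] at this
    simp at this
  have hζ0 : dd z x (e x) ≠ 0 := fun h0 => he (hinj _ h0)
  have hh0 : h x ≠ 0 := by
    intro h0
    refine hq x hx.1 (funext fun X => ?_)
    rw [hqx, h0, zero_mul, Pi.zero_apply]
  refine ⟨by rw [hqx]; ring, mul_ne_zero hh0 (mul_ne_zero hζ0 hζ0), ?_⟩
  obtain ⟨ε, hε, hJ⟩ := hsign x hx
  have hε' : (ε : ℂ) * ε = 1 := by exact_mod_cast hε
  refine ⟨ε, hε, ?_⟩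
  have mh := hh.mdifferentiableAt hV hx
  have mζ := hζ.mdifferentiableAt hV hx
  have mζ' := hζ'.mdifferentiableAt hV hx
  rw [dd_mul mh ((hζ.mul hζ).mdifferentiableAt hV hx), dd_mul mh
    ((hζ.mul hζ).mdifferentiableAt hV hx), dd_mul mζ mζ, dd_mul mζ mζ, hCR x hx ε hε hJ h hhJ]
  have hcl := dd_dd_frame_complex hV hAV hdV hz hx
  have hd2 := congrArg (fun L => L (e x)) (dd_congr hV hx hsq)
  have hneg : dd (fun x => -(dd z x (e x) * dd z x (e x))) x (e x) =
      -(dd (fun x => dd z x (e x) * dd z x (e x)) x (e x)) := by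
    have := dd_clm (-ContinuousLinearMap.id ℝ ℂ) ((hζ.mul hζ).mdifferentiableAt hV hx) (e x)
    simpa only [_root_.neg_apply, ContinuousLinearMap.id_apply] using this
  simp only [hneg] at hd2
  rw [dd_mul mζ' mζ', dd_mul mζ mζ] at hd2
  have hz' := hCR x hx ε hε hJ z hzJ
  rw [hz'] at hcl hd2
  generalize dd (fun x => dd z x (e x)) x (e' x) = a at *
  generalize dd (fun x => dd z x (e x)) x (e x) = b at *
  generalize dd (fun x => dd z x (e' x)) x (e x) = c at *
  generalize dd h x (e x) = k at *
  generalize dd z x (e x) = ζ at *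
  generalize ((A.conn x 0 0 (e' x) - A.conn x 2 1 (e x) : ℝ) : ℂ) = η' at *
  generalize ((A.conn x 0 0 (e x) + A.conn x 2 1 (e' x) : ℝ) : ℂ) = η at *
  -- This is the derivative of the squared Cauchy–Riemann relation along e; together with the mixed
  -- second derivatives of z it yields the equation for κ = h·dz(e)².
  have hc : c = ε * Complex.I * b := by
    refine mul_left_cancel₀ (mul_ne_zero (mul_ne_zero Complex.I_ne_zero
      (fun h0 => by rw [h0] at hε'; simp at hε' : (ε : ℂ) ≠ 0)) hζ0) ?_
    linear_combination (1 / 2) * hd2 - ζ * b * ε * ε * Complex.I_sq + ζ * b * hε'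
  rw [hc] at hcl
  linear_combination 2 * h x * ζ * hcl

/-- A potential exists if the polarization has no zeros and is real in the frame. -/
theorem exists_isPotential (hq : ∀ p ∈ U, q p ≠ 0)
    (hreal : ∀ p ∈ U, (∀ᶠ x in 𝓝 p, μ x = 0) → (q p (e p)).im = 0) :
    ∃ ρ, IsPotential U A ρ := by
  have him : ∀ p ∈ U, (q p (e p)).im = 0 := by
    intro p hp
    by_contra h0
    obtain ⟨V, κ, hV, hpV, hVU, hκ, hκq⟩ := exists_local_coefficient hF hU hA hd hq hp
    -- If q(e) is not real at p, it is not real nearby, where consequently μ = 0; the hypothesis at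
    -- points of this kind then applies to p.
    refine h0 (hreal p hp ?_)
    have hne : ∀ᶠ x in 𝓝 p, (κ x).im ≠ 0 :=
      ((hκ.clm Complex.imCLM).continuousOn.continuousAt (hV.mem_nhds hpV)).eventually_ne
        (by rw [(hκq p hpV).1]; exact h0)
    filter_upwards [hne, hV.mem_nhds hpV] with x hx hxV
    by_contra hμ
    rw [(hκq x hxV).1] at hx
    exact hx (im_polarization_eq_zero (hF.mono hU (subset_univ _)) hU hA hd (hVU hxV) hμ)
  have hloc : ∀ p ∈ U, ∃ (V : Set M) (k : M → ℝ), IsOpen V ∧ p ∈ V ∧ V ⊆ U ∧ SmoothOn V k ∧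
      (∀ x ∈ V, k x ≠ 0 ∧ ‖q x (e x)‖ = |k x|) ∧
      dd k p (e p) = -(2 * k p * (A.conn p 0 0 (e p) + A.conn p 2 1 (e' p))) ∧
      dd k p (e' p) = -(2 * k p * (A.conn p 0 0 (e' p) - A.conn p 2 1 (e p))) := by
    intro p hp
    obtain ⟨V, κ, hV, hpV, hVU, hκ, hκq⟩ := exists_local_coefficient hF hU hA hd hq hp
    have hκre : ∀ x ∈ V, κ x = ((κ x).re : ℂ) := by
      intro x hx
      apply Complex.ext
      · simp
      · rw [(hκq x hx).1, him x (hVU hx)]; simp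
    refine ⟨V, fun x => (κ x).re, hV, hpV, hVU, hκ.clm Complex.reCLM, fun x hx => ⟨fun h0 => ?_, ?_⟩,
      ?_⟩
    · refine (hκq x hx).2.1 ?_
      rw [hκre x hx]
      simpa using h0
    · rw [← (hκq x hx).1, hκre x hx, Complex.norm_real]
      rfl
    · have hdd : ∀ X : T p, dd κ p X = ((dd (fun x => (κ x).re) p X : ℝ) : ℂ) := by
        intro X
        rw [dd_congr hV hpV hκre]
        exact dd_clm Complex.ofRealCLM ((hκ.clm Complex.reCLM).mdifferentiableAt hV hpV) X
      obtain ⟨-, -, ε, hε, heq⟩ := hκq p hpV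
      rw [hdd, hdd, hκre p hpV] at heq
      have hε0 : ε ≠ 0 := by rintro rfl; simp at hε
      have h1 := congrArg Complex.re heq
      have h2 := congrArg Complex.im heq
      simp at h1 h2
      -- With κ real the left side of the equation is real and the right side purely imaginary, so
      -- both vanish separately.
      have h3 := h2.resolve_left hε0
      constructor <;> linarith
  -- Taking the absolute value makes ρ positive whatever the sign of κ, without changing d log.
  refine ⟨fun x => ‖q x (e x)‖, smoothOn_of_locally fun p hp => ?_, fun p hp => ?_, fun p hp => ?_⟩
  · obtain ⟨V, k, hV, hpV, hVU, hk, hkq, -⟩ := hloc p hp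
    exact ⟨V, hV, hpV, (hk.comp (Φ := fun y => |y|) fun x hx =>
      contDiffAt_abs (hkq x hx).1).congr fun x hx => (hkq x hx).2⟩
  · obtain ⟨V, k, hV, hpV, hVU, hk, hkq, -⟩ := hloc p hp
    simp only [(hkq p hpV).2]
    exact abs_pos.2 (hkq p hpV).1
  · obtain ⟨V, k, hV, hpV, hVU, hk, hkq, h1, h2⟩ := hloc p hp
    have h0 := (hkq p hpV).1
    have hlog : ∀ X, dd (fun x => Real.log ‖q x (e x)‖) p X = dd k p X * (k p)⁻¹ := by
      intro X
      rw [dd_congr hV hpV (g := fun x => Real.log (k x)) fun x hx => by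
        rw [(hkq x hx).2, Real.log_abs],
        dd_comp (Real.hasDerivAt_log h0).hasFDerivAt (hk.mdifferentiableAt hV hpV)]
      rfl
    have hdp := hd p hp
    refine ⟨A.conn p 2 1 (e p) • A.conn p 2 0 - A.conn p 2 1 (e' p) • A.conn p 1 0,
      ⟨_, _, ?_, rfl⟩, ?_⟩
    · ext X
      rw [hdp.map_eq (A.conn p 2 1) X]
      simp only [_root_.add_apply, _root_.smul_apply, smul_eq_mul]
      ring
    · ext X
      rw [_root_.neg_apply, hlog X, hdp.map_eq (dd k p) X, h1, h2]
      simp only [_root_.smul_apply, _root_.sub_apply, smul_eq_mul]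
      rw [hdp.map_eq (A.conn p 0 0) X, smul_eq_mul, smul_eq_mul]
      field_simp
      ring

end Existence

end Potential

/-! ### Criteria for membership in the proper Lorentz group -/

section Lorentz

variable {a : Fin 4 → R41}
  (h : ∀ i j, lor (a i) (a j) = lor (Pi.single i 1) (Pi.single j 1))
include h

theorem sq_det_frameMatrix : (frameMatrix a).det * (frameMatrix a).det = 1 := by
  let G : Matrix (Fin 4) (Fin 4) ℝ := !![0, 0, 0, -1; 0, 1, 0, 0; 0, 0, 1, 0; -1, 0, 0, 0]
  have hG : (frameMatrix a).transpose * G * frameMatrix a = G := by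
    ext i j
    have h1 : ((frameMatrix a).transpose * G * frameMatrix a) i j = lor (a i) (a j) := by
      simp only [Matrix.mul_apply, frameMatrix, Matrix.transpose_apply, Matrix.of_apply,
        Fin.sum_univ_four, Matrix.cons_val, lor, Matrix.cons_val', Matrix.cons_val_fin_one, G]
      ring
    rw [h1, h]
    fin_cases i <;> fin_cases j <;> simp [lor, G]
  have hGG : G * G = 1 := by
    ext i j
    fin_cases i <;> fin_cases j <;> simp [Matrix.mul_apply, Fin.sum_univ_four, G]
  have hdet : G.det ≠ 0 := by
    intro h0
    have := congrArg Matrix.det hGG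
    rw [Matrix.det_mul, h0, Matrix.det_one] at this
    simp at this
  have := congrArg Matrix.det hG
  rw [Matrix.det_mul, Matrix.det_mul, Matrix.det_transpose] at this
  exact mul_right_cancel₀ hdet (by linarith)

/-- With these time components a vector v of the positive cone is sent to one of time component v¹ +
v⁴/2. It is positive, since v¹ and v⁴ are nonnegative with positive sum. -/
theorem frameMatrix_mem_properLorentz (hdet : (frameMatrix a).det = 1) (h0 : tm (a 0) = 1)
    (h1 : tm (a 1) = 0) (h2 : tm (a 2) = 0) (h3 : tm (a 3) = 1 / 2) :
    frameMatrix a ∈ properLorentz := by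
  have hlor : ∀ u w : R41, lor ((frameMatrix a).mulVec u) ((frameMatrix a).mulVec w) = lor u w := by
    intro u w
    rw [frameMatrix_mulVec, frameMatrix_mulVec]
    simp only [Fin.sum_univ_four, lor_add_left, lor_add_right, lor_smul_left, lor_smul_right, h]
    simp [lor]
    ring
  refine ⟨hlor, hdet, fun v hv => ⟨by rw [hlor]; exact hv.1, ?_⟩⟩
  have ht : 0 < tm ((frameMatrix a).mulVec v) := by
    rw [frameMatrix_mulVec]
    simp only [Fin.sum_univ_four, map_add, map_smul, h0, h1, h2, h3, smul_eq_mul]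
    have e1 := hv.1
    have e2 := hv.2
    simp only [lor] at e1
    have e3 : 0 ≤ v 0 * v 3 := by nlinarith [mul_self_nonneg (v 1), mul_self_nonneg (v 2)]
    by_contra hle
    nlinarith
  rw [tm_apply] at ht
  exact pos_of_mul_pos_right ht (by positivity)

end Lorentz

theorem contDiff_det_frameMatrix :
    ContDiff ℝ ∞ (fun a : Fin 4 → R41 => (frameMatrix a).det) := by
  simp only [Matrix.det_apply']
  refine ContDiff.sum fun τ _ => contDiff_const.mul (contDiff_prod fun i _ => ?_)
  simp only [frameMatrix, Matrix.transpose_apply, Matrix.of_apply]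
  fun_prop

theorem det_frameMatrix_smul (a b c d : R41) (s : ℝ) :
    (frameMatrix ![a, b, s • c, d]).det = s * (frameMatrix ![a, b, c, d]).det := by
  have h1 : Matrix.of ![a, b, s • c, d] = (Matrix.of ![a, b, c, d]).updateRow 2 (s • c) := by
    ext i j; fin_cases i <;> rfl
  have h2 : Matrix.of ![a, b, c, d] = (Matrix.of ![a, b, c, d]).updateRow 2 c := by
    ext i j; fin_cases i <;> rfl
  rw [frameMatrix, frameMatrix, Matrix.det_transpose, Matrix.det_transpose, h1,
    Matrix.det_updateRow_smul, ← h2]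

/-- The inclusion of Euclidean space into Minkowski space. -/
def spaceIncl : E3 →L[ℝ] R41 :=
  LinearMap.toContinuousLinearMap
    { toFun := fun x => sphereVec x 0
      map_add' := fun x y => by rw [← sphereVec_add, add_zero]
      map_smul' := fun c x => by rw [RingHom.id_apply, ← sphereVec_smul, mul_zero] }

theorem spaceIncl_apply (x : E3) : spaceIncl x = sphereVec x 0 := rfl

theorem dir_mem_lightCone (c : ContactElement) : c.dir ∈ lightCone := by
  have ht := c.tm_dir
  constructor
  · rw [lor_eq_inner, ht, c.sp_dir, inner_neg_neg, real_inner_self_eq_norm_sq, c.norm_normal]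
    norm_num
  · rw [tm_apply] at ht
    exact pos_of_mul_pos_right (by rw [ht]; exact one_pos) (by positivity)

section Frame

variable {M : Type*} [TopologicalSpace M] [ChartedSpace E2 M] [IsManifold (𝓡 2) ∞ M]
  {U : Set M} {F : M → ContactElement}

theorem IsLegendreImmersion.isLineField (hF : IsLegendreImmersion U F) :
    IsLineField U F (fun x => sphereVec (F x).pt 0) (fun x => (F x).dir) where
  smooth₀ := hF.smooth_pt.clm spaceIncl
  smooth₁ := ((hF.smooth_normal.neg.clm spaceIncl).add (SmoothOn.const (sphereVec 0 1))).congr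
    fun x _ => by
      rw [spaceIncl_apply, ← sphereVec_add, add_zero, zero_add, ContactElement.dir]
  mem p _ := dir_mem_lightCone _
  line p _ := (F p).line_eq

/-- A smooth square root of a nonvanishing complex function. -/
theorem exists_smooth_sqrt (hU : IsOpen U) {h : M → ℂ} (hh : SmoothOn U h) {p : M} (hp : p ∈ U)
    (h0 : h p ≠ 0) : ∃ (V : Set M) (g : M → ℂ), IsOpen V ∧ p ∈ V ∧ V ⊆ U ∧ SmoothOn V g ∧
      ∀ x ∈ V, g x ≠ 0 ∧ g x ^ 2 = h x := by
  -- Dividing by h(p) moves the values near 1, where the principal logarithm is smooth.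
  obtain ⟨c, hc⟩ := IsAlgClosed.exists_pow_nat_eq (h p) (n := 2) (by norm_num)
  have hc0 : c ≠ 0 := by rintro rfl; exact h0 (by rw [← hc]; simp)
  have hquot : SmoothOn U (fun x => h x * (h p)⁻¹) := hh.mul (SmoothOn.const _)
  have hV : IsOpen (U ∩ (fun x => h x * (h p)⁻¹) ⁻¹' Complex.slitPlane) :=
    hquot.continuousOn.isOpen_inter_preimage hU Complex.isOpen_slitPlane
  refine ⟨_, fun x => c * Complex.exp (Complex.log (h x * (h p)⁻¹) / 2), hV, ⟨hp, ?_⟩,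
    inter_subset_left, ?_, fun x hx => ⟨mul_ne_zero hc0 (Complex.exp_ne_zero _), ?_⟩⟩
  · show h p * (h p)⁻¹ ∈ Complex.slitPlane
    rw [mul_inv_cancel₀ h0]
    exact Complex.one_mem_slitPlane
  · refine (hquot.mono inter_subset_left).comp (Φ := fun w => c * Complex.exp (Complex.log w / 2))
      fun x hx => ?_
    have h1 : ContDiffAt ℝ ∞ Complex.log (h x * (h p)⁻¹) :=
      (Complex.contDiffAt_log (n := ∞) hx.2).restrict_scalars ℝ
    have h2 : ContDiff ℝ ∞ Complex.exp := (Complex.contDiff_exp (𝕜 := ℂ)).restrict_scalars ℝ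
    exact contDiffAt_const.mul (h2.contDiffAt.comp _ (h1.div_const 2))
  · have hx0 : h x * (h p)⁻¹ ≠ 0 := Complex.slitPlane_ne_zero hx.2
    rw [mul_pow, hc, ← Complex.exp_nat_mul]
    rw [show ((2 : ℕ) : ℂ) * (Complex.log (h x * (h p)⁻¹) / 2) = Complex.log (h x * (h p)⁻¹) by
      push_cast; ring, Complex.exp_log hx0]
    field_simp

end Frame

/-! ### Principal frames around points where the polarization does not vanish -/

section LocalFrame

variable {M : Type*} [TopologicalSpace M] [ChartedSpace E2 M] [IsManifold (𝓡 2) ∞ M]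
  {U : Set M} {F : M → ContactElement}

theorem smoothOn_dd_dualFrame (hU : IsOpen U) {θ θ' : (x : M) → T x →L[ℝ] ℝ}
    (hθ : SmoothForm U θ) (hθ' : SmoothForm U θ') {e e' : (x : M) → T x}
    (hd : ∀ x ∈ U, IsDualFrame (θ x) (θ' x) (e x) (e' x)) {n : ℕ} {f : M → Fin n → ℝ}
    (hf : SmoothOn U f) :
    SmoothOn U (fun x => dd f x (e x)) ∧ SmoothOn U (fun x => dd f x (e' x)) := by
  have hk := fun k => smoothOn_apply_dualFrame hU hθ hθ' (HasExtDeriv.dd (hf.apply k) hU).smooth hd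
  exact ⟨SmoothOn.pi fun k => (hk k).1.congr fun x hx =>
      (dd_apply (hf.mdifferentiableAt hU hx) k (e x)).symm,
    SmoothOn.pi fun k => (hk k).2.congr fun x hx =>
      (dd_apply (hf.mdifferentiableAt hU hx) k (e' x)).symm⟩

/-- Around a point where it does not vanish a holomorphic quadratic differential is the square of
a smooth form of type `(1,0)`. -/
theorem IsPolarization.exists_frame {J : (x : M) → T x →L[ℝ] T x} {q : (x : M) → T x → ℂ}
    (hq : IsPolarization U J q) {p : M} (hp : p ∈ U) (h0 : q p ≠ 0) :
    ∃ (V : Set M) (e e' : (x : M) → T x), IsOpen V ∧ p ∈ V ∧ V ⊆ U ∧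
      (∀ {n : ℕ} {f : M → Fin n → ℝ}, SmoothOn V f →
        SmoothOn V (fun x => dd f x (e x)) ∧ SmoothOn V (fun x => dd f x (e' x))) ∧
      ∀ x ∈ V, (∀ X, ∃ s t : ℝ, X = s • e x + t • e' x) ∧ J x (e x) = e' x ∧
        J x (e' x) = -e x ∧ e x ≠ 0 ∧
        ∀ s t : ℝ, q x (s • e x + t • e' x) = ((s : ℂ) + t * Complex.I) ^ 2 := by
  obtain ⟨W, hW, hpW, hWU, z, h, hz, hh, hzh⟩ := hq.holomorphic p hp
  have hhp : h p ≠ 0 := fun hh0 => h0 (funext fun X => by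
    rw [(hzh p hpW).2.2.2, hh0, zero_mul, Pi.zero_apply])
  obtain ⟨V, g, hV, hpV, hVW, hg, hgh⟩ := exists_smooth_sqrt hW hh hpW hhp
  replace hz := hz.mono hVW
  have hzr := hz.clm Complex.reCLM
  have hzi := hz.clm Complex.imCLM
  have hgr := hg.clm Complex.reCLM
  have hgi := hg.clm Complex.imCLM
  -- With g² = h, the forms θ and θ' are the real and imaginary parts of g dz, so q = (θ + iθ')².
  let θ : (x : M) → T x →L[ℝ] ℝ := fun x => (g x).re • dd (fun y => Complex.reCLM (z y)) x -
    (g x).im • dd (fun y => Complex.imCLM (z y)) x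
  let θ' : (x : M) → T x →L[ℝ] ℝ := fun x => (g x).re • dd (fun y => Complex.imCLM (z y)) x +
    (g x).im • dd (fun y => Complex.reCLM (z y)) x
  have hθ : SmoothForm V θ :=
    ((HasExtDeriv.smul_dd hgr hzr hV).sub (HasExtDeriv.smul_dd hgi hzi hV) hV).smooth
  have hθ' : SmoothForm V θ' :=
    ((HasExtDeriv.smul_dd hgr hzi hV).add (HasExtDeriv.smul_dd hgi hzr hV) hV).smooth
  have hψ : ∀ x ∈ V, ∀ X, g x * dd z x X = (θ x X : ℂ) + (θ' x X : ℂ) * Complex.I := by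
    intro x hx X
    simp only [θ, θ', _root_.add_apply, _root_.sub_apply, _root_.smul_apply,
      dd_clm _ (hz.mdifferentiableAt hV hx), smul_eq_mul]
    apply Complex.ext <;> simp
  have hinj : ∀ x ∈ V, ∀ X, θ x X = 0 → θ' x X = 0 → X = 0 := by
    intro x hx X h1 h2
    refine (hzh x (hVW hx)).1 X ?_
    have := hψ x hx X
    rw [h1, h2] at this
    simp at this
    exact this.resolve_left (hgh x hx).1
  have hJ : ∀ x ∈ V, ∀ X, θ x (J x X) = -θ' x X ∧ θ' x (J x X) = θ x X := by
    intro x hx X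
    have h1 := hψ x hx (J x X)
    rw [(hzh x (hVW hx)).2.1, mul_left_comm, hψ x hx X] at h1
    have h2 := congrArg Complex.re h1
    have h3 := congrArg Complex.im h1
    simp at h2 h3
    exact ⟨h2.symm, h3.symm⟩
  have hex : ∀ x, ∃ w : T x × T x, x ∈ V → IsDualFrame (θ x) (θ' x) w.1 w.2 := by
    intro x
    by_cases hx : x ∈ V
    · obtain ⟨e, e', hd⟩ := exists_isDualFrame (hinj x hx)
      exact ⟨(e, e'), fun _ => hd⟩
    · exact ⟨(0, 0), fun h => absurd h hx⟩
  choose w hd using hex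
  refine ⟨V, fun x => (w x).1, fun x => (w x).2, hV, hpV, fun x hx => hWU (hVW hx),
    fun hf => smoothOn_dd_dualFrame hV hθ hθ' hd hf, fun x hx => ⟨fun X => ⟨_, _, (hd x hx).expand X⟩,
      ?_, ?_, fun he => ?_, fun s t => ?_⟩⟩
  · rw [(hd x hx).expand (J x (w x).1), (hJ x hx _).1, (hJ x hx _).2, (hd x hx).left,
      (hd x hx).left']
    simp
  · rw [(hd x hx).expand (J x (w x).2), (hJ x hx _).1, (hJ x hx _).2, (hd x hx).right,
      (hd x hx).right']
    simp
  · have := (hd x hx).left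
    rw [show (w x).1 = 0 from he, map_zero] at this
    simp at this
  · rw [(hzh x (hVW hx)).2.2.2, ← (hgh x hx).2, ← mul_pow, hψ x hx]
    simp only [map_add, map_smul, (hd x hx).left, (hd x hx).left', (hd x hx).right,
      (hd x hx).right', smul_eq_mul]
    simp

/-- An L-isothermic immersion has principal frames in which the polarization is real around every
point where the polarization does not vanish. -/
theorem exists_isPrincipalFraming {J : (x : M) → T x →L[ℝ] T x} {q : (x : M) → T x → ℂ}
    {μ : M → ℝ} (hU : IsOpen U) (hF : IsLIsothermicWith U F J q μ) {p : M} (hp : p ∈ U)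
    (h0 : q p ≠ 0) :
    ∃ (V : Set M) (A : FrameField M), IsOpen V ∧ p ∈ V ∧ V ⊆ U ∧ IsPrincipalFraming V F A ∧
      ∀ x ∈ V, q x ≠ 0 ∧ ∀ X : T x, A.conn x 2 0 X = 0 → (q x X).im = 0 := by
  obtain ⟨V, e, e', hV, hpV, hVU, hsm, hfr⟩ := hF.polarization.exists_frame hp h0
  have hFV := hF.mono hV hVU
  have hL := hFV.legendre.isLineField
  set D := fun x : M => dd (fun x => (F x).dir) x with hD
  have htm : ∀ x : M, tm (F x).dir = 1 := fun x => (F x).tm_dir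
  have hIII : ∀ x ∈ V, ∀ X Y, thirdForm F x X Y = lor (D x X) (D x Y) := by
    intro x hx X Y
    rw [hL.thirdForm_eq hV hx, htm, inv_one, one_pow, one_mul]
  have hc : ∀ x ∈ V, ∀ X : T x, lor (dd (fun x => sphereVec (F x).pt 0) x X) (F x).dir = 0 := by
    intro x hx X
    have h1 := hL.inner_dd_pt_normal hV hx X
    rw [hFV.legendre.contact x hx, htm] at h1
    simpa using h1
  have hII : ∀ x ∈ V, ∀ X Y, secondForm F x X Y =
      lor (dd (fun x => sphereVec (F x).pt 0) x X) (D x Y) := by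
    intro x hx X Y
    rw [hL.secondForm_eq hV hc hx, htm, tm_sphereVec]
    simp [hD]
  set m := fun x => lor (D x (e x)) (D x (e x)) with hm
  have hmpos : ∀ x ∈ V, 0 < m x := fun x hx => by
    have := hFV.third_pos x hx (e x) (hfr x hx).2.2.2.1
    rwa [hIII x hx] at this
  have hconf : ∀ x ∈ V, lor (D x (e' x)) (D x (e' x)) = m x ∧ lor (D x (e x)) (D x (e' x)) = 0 := by
    intro x hx
    obtain ⟨-, hJe, hJe', -, -⟩ := hfr x hx
    have h1 := hFV.conformal x hx (e x)
    have h2 := hFV.conformal x hx (e x + e' x)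
    rw [hJe, hIII x hx, hIII x hx] at h1
    rw [map_add, hJe, hJe', hIII x hx, hIII x hx] at h2
    simp only [map_add, map_neg, lor_add_left, lor_add_right, lor_neg_left, lor_neg_right] at h2
    rw [lor_comm (D x (e' x)) (D x (e x))] at h2
    exact ⟨h1, by linarith⟩
  -- Since q(e) = 1 and q(e') = -1 are real, the imaginary part of the Hopf equation kills the mixed
  -- terms of II. Using both equations avoids proving that II is symmetric.
  have hprin : ∀ x ∈ V, secondForm F x (e x) (e' x) = 0 ∧ secondForm F x (e' x) (e x) = 0 := by
    intro x hx
    obtain ⟨-, hJe, hJe', -, hq⟩ := hfr x hx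
    have h1 := congrArg Complex.im (hFV.hopf x hx (e x))
    have h2 := congrArg Complex.im (hFV.hopf x hx (e' x))
    have q1 : q x (e x) = 1 := by simpa using hq 1 0
    have q2 : q x (e' x) = -1 := by simpa using hq 0 1
    have hneg : secondForm F x (e' x) (-e x) = -secondForm F x (e' x) (e x) := by
      rw [hII x hx, hII x hx, map_neg, lor_neg_right]
    rw [q1, part20, hJe] at h1
    rw [q2, part20, hJe', hneg] at h2
    simp at h1 h2
    exact ⟨h1, h2⟩
  set l := fun x => (Real.sqrt (m x))⁻¹ with hl
  have hl2 : ∀ x ∈ V, l x * l x * m x = 1 := fun x hx => by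
    have h1 := Real.mul_self_sqrt (hmpos x hx).le
    have h2 := (Real.sqrt_pos.2 (hmpos x hx)).ne'
    simp only [hl]
    field_simp
    rw [sq, h1]
  have hlpos : ∀ x ∈ V, 0 < l x := fun x hx => inv_pos.2 (Real.sqrt_pos.2 (hmpos x hx))
  obtain ⟨hDe, hDe'⟩ := hsm hL.smooth₁
  have hsl : SmoothOn V l := ((hDe.lor hDe).comp (Φ := Real.sqrt) fun x hx =>
    Real.contDiffAt_sqrt (hmpos x hx).ne').inv fun x hx => (Real.sqrt_pos.2 (hmpos x hx)).ne'
  -- The fourth vector is the opposite null normal, scaled so that ⟨a₁,a₄⟩ = -1.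
  set N := fun x => (1 / 2 : ℝ) • sphereVec (F x).normal 1 with hN
  have hsN : SmoothOn V N := (SmoothOn.const _).smul
    (((hFV.legendre.smooth_normal.clm spaceIncl).add (SmoothOn.const (sphereVec 0 1))).congr
      fun x _ => by rw [spaceIncl_apply, ← sphereVec_add, add_zero, zero_add])
  set b : M → Fin 4 → R41 := fun x => ![(F x).dir, l x • D x (e x), l x • D x (e' x), N x] with hb
  -- This determinant is ±1 and smooth. Multiplying the third vector by it gives determinant σ² = 1,
  -- so no orientation has to be chosen.
  set σ := fun x => (frameMatrix (b x)).det with hσ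
  have hsb : SmoothOn V b := by
    refine contMDiffOn_pi_space.2 fun j => ?_
    fin_cases j
    · exact hL.smooth₁
    · exact hsl.smul hDe
    · exact hsl.smul hDe'
    · exact hsN
  have hsσ : SmoothOn V σ := hsb.contDiff_comp contDiff_det_frameMatrix
  have htable : ∀ x ∈ V, ∀ s : ℝ, s * s = 1 → ∀ i j,
      lor (![(F x).dir, l x • D x (e x), s • (l x • D x (e' x)), N x] i)
        (![(F x).dir, l x • D x (e x), s • (l x • D x (e' x)), N x] j) =
      lor (Pi.single i 1) (Pi.single j 1) := by
    intro x hx s hs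
    have t00 : lor (F x).dir (F x).dir = 0 := (hL.mem x hx).1
    have t0 : ∀ X, lor (D x X) (F x).dir = 0 := hL.lor_dd_self hV hx
    have hn1 : inner ℝ (F x).normal (F x).normal = 1 := by
      rw [real_inner_self_eq_norm_sq, (F x).norm_normal]; norm_num
    have t03 : lor (F x).dir (N x) = -1 := by
      rw [hN, lor_smul_right, lor_eq_inner, tm_sphereVec, sp_sphereVec, htm, (F x).sp_dir,
        inner_neg_left, hn1]
      norm_num
    have t33 : lor (N x) (N x) = 0 := by
      rw [hN, lor_smul_right, lor_smul_left, lor_eq_inner, tm_sphereVec, sp_sphereVec, hn1]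
      norm_num
    have t3 : ∀ X, lor (D x X) (N x) = 0 := by
      intro X
      have h1 := t0 X
      have h2 : tm (D x X) = 0 := hL.tm_dd_dir hV hx X
      rw [lor_eq_inner, h2, (F x).sp_dir, inner_neg_right] at h1
      rw [hN, lor_smul_right, lor_eq_inner, h2, sp_sphereVec]
      linarith
    have t11 : lor (D x (e x)) (D x (e x)) = m x := rfl
    obtain ⟨t22, t12⟩ := hconf x hx
    have hm1 := hl2 x hx
    have t0' := fun X => (lor_comm (F x).dir (D x X)).trans (t0 X)
    have t3' := fun X => (lor_comm (N x) (D x X)).trans (t3 X)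
    have t30 := (lor_comm (N x) (F x).dir).trans t03
    have t21 := (lor_comm (D x (e' x)) (D x (e x))).trans t12
    intro i j
    fin_cases i <;> fin_cases j <;>
      simp [lor_smul_left, lor_smul_right, t00, t0, t03, t33, t3, t11, t22, t12, t0', t3', t30,
        t21] <;> simp [lor]
    · linarith
    · linear_combination (l x * l x * m x) * hs + hm1
  have hσσ : ∀ x ∈ V, σ x * σ x = 1 := fun x hx => by
    refine sq_det_frameMatrix fun i j => ?_
    have := htable x hx 1 (by norm_num) i j
    rwa [one_smul] at this
  let A : FrameField M :=
    { pos := fun x => sphereVec (F x).pt 0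
      vec := fun x => ![(F x).dir, l x • D x (e x), σ x • (l x • D x (e' x)), N x] }
  have hlor : ∀ x ∈ V, frameMatrix (A.vec x) ∈ properLorentz := by
    intro x hx
    refine frameMatrix_mem_properLorentz (htable x hx _ (hσσ x hx)) ?_ (htm x) ?_ ?_ ?_
    · exact (det_frameMatrix_smul _ _ _ _ _).trans (hσσ x hx)
    · show tm (l x • D x (e x)) = 0
      rw [map_smul, hL.tm_dd_dir hV hx, smul_zero]
    · show tm (σ x • (l x • D x (e' x))) = 0
      rw [map_smul, map_smul, hL.tm_dd_dir hV hx, smul_zero, smul_zero]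
    · show tm (N x) = 1 / 2
      rw [hN, map_smul, tm_sphereVec, smul_eq_mul, mul_one]
  have hsvec : ∀ j, SmoothOn V (fun x => A.vec x j) := by
    intro j
    fin_cases j
    · exact hL.smooth₁
    · exact hsl.smul hDe
    · exact hsσ.smul (hsl.smul hDe')
    · exact hsN
  have hconn : ∀ x ∈ V, ∀ s t : ℝ,
      A.conn x 1 0 (s • e x + t • e' x) = s * (l x * m x) ∧
      A.conn x 2 0 (s • e x + t • e' x) = t * (σ x * l x * m x) ∧
      A.conn₀ x 1 (s • e x + t • e' x) = s * (l x * secondForm F x (e x) (e x)) ∧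
      A.conn₀ x 2 (s • e x + t • e' x) = t * (σ x * l x * secondForm F x (e' x) (e' x)) := by
    intro x hx s t
    have h1 : ∀ X, A.conn x 1 0 X = lor (l x • D x (e x)) (D x X) :=
      fun X => FrameField.conn_apply (hlor x hx) 1 0 X
    have h2 : ∀ X, A.conn x 2 0 X = lor (σ x • (l x • D x (e' x))) (D x X) :=
      fun X => FrameField.conn_apply (hlor x hx) 2 0 X
    have h3 : ∀ X, A.conn₀ x 1 X = l x * secondForm F x X (e x) := fun X =>
      (FrameField.conn₀_apply (hlor x hx) 1 X).trans (by
        rw [hII x hx, lor_comm _ (D x (e x)), ← lor_smul_left]; rfl)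
    have h4 : ∀ X, A.conn₀ x 2 X = σ x * (l x * secondForm F x X (e' x)) := fun X =>
      (FrameField.conn₀_apply (hlor x hx) 2 X).trans (by
        rw [hII x hx, lor_comm _ (D x (e' x)), ← lor_smul_left, ← lor_smul_left]; rfl)
    obtain ⟨t22, t12⟩ := hconf x hx
    have t21 := (lor_comm (D x (e' x)) (D x (e x))).trans t12
    have t11 : lor (D x (e x)) (D x (e x)) = m x := rfl
    obtain ⟨k1, k2⟩ := hprin x hx
    rw [hII x hx] at k1 k2
    simp only [map_add, map_smul, smul_eq_mul, h1, h2, h3, h4, hII x hx, k1, k2, lor_smul_left,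
      lor_smul_right, lor_add_right, lor_add_left, t11, t12, t21, t22]
    refine ⟨by ring, by ring, by ring, by ring⟩
  refine ⟨V, A, hV, hpV, hVU, ⟨hL.smooth₀, hsvec, hlor, fun x hx => ((F x).line_eq).symm,
    fun x hx X Y => ?_, fun x hx X Y => ?_⟩, fun x hx => ⟨fun hq0 => ?_, fun X hX => ?_⟩⟩
  · obtain ⟨s, t, rfl⟩ := (hfr x hx).1 X
    obtain ⟨s', t', rfl⟩ := (hfr x hx).1 Y
    rw [(hconn x hx s t).1, (hconn x hx s t).2.2.1, (hconn x hx s' t').1,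
      (hconn x hx s' t').2.2.1]
    ring
  · obtain ⟨s, t, rfl⟩ := (hfr x hx).1 X
    obtain ⟨s', t', rfl⟩ := (hfr x hx).1 Y
    rw [(hconn x hx s t).2.1, (hconn x hx s t).2.2.2, (hconn x hx s' t').2.1,
      (hconn x hx s' t').2.2.2]
    ring
  · have h1 := (hfr x hx).2.2.2.2 1 0
    rw [hq0] at h1
    simp at h1
  · obtain ⟨s, t, rfl⟩ := (hfr x hx).1 X
    rw [(hconn x hx s t).2.1] at hX
    have hσ0 : σ x ≠ 0 := fun h0 => by
      have := hσσ x hx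
      rw [h0] at this
      simp at this
    have ht : t = 0 := (mul_eq_zero.1 hX).resolve_right
      (mul_ne_zero (mul_ne_zero hσ0 (hlpos x hx).ne') (hmpos x hx).ne')
    rw [(hfr x hx).2.2.2.2, ht]
    rw [Complex.ofReal_zero, zero_mul, add_zero, ← Complex.ofReal_pow, Complex.ofReal_im]

end LocalFrame

/-! ### Assembly of the theorem -/

section Main

variable {M : Type*} [TopologicalSpace M] [ChartedSpace E2 M] [IsManifold (𝓡 2) ∞ M]
  {U W : Set M} {F : M → ContactElement} {A : FrameField M} {ρ : M → ℝ}
  {J : (x : M) → T x →L[ℝ] T x} {q : (x : M) → T x → ℂ} {μ : M → ℝ}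

/-- A solution of the linear system defines a Bianchi–Darboux transform. -/
theorem exists_transform (hF : IsLIsothermicWith univ F J q μ) (hU : IsOpen U)
    (hA : IsPrincipalFraming U F A) (hρ : IsPotential U A ρ) (hW : IsOpen W) (hWU : W ⊆ U)
    {v : M → R41} (hv : IsSolution W A ρ v) (hcone : ∀ p ∈ W, v p ∈ lightCone) :
    IsClosedForm W (A.gam v) ∧
      ∀ r : M → ℝ, SmoothOn W r → (∀ p ∈ W, dd r p = A.gam v p) → (∀ p ∈ W, v p 3 ≠ 0) →
        ∃ G : M → ContactElement,
          (∀ p ∈ W, (G p).line = affLine (A.congr v r p) (∑ i, v p i • A.vec p i)) ∧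
          IsLIsothermic W G ∧
          ((∀ p ∈ W, Function.Injective (dd (A.congr v r) p)) →
            IsNondegenerateDarboux W (A.congr v r) F G ∧ IsBianchiDarboux W F G) := by
  have hFW := hF.mono hW (subset_univ _)
  have hAW := hA.mono hWU
  obtain ⟨e, e', hd⟩ := hAW.exists_dualFrame hW hFW.third_pos
  have h : IsDarbouxData W F A ρ v e e' :=
    ⟨hW, hAW, hFW.legendre, hd, hρ.mono hWU, hv, hcone⟩
  refine ⟨h.hasExtDeriv_gam.isClosedForm hW, fun r hr hdr hv3 => ?_⟩
  have hex : ∀ x, ∃ c : ContactElement, x ∈ W → c.line = affLine (A.congr v r x) (A.comb v x) := by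
    intro x
    by_cases hx : x ∈ W
    · obtain ⟨c, hc⟩ := exists_contactElement (b₀ := A.congr v r x) (h.comb_mem hx)
      exact ⟨c, fun _ => hc⟩
    · exact ⟨F x, fun h => absurd h hx⟩
  choose G hG using hex
  have hiso := h.isLIsothermic_transform hr hv3 hdr hG
  refine ⟨G, hG, hiso, fun hinj => ?_⟩
  have hD := h.isNondegenerateDarboux hr hv3 hdr hG hinj
  exact ⟨hD, ⟨J, q, μ, hFW⟩, hiso, _, hD⟩

/-- In the frame built from a square root of q the polarization is real at every point, so ρ exists
with no condition on the zeros of μ. -/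
theorem exists_local_transform (hF : IsLIsothermicWith univ F J q μ) {p : M} (hp : q p ≠ 0) :
    ∃ U : Set M, IsOpen U ∧ p ∈ U ∧
      (∃ (A : FrameField M) (ρ : M → ℝ), IsPrincipalFraming U F A ∧ IsPotential U A ρ) ∧
      ∃ G : M → ContactElement, IsBianchiDarboux U F G := by
  obtain ⟨V, A, hV, hpV, -, hA, hq⟩ := exists_isPrincipalFraming isOpen_univ hF (mem_univ p) hp
  have hFV := hF.mono hV (subset_univ _)
  obtain ⟨e, e', hd⟩ := hA.exists_dualFrame hV hFV.third_pos
  obtain ⟨ρ, hρ⟩ := exists_isPotential hF hV hA hd (fun x hx => (hq x hx).1)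
    fun x hx _ => (hq x hx).2 _ (hd x hx).left'
  obtain ⟨W, v, r, hW, hpW, hWV, hv, hcone, hr, hdr, hinj⟩ :=
    exists_transform_data hV hA hFV.legendre hρ hd hpV
  obtain ⟨G, -, -, hG⟩ := (exists_transform hF hV hA hρ hW hWV hv fun x hx => (hcone x hx).1).2 r hr
    hdr fun x hx => (hcone x hx).2
  exact ⟨W, hW, hpW, ⟨A, ρ, hA.mono hWV, hρ.mono hWV⟩, G, (hG hinj).2⟩

end Main

end Laguerre

end

theorem theorem3 {M : Type*} [TopologicalSpace M] [ChartedSpace E2 M] [IsManifold (𝓡 2) ∞ M]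
    (F : M → ContactElement) (J : (x : M) → T x →L[ℝ] T x) (q : (x : M) → T x → ℂ) (μ : M → ℝ)
    (hF : IsLIsothermicWith univ F J q μ) :
    (∀ (U : Set M) (A : FrameField M), IsOpen U → IsPrincipalFraming U F A →
      -- existence of `ρ`
      ((∀ p ∈ U, q p ≠ 0) →
        (∀ p ∈ U, (∀ᶠ x in 𝓝 p, μ x = 0) → ∀ X : T p, A.conn p 2 0 X = 0 → (q p X).im = 0) →
        ∃ ρ, IsPotential U A ρ) ∧
      ∀ ρ : M → ℝ, IsPotential U A ρ →
        -- complete integrability of `dv = -α'_ρ v`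
        (∀ p ∈ U, ∀ v₀ : R41, ∃ (W : Set M) (v : M → R41), IsOpen W ∧ p ∈ W ∧ W ⊆ U ∧
          IsSolution W A ρ v ∧ v p = v₀ ∧ (v₀ ∈ lightCone → ∀ x ∈ W, v x ∈ lightCone)) ∧
        -- the transform defined by a solution
        (∀ (W : Set M) (v : M → R41), IsOpen W → W ⊆ U → IsSolution W A ρ v →
          (∀ p ∈ W, v p ∈ lightCone) →
          IsClosedForm W (A.gam v) ∧
          ∀ r : M → ℝ, SmoothOn W r → (∀ p ∈ W, dd r p = A.gam v p) → (∀ p ∈ W, v p 3 ≠ 0) →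
            ∃ G : M → ContactElement,
              (∀ p ∈ W, (G p).line = affLine (A.congr v r p) (∑ i, v p i • A.vec p i)) ∧
              IsLIsothermic W G ∧
              ((∀ p ∈ W, Function.Injective (dd (A.congr v r) p)) →
                IsNondegenerateDarboux W (A.congr v r) F G ∧ IsBianchiDarboux W F G)) ∧
        -- existence of such transforms around every point
        (∀ p ∈ U, ∃ (W : Set M) (v : M → R41) (r : M → ℝ), IsOpen W ∧ p ∈ W ∧ W ⊆ U ∧
          IsSolution W A ρ v ∧ (∀ x ∈ W, v x ∈ lightCone ∧ v x 3 ≠ 0) ∧ SmoothOn W r ∧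
          (∀ x ∈ W, dd r x = A.gam v x) ∧
          ∀ x ∈ W, Function.Injective (dd (A.congr v r) x))) ∧
    -- principal frames, functions `ρ` and Bianchi–Darboux transforms exist locally
    (∀ p : M, q p ≠ 0 → ∃ U : Set M, IsOpen U ∧ p ∈ U ∧
      (∃ (A : FrameField M) (ρ : M → ℝ), IsPrincipalFraming U F A ∧ IsPotential U A ρ) ∧
      ∃ G : M → ContactElement, IsBianchiDarboux U F G) := by
  refine ⟨fun U A hU hA => ?_, fun p hp => exists_local_transform hF hp⟩
  have hFU := hF.mono hU (subset_univ _)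
  obtain ⟨e, e', hd⟩ := hA.exists_dualFrame hU hFU.third_pos
  refine ⟨fun hq hreal => exists_isPotential hF hU hA hd hq fun p hp hμ =>
      hreal p hp hμ _ (hd p hp).left', fun ρ hρ => ⟨fun p hp v₀ => exists_isSolution hU hA hρ hp v₀,
    fun W v hW hWU hv hcone => exists_transform hF hU hA hρ hW hWU hv hcone,
    fun p hp => exists_transform_data hU hA hFU.legendre hρ hd hp⟩⟩
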